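/- **Setting.** Let $X$ (states) and $A$ (actions) be finite sets. $X$ is partitioned into layers $X_0=\{x_0\},X_1,\dots,X_L=\{x_L\}$, and $P$ is a transition function, unknown to the learner, with $P(x'\mid x,a)>0$ only if $x\in X_k$, $x'\in X_{k+1}$ for some $k<L$. There are $m$ constraints with thresholds $\alpha\in[0,L]^m$ and $T\ge 1$ episodes. An adversary fixes sequences of distributions $\mathcal R_t$ on $[0,1]^{X\times A}$ and $\mathcal G_t$ on $[0,1]^{X\times A\times m}$, $t\in[T]$. In episode $t$ the learner picks a policy $\pi_t(\cdot\mid x)$ from the past; a reward vector $r_t\sim\mathcal R_t$ and a cost matrix $G_t=(g_{t,i})_{i\in[m]}\sim\mathcal G_t$ are drawn independently of the past; from $x_0$, for $k=0,\dots,L-1$, the learner plays $a_k\sim\pi_t(\cdot\mid x_k)$, observes $r_t(x_k,a_k)$ and $g_{t,i}(x_k,a_k)$, $i\in[m]$, and moves to $x_{k+1}\sim P(\cdot\mid x_k,a_k)$. For a policy $\pi$ let $q^{P,\pi}(x,a,x')=\mathbb P[x_k=x,a_k=a,x_{k+1}=x'\mid P,\pi]$ for $x\in X_k$ be its occupancy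 measure; put $q(x,a)=\sum_{x'}q(x,a,x')$, $q(x)=\sum_a q(x,a)$, $v^\top q=\sum_{x,a}v(x,a)q(x,a)$, and let $\Delta(P)$ be the set of all $q^{P,\pi}$. With $\overline r=\frac1T\sum_{t\le T}\mathbb E[r_t]$ and $\overline G=\frac1T\sum_{t\le T}\mathbb E[G_t]$, assume that some $q\in\Delta(P)$ satisfies $\overline G^\top q\le\alpha$. The regret is $$R_T=T\max\{\overline r^\top q: q\in\Delta(P),\ \overline G^\top q\le\alpha\}-\sum_{t=1}^T\mathbb E[r_t]^\top q^{P,\pi_t}.$$ The corruption is $C^\star=\max\{C_G,C_r\}$ with $C_r=\min_{r\in[0,1]^{X\times A}}\sum_{t\le T}\|\mathbb E[r_t]-r\|_1$ and $C_G=\min_{g\in[0,1]^{X\times A\times m}}\sum_{t\le T}\max_{i\in[m]}\|\mathbb E[g_{t,i}]-g_i\|_1$. **Algorithm NS-SOPS** (inputs $\delta\in(0,1)$ and a corruption value $C$). The first policy $\pi_1$ is arbitrary. At the end of episode $t$, let $N_t(x,a)$ be the number of visits to $(x,a)$ in episodes $1,\dots,t$, let $M_t(x,a,x')$ be the number of those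 visits followed by $x'$, let $\widehat r_t(x,a)$ and $\widehat g_{t,i}(x,a)$ be the sums of the rewards and costs observed at these visits divided by $\max\{N_t(x,a),1\}$, and let $\overline P_t(x'\mid x,a)=M_t(x,a,x')/\max\{1,N_t(x,a)\}$. Put $$\phi_t=\min\Big\{1,\sqrt{\tfrac{\ln(2T|X||A|/\delta)}{2\max\{N_t,1\}}}+\tfrac{C}{\max\{N_t,1\}}+\tfrac CT\Big\},\quad \xi_t=\min\Big\{1,\sqrt{\tfrac{\ln(2mT|X||A|/\delta)}{2\max\{N_t,1\}}}+\tfrac{C}{\max\{N_t,1\}}+\tfrac CT\Big\},$$ $$\epsilon_t(x'\mid x,a)=2\sqrt{\tfrac{\overline P_t(x'\mid x,a)\ln(T|X||A|/\delta)}{\max\{1,N_t(x,a)-1\}}}+\tfrac{14\ln(T|X||A|/\delta)}{3\max\{1,N_t(x,a)-1\}}.$$ Let $\Delta(\mathcal P_t)$ be the set of $q\ge0$, supported on triples $(x,a,x')$ in consecutive layers, with total mass $1$ on each layer $X_0,\dots,X_{L-1}$, with $\sum_{a,x'}q(x,a,x')=\sum_{x',a}q(x',a,x)$ for $x$ in an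 intermediate layer, and with $|q(x,a,x')-\overline P_t(x'\mid x,a)\,q(x,a)|\le\epsilon_t(x'\mid x,a)\,q(x,a)$. The algorithm takes a maximizer $\widehat q_{t+1}$ of $(\widehat r_t+\phi_t)^\top q$ over the $q\in\Delta(\mathcal P_t)$ with $(\widehat g_{t,i}-\xi_t)^\top q\le\alpha_i$ for all $i$ or, if there is no such $q$, any $\widehat q_{t+1}\in\Delta(\mathcal P_t)$; ties are broken arbitrarily. It then plays $\pi_{t+1}(a\mid x)=\widehat q_{t+1}(x,a)/\widehat q_{t+1}(x)$ (arbitrary where $\widehat q_{t+1}(x)=0$). **Theorem.** There is an absolute constant $K>0$ such that, in every such setting, for every $\delta\in(0,1)$ and every $C\ge C^\star$ (in particular for $C=C^\star$, the case in which the corruption is known), NS-SOPS with inputs $\delta$ and $C$ satisfies, with probability at least $1-9\delta$, $$R_T\le K\Big(L|X||A|\sqrt{T\ln\big(T|X||A|/\delta\big)}+\ln(T)\,|X||A|\,C\Big).$$ -/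

import Mathlib

open MeasureTheory ProbabilityTheory

universe u v w

noncomputable section

namespace CMDP

/-- A partition of the state space into layers `X₀, …, X_L`, whose first and last layers are
the singletons `{start}` and `{terminal}`. -/
structure Layering (X : Type*) (L : ℕ) where
  layer : X → Fin (L + 1)
  start : X
  terminal : X
  layer_eq_zero_iff : ∀ x, layer x = 0 ↔ x = start
  layer_eq_last_iff : ∀ x, layer x = Fin.last L ↔ x = terminal

/-- An environment with `m` constraints: a loop-free transition function, the sequences of reward
and cost distributions selected by the adversary (the distributions used at episode `t = 1, 2, …`
are `rewardLaw t` and `costLaw t`), and the thresholds. -/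
structure Environment (X A : Type*) [Fintype X] (m L : ℕ) extends Layering X L where
  /-- `P x a x'` is the probability of moving to `x'` when `a` is played in `x`. -/
  P : X → A → X → ℝ
  P_nonneg : ∀ x a x', 0 ≤ P x a x'
  P_sum : ∀ x a, layer x ≠ Fin.last L → ∑ x', P x a x' = 1
  P_loopfree : ∀ x a x', P x a x' ≠ 0 → (layer x' : ℕ) = layer x + 1
  rewardLaw : ℕ → Measure (X → A → ℝ)
  rewardLaw_prob : ∀ t, IsProbabilityMeasure (rewardLaw t)
  rewardLaw_mem : ∀ t, ∀ᵐ r ∂(rewardLaw t), ∀ x a, r x a ∈ Set.Icc (0 : ℝ) 1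
  costLaw : ℕ → Measure (Fin m → X → A → ℝ)
  costLaw_prob : ∀ t, IsProbabilityMeasure (costLaw t)
  costLaw_mem : ∀ t, ∀ᵐ g ∂(costLaw t), ∀ i x a, g i x a ∈ Set.Icc (0 : ℝ) 1
  /-- thresholds of the constraints -/
  α : Fin m → ℝ
  α_mem : ∀ i, α i ∈ Set.Icc (0 : ℝ) L

/-- `π x a` is the probability of playing `a` in `x`. -/
def IsPolicy {X A : Type*} [Fintype A] (π : X → A → ℝ) : Prop :=
  (∀ x a, 0 ≤ π x a) ∧ ∀ x, ∑ a, π x a = 1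

/-- The states `x₀, …, x_L` and the actions `a₀, …, a_{L-1}` of one episode. -/
abbrev Trajectory (X A : Type*) (L : ℕ) := (Fin (L + 1) → X) × (Fin L → A)

/-- The pair `(x, a)` is visited. -/
def Trajectory.Visits {X A : Type*} {L : ℕ} (s : Trajectory X A L) (x : X) (a : A) : Prop :=
  ∃ k : Fin L, s.1 k.castSucc = x ∧ s.2 k = a

/-- The pair `(x, a)` is visited and the next state is `x'`. -/
def Trajectory.Moves {X A : Type*} {L : ℕ} (s : Trajectory X A L) (x : X) (a : A) (x' : X) :
    Prop :=
  ∃ k : Fin L, s.1 k.castSucc = x ∧ s.2 k = a ∧ s.1 k.succ = x'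

/-- All that is sampled in one episode. -/
structure Episode (X A : Type*) (m L : ℕ) where
  traj : Trajectory X A L
  reward : X → A → ℝ
  cost : Fin m → X → A → ℝ

/-- `q(x, a) = ∑_{x'} q(x, a, x')`. -/
def pairOcc {X A : Type*} [Fintype X] (q : X → A → X → ℝ) (x : X) (a : A) : ℝ :=
  ∑ x', q x a x'

/-- `q(x) = ∑_a q(x, a)`. -/
def stateOcc {X A : Type*} [Fintype X] [Fintype A] (q : X → A → X → ℝ) (x : X) : ℝ :=
  ∑ a, pairOcc q x a

/-- The inner product `vᵀ q` of a vector on state-action pairs and an occupancy measure. -/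
def pairing {X A : Type*} [Fintype X] [Fintype A] (v : X → A → ℝ) (q : X → A → X → ℝ) : ℝ :=
  ∑ x, ∑ a, v x a * pairOcc q x a

/-- `π` is a policy induced by `q`, that is `π(a|x) = q(x, a) / q(x)`; it is arbitrary at the
states with `q(x) = 0`, where the quotient has no meaning. -/
def IsInducedPolicy {X A : Type*} [Fintype X] [Fintype A] (q : X → A → X → ℝ) (π : X → A → ℝ) :
    Prop :=
  IsPolicy π ∧ ∀ x a, stateOcc q x ≠ 0 → π x a = pairOcc q x a / stateOcc q x

namespace Environment

variable {X A : Type*} [Fintype X] [Fintype A] [DecidableEq X] [DecidableEq A] {m L : ℕ}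

/-- Probability of a trajectory when the policy `π` is played: `x₀` is the initial state,
`a_k ∼ π(·|x_k)` and `x_{k+1} ∼ P(·|x_k, a_k)`. -/
def trajProb (E : Environment X A m L) (π : X → A → ℝ) (s : Trajectory X A L) : ℝ :=
  (if s.1 0 = E.start then 1 else 0) *
    ∏ k : Fin L, (π (s.1 k.castSucc) (s.2 k) * E.P (s.1 k.castSucc) (s.2 k) (s.1 k.succ))

/-- The occupancy measure `q^{P,π}(x, a, x') = ℙ[x_k = x, a_k = a, x_{k+1} = x' | P, π]`, where `k`
is the layer of `x` (and `0` if `x` is the terminal state). -/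
def occ (E : Environment X A m L) (π : X → A → ℝ) (x : X) (a : A) (x' : X) : ℝ :=
  ∑ k : Fin L, if k.castSucc = E.layer x then
    ∑ s : Trajectory X A L,
      if s.1 k.castSucc = x ∧ s.2 k = a ∧ s.1 k.succ = x' then E.trajProb π s else 0
  else 0

/-- `Δ(P)`, the set of valid occupancy measures. -/
def occSet (E : Environment X A m L) : Set (X → A → X → ℝ) :=
  {q | ∃ π, IsPolicy π ∧ q = E.occ π}

/-- The feasible set of the offline program with cost matrix `G`. -/
def feasibleSet (E : Environment X A m L) (G : Fin m → X → A → ℝ) : Set (X → A → X → ℝ) :=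
  {q | q ∈ E.occSet ∧ ∀ i, pairing (G i) q ≤ E.α i}

/-- The value of the offline program with reward vector `r` and cost matrix `G`. -/
def opt (E : Environment X A m L) (r : X → A → ℝ) (G : Fin m → X → A → ℝ) : ℝ :=
  sSup (pairing r '' E.feasibleSet G)

/-- `𝔼[r_t]` -/
def meanReward (E : Environment X A m L) (t : ℕ) (x : X) (a : A) : ℝ :=
  ∫ r, r x a ∂(E.rewardLaw t)

/-- `𝔼[g_{t,i}]` -/
def meanCost (E : Environment X A m L) (t : ℕ) (i : Fin m) (x : X) (a : A) : ℝ :=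
  ∫ g, g i x a ∂(E.costLaw t)

/-- The average over the `T` episodes of the mean rewards. -/
def avgReward (E : Environment X A m L) (T : ℕ) (x : X) (a : A) : ℝ :=
  (1 / (T : ℝ)) * ∑ t ∈ Finset.Icc 1 T, E.meanReward t x a

/-- The average over the `T` episodes of the mean costs. -/
def avgCost (E : Environment X A m L) (T : ℕ) (i : Fin m) (x : X) (a : A) : ℝ :=
  (1 / (T : ℝ)) * ∑ t ∈ Finset.Icc 1 T, E.meanCost t i x a

/-- The corruption `C_r` of the rewards. -/
def corruptionReward (E : Environment X A m L) (T : ℕ) : ℝ :=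
  ⨅ r : X → A → unitInterval, ∑ t ∈ Finset.Icc 1 T, ∑ x, ∑ a, |E.meanReward t x a - r x a|

/-- The corruption `C_G` of the costs. Every constraint has its own uncorrupted cost vector. -/
def corruptionCost (E : Environment X A m L) (T : ℕ) : ℝ :=
  ⨅ g : Fin m → X → A → unitInterval, ∑ t ∈ Finset.Icc 1 T, ⨆ i, ∑ x, ∑ a,
    |E.meanCost t i x a - g i x a|

/-- The total corruption `max {C_G, C_r}`. -/
def corruption (E : Environment X A m L) (T : ℕ) : ℝ :=
  max (E.corruptionCost T) (E.corruptionReward T)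

/-- The regret `R_T` of the sequence of policies `π₁, …, π_T`. -/
def regret (E : Environment X A m L) (T : ℕ) (π : ℕ → X → A → ℝ) : ℝ :=
  T * E.opt (E.avgReward T) (E.avgCost T)
    - ∑ t ∈ Finset.Icc 1 T, pairing (E.meanReward t) (E.occ (π t))

/-- The random policies `π t` and episodes `H t`, `t = 1, …, T`, follow the interaction protocol;
`ℋ t` is the information available after `t` episodes. The policy of the next episode is
determined by the past; the rewards and the costs have the laws selected by the adversary and are
independent of the past; given the past, the rewards and the costs, the trajectory is the one
generated by the policy and the transition function. -/
structure IsInteraction (E : Environment X A m L) (T : ℕ) {Ω : Type*} {mΩ : MeasurableSpace Ω}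
    (μ : Measure Ω) (ℋ : Filtration ℕ mΩ) (π : ℕ → Ω → X → A → ℝ)
    (H : ℕ → Ω → Episode X A m L) : Prop where
  policy_measurable : ∀ t < T, Measurable[ℋ t] (π (t + 1))
  policy : ∀ t < T, ∀ᵐ ω ∂μ, IsPolicy (π (t + 1) ω)
  traj_measurable : ∀ t < T, ∀ s, MeasurableSet[ℋ (t + 1)] {ω | (H (t + 1) ω).traj = s}
  reward_measurable : ∀ t < T, Measurable[ℋ (t + 1)] (fun ω => (H (t + 1) ω).reward)
  cost_measurable : ∀ t < T, Measurable[ℋ (t + 1)] (fun ω => (H (t + 1) ω).cost)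
  reward_law : ∀ t < T, μ.map (fun ω => (H (t + 1) ω).reward) = E.rewardLaw (t + 1)
  cost_law : ∀ t < T, μ.map (fun ω => (H (t + 1) ω).cost) = E.costLaw (t + 1)
  indep_past : ∀ t < T, Indep
    (MeasurableSpace.comap (fun ω => ((H (t + 1) ω).reward, (H (t + 1) ω).cost)) inferInstance)
    (ℋ t) μ
  traj_law : ∀ t < T, ∀ s : Trajectory X A L,
    μ[Set.indicator {ω | (H (t + 1) ω).traj = s} (fun _ => (1 : ℝ)) |
      ℋ t ⊔ MeasurableSpace.comap (fun ω => ((H (t + 1) ω).reward, (H (t + 1) ω).cost))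
        inferInstance]
      =ᵐ[μ] fun ω => E.trajProb (π (t + 1) ω) s

end Environment

/-! The quantities computed by the learner at the end of episode `t`, from the episodes `1, …, t`.
Only rewards and costs of visited pairs enter. -/

section Learner

variable {X A : Type*} [Fintype X] [Fintype A] {m L : ℕ}

open Classical in
/-- `N_t(x, a)`: number of visits to `(x, a)` in the episodes `1, …, t`. -/
def visitCount (H : ℕ → Episode X A m L) (t : ℕ) (x : X) (a : A) : ℕ :=
  ((Finset.Icc 1 t).filter fun τ => (H τ).traj.Visits x a).card

open Classical in
/-- `M_t(x, a, x')`: number of those visits that are followed by `x'`. -/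
def moveCount (H : ℕ → Episode X A m L) (t : ℕ) (x : X) (a : A) (x' : X) : ℕ :=
  ((Finset.Icc 1 t).filter fun τ => (H τ).traj.Moves x a x').card

open Classical in
/-- The empirical reward. -/
def empReward (H : ℕ → Episode X A m L) (t : ℕ) (x : X) (a : A) : ℝ :=
  (∑ τ ∈ Finset.Icc 1 t, if (H τ).traj.Visits x a then (H τ).reward x a else 0) /
    max (visitCount H t x a : ℝ) 1

open Classical in
/-- The empirical cost of constraint `i`. -/
def empCost (H : ℕ → Episode X A m L) (t : ℕ) (i : Fin m) (x : X) (a : A) : ℝ :=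
  (∑ τ ∈ Finset.Icc 1 t, if (H τ).traj.Visits x a then (H τ).cost i x a else 0) /
    max (visitCount H t x a : ℝ) 1

/-- The empirical transition probabilities. -/
def empTrans (H : ℕ → Episode X A m L) (t : ℕ) (x : X) (a : A) (x' : X) : ℝ :=
  (moveCount H t x a x' : ℝ) / max 1 (visitCount H t x a : ℝ)

/-- `ln (T |X| |A| / δ)` -/
def logTerm (X A : Type*) [Fintype X] [Fintype A] (T : ℕ) (δ : ℝ) : ℝ :=
  Real.log (T * Fintype.card X * Fintype.card A / δ)

/-- The confidence width `ε_t(x'|x, a)` of the transition probabilities. -/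
def transWidth (T : ℕ) (δ : ℝ) (H : ℕ → Episode X A m L) (t : ℕ) (x : X) (a : A) (x' : X) : ℝ :=
  2 * √(empTrans H t x a x' * logTerm X A T δ / max 1 ((visitCount H t x a : ℝ) - 1))
    + 14 * logTerm X A T δ / (3 * max 1 ((visitCount H t x a : ℝ) - 1))

/-- The confidence width `φ_t(x, a)` of the rewards, for the corruption value `C`. -/
def rewardWidth (T : ℕ) (δ C : ℝ) (H : ℕ → Episode X A m L) (t : ℕ) (x : X) (a : A) : ℝ :=
  min 1 (√(Real.log (2 * T * Fintype.card X * Fintype.card A / δ) /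
      (2 * max (visitCount H t x a : ℝ) 1))
    + C / max (visitCount H t x a : ℝ) 1 + C / T)

/-- The confidence width `ξ_t(x, a)` of the costs, for the corruption value `C`. -/
def costWidth (T : ℕ) (δ C : ℝ) (H : ℕ → Episode X A m L) (t : ℕ) (x : X) (a : A) : ℝ :=
  min 1 (√(Real.log (2 * m * T * Fintype.card X * Fintype.card A / δ) /
      (2 * max (visitCount H t x a : ℝ) 1))
    + C / max (visitCount H t x a : ℝ) 1 + C / T)

/-- The upper confidence bound on the rewards. -/
def optReward (T : ℕ) (δ C : ℝ) (H : ℕ → Episode X A m L) (t : ℕ) (x : X) (a : A) : ℝ :=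
  empReward H t x a + rewardWidth T δ C H t x a

/-- The lower confidence bound on the costs. -/
def optCost (T : ℕ) (δ C : ℝ) (H : ℕ → Episode X A m L) (t : ℕ) (i : Fin m) (x : X) (a : A) : ℝ :=
  empCost H t i x a - costWidth T δ C H t x a

/-- `Δ(𝒫_t)`: the occupancy measures compatible with the confidence set for the transitions. -/
structure ConfOcc (lay : Layering X L) (T : ℕ) (δ : ℝ) (H : ℕ → Episode X A m L) (t : ℕ)
    (q : X → A → X → ℝ) : Prop where
  nonneg : ∀ x a x', 0 ≤ q x a x'
  support : ∀ x a x', (lay.layer x' : ℕ) ≠ lay.layer x + 1 → q x a x' = 0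
  mass : ∀ k < L, ∑ x with (lay.layer x : ℕ) = k, stateOcc q x = 1
  flow : ∀ x, lay.layer x ≠ 0 → lay.layer x ≠ Fin.last L →
    stateOcc q x = ∑ x', ∑ a, q x' a x
  upper : ∀ x a x', (lay.layer x' : ℕ) = lay.layer x + 1 →
    q x a x' ≤ (empTrans H t x a x' + transWidth T δ H t x a x') * pairOcc q x a
  lower : ∀ x a x', (lay.layer x' : ℕ) = lay.layer x + 1 →
    (empTrans H t x a x' - transWidth T δ H t x a x') * pairOcc q x a ≤ q x a x'

/-- The feasible set of the optimistic program solved at the end of episode `t`. -/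
def optFeasible (lay : Layering X L) (α : Fin m → ℝ) (T : ℕ) (δ C : ℝ)
    (H : ℕ → Episode X A m L) (t : ℕ) : Set (X → A → X → ℝ) :=
  {q | ConfOcc lay T δ H t q ∧ ∀ i, pairing (optCost T δ C H t i) q ≤ α i}

/-- `q` may be chosen at the end of episode `t`: it solves the optimistic program if that is
feasible, and is any element of `Δ(𝒫_t)` otherwise. -/
def IsChoice (lay : Layering X L) (α : Fin m → ℝ) (T : ℕ) (δ C : ℝ)
    (H : ℕ → Episode X A m L) (t : ℕ) (q : X → A → X → ℝ) : Prop :=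
  ((optFeasible lay α T δ C H t).Nonempty →
    q ∈ optFeasible lay α T δ C H t ∧
      IsMaxOn (pairing (optReward T δ C H t)) (optFeasible lay α T δ C H t) q) ∧
  (¬ (optFeasible lay α T δ C H t).Nonempty → ConfOcc lay T δ H t q)

/-- The policies `π₁, …, π_T` are those of a run of NS-SOPS with inputs `C` and `δ`, the episodes
being `H 1, …, H T`. The first policy and all ties are arbitrary. -/
def IsNSSOPS (lay : Layering X L) (α : Fin m → ℝ) (T : ℕ) (δ C : ℝ)
    (H : ℕ → Episode X A m L) (π : ℕ → X → A → ℝ) : Prop :=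
  IsPolicy (π 1) ∧ ∀ t, 1 ≤ t → t < T →
    ∃ q, IsChoice lay α T δ C H t q ∧ IsInducedPolicy q (π (t + 1))

end Learner

end CMDP

end

/-!
The regret bound rests on optimism for an upper-confidence linear program, with confidence widths
that pay for corruption, and every probabilistic input is a supermartingale estimate along the
interaction.

*Typical runs.* Outside an event of probability at most `5 δ` a run is typical
(`CMDP.IsTypicalRun`): over the first `n` visits to any pair `(x, a)` the rewards and costs are close
to their means (Hoeffding's lemma), the number of moves to any `x'` is close to `n P(x' | x, a)`
(Chernoff bounds for Bernoulli variables), and weighted sums of occupancy measures are controlled by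
the same sums over actual visits (Azuma's inequality). Each of these bounds is Markov's inequality
for a product whose factors have conditional expectation at most one
(`CMDP.measureReal_le_sum_le_exp_neg`); restricting to the first `n` visits, for each fixed `n`,
avoids stopping times, and a union bound over `n ≤ T` then covers the random number of visits.

*Optimism.* The expected rewards of any `N` episodes have a mean within `C / N + C / T` of the overall
average `r̄`, so that the empirical mean over `N` visits is within `√(log / N) + C / N + C / T` of
`r̄`, which is the width `φ`; the same holds for costs. On a typical run the true transition function is
within its confidence bounds, hence the occupancy measure of the benchmark policy is admissible for
the optimistic program. The value of the program is thus at least the benchmark.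

*Estimation error.* The gap between the optimistic value and the reward of the policy played is at
most the widths collected by the policy, plus the distance between the occupancy measures
of the policy under the optimistic and the true transition functions. By the simulation lemma
the distance is at most `L` times the `L¹` error of the transition function collected along the true
occupancy measure. That error is at most `2`, which makes it possible to absorb the
first-order term `log / N` of the confidence bound into the term of order `√(log / N)`; no
lower-order term appears in the result. All this is collected in one weight per visit count
(`CMDP.regretWeight`). Azuma's inequality replaces occupancy measures by visits, and the sums over
visits are bounded by `∑ n ≤ N, 1 / √n ≤ 2 √N + O(1)`, `∑ n ≤ T, 1 / n = O(log T)` and the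
arithmetic-geometric mean inequality over pairs.

The cases `L = 0` and `T = 1` are degenerate: in the former the regret vanishes, in the
latter it is at most `L`, the length of the only episode.
-/

set_option linter.unusedSectionVars false

namespace CMDP

/-! ### Occupancy measures -/

section Occupancy

variable {X : Type u} {A : Type v} [Fintype X] [Fintype A] [DecidableEq X] [DecidableEq A]
  {m L : ℕ}

/-- The total weight of the paths of length `n` issued from `x`, where `F k` is the weight of the
`k`-th step. -/
noncomputable def pathSum (n : ℕ) (F : ℕ → X → A → X → ℝ) (x : X) : ℝ :=
  ∑ s : Trajectory X A n, if s.1 0 = x then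
    ∏ k : Fin n, F k (s.1 k.castSucc) (s.2 k) (s.1 k.succ) else 0

lemma pathSum_zero (F : ℕ → X → A → X → ℝ) (x : X) : pathSum 0 F x = 1 := by
  unfold pathSum
  rw [Fintype.sum_eq_single ((fun _ => x, fun k => k.elim0) : Trajectory X A 0)]
  · simp
  · rintro ⟨s, b⟩ h
    have : s 0 ≠ x := fun h0 => h (by
      ext k
      · obtain rfl : k = 0 := Fin.ext (by omega)
        exact h0
      · exact k.elim0)
    simp [this]

lemma pathSum_succ (n : ℕ) (F : ℕ → X → A → X → ℝ) (x : X) :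
    pathSum (n + 1) F x = ∑ a, ∑ x', F 0 x a x' * pathSum n (fun k => F (k + 1)) x' := by
  have hR : ∀ a, ∑ x', F 0 x a x' * pathSum n (fun k => F (k + 1)) x'
      = ∑ s : Trajectory X A n, F 0 x a (s.1 0) *
        ∏ k : Fin n, F (k + 1) (s.1 k.castSucc) (s.2 k) (s.1 k.succ) := by
    intro a
    simp only [pathSum, Finset.mul_sum]
    rw [Finset.sum_comm]
    refine Finset.sum_congr rfl fun s _ => ?_
    simp
  simp only [hR]
  unfold pathSum
  rw [← Equiv.sum_comp (((Fin.consEquiv (fun _ : Fin (n + 2) => X)).symm.prodCongr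
      (Fin.consEquiv (fun _ : Fin (n + 1) => A)).symm).trans
        (Equiv.prodProdProdComm _ _ _ _)).symm]
  rw [Fintype.sum_prod_type, Fintype.sum_prod_type, Fintype.sum_eq_single x]
  · refine Finset.sum_congr rfl fun a _ => Finset.sum_congr rfl fun s _ => ?_
    simp [Fin.prod_univ_succ, Fin.consEquiv, Equiv.prodProdProdComm]
  · intro y hy
    refine Finset.sum_eq_zero fun a _ => Finset.sum_eq_zero fun s _ => ?_
    simp [Fin.consEquiv, Equiv.prodProdProdComm, hy]

namespace Environment

variable (E : Environment X A m L) (π : X → A → ℝ)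

/-- The transition matrix of the states when `π` is played. -/
noncomputable def stepMatrix : Matrix X X ℝ := fun x x' => ∑ a, π x a * E.P x a x'

variable {π}

lemma stepMatrix_nonneg (hπ : IsPolicy π) (x x' : X) : 0 ≤ E.stepMatrix π x x' :=
  Finset.sum_nonneg fun a _ => mul_nonneg (hπ.1 x a) (E.P_nonneg x a x')

lemma layer_of_stepMatrix_ne_zero {x x' : X} (h : E.stepMatrix π x x' ≠ 0) :
    (E.layer x' : ℕ) = E.layer x + 1 := by
  obtain ⟨a, -, ha⟩ := Finset.exists_ne_zero_of_sum_ne_zero h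
  exact E.P_loopfree x a x' (right_ne_zero_of_mul ha)

lemma stepMatrix_pow_nonneg (hπ : IsPolicy π) (k : ℕ) (x x' : X) :
    0 ≤ (E.stepMatrix π ^ k) x x' := by
  induction k generalizing x' with
  | zero => rw [pow_zero, Matrix.one_apply]; split_ifs <;> norm_num
  | succ k ih =>
    rw [pow_succ, Matrix.mul_apply]
    exact Finset.sum_nonneg fun y _ => mul_nonneg (ih y) (E.stepMatrix_nonneg hπ y x')

lemma layer_of_stepMatrix_pow_ne_zero {k : ℕ} {x x' : X} (h : (E.stepMatrix π ^ k) x x' ≠ 0) :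
    (E.layer x' : ℕ) = E.layer x + k := by
  induction k generalizing x' with
  | zero =>
    rw [pow_zero, Matrix.one_apply] at h
    have : x = x' := by by_contra hne; simp [hne] at h
    simp [this]
  | succ k ih =>
    rw [pow_succ, Matrix.mul_apply] at h
    obtain ⟨y, -, hy⟩ := Finset.exists_ne_zero_of_sum_ne_zero h
    have h1 := ih (left_ne_zero_of_mul hy)
    have h2 := E.layer_of_stepMatrix_ne_zero (right_ne_zero_of_mul hy)
    omega

lemma ne_last_of_lt {x : X} (h : (E.layer x : ℕ) < L) : E.layer x ≠ Fin.last L := by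
  intro h'; rw [h'] at h; simp at h

lemma lt_of_ne_last {x : X} (h : E.layer x ≠ Fin.last L) : (E.layer x : ℕ) < L :=
  Fin.val_lt_last h

lemma sum_stepMatrix (hπ : IsPolicy π) {x : X} (hx : (E.layer x : ℕ) < L) :
    ∑ x', E.stepMatrix π x x' = 1 := by
  unfold stepMatrix
  rw [Finset.sum_comm]
  simp_rw [← Finset.mul_sum, E.P_sum x _ (E.ne_last_of_lt hx), mul_one]
  exact hπ.2 x

lemma sum_stepMatrix_pow (hπ : IsPolicy π) {k : ℕ} {x : X} (hx : (E.layer x : ℕ) + k ≤ L) :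
    ∑ x', (E.stepMatrix π ^ k) x x' = 1 := by
  induction k with
  | zero => simp [Matrix.one_apply]
  | succ k ih =>
    simp_rw [pow_succ, Matrix.mul_apply]
    rw [Finset.sum_comm, ← ih (by omega)]
    refine Finset.sum_congr rfl fun y _ => ?_
    rw [← Finset.mul_sum]
    by_cases hy : (E.stepMatrix π ^ k) x y = 0
    · simp [hy]
    · have := E.layer_of_stepMatrix_pow_ne_zero hy
      rw [E.sum_stepMatrix hπ (by omega), mul_one]

lemma pathSum_policy (hπ : IsPolicy π) {n : ℕ} {x : X} (hx : (E.layer x : ℕ) + n = L) :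
    pathSum n (fun _ y a z => π y a * E.P y a z) x = 1 := by
  induction n generalizing x with
  | zero => exact pathSum_zero _ _
  | succ n ih =>
    rw [pathSum_succ, ← hπ.2 x]
    refine Finset.sum_congr rfl fun a _ => ?_
    trans ∑ z, π x a * E.P x a z
    · refine Finset.sum_congr rfl fun z _ => ?_
      by_cases hz : E.P x a z = 0
      · simp [hz]
      · rw [ih (by have := E.P_loopfree x a z hz; omega), mul_one]
    · rw [← Finset.mul_sum, E.P_sum x a (E.ne_last_of_lt (by omega)), mul_one]

/-- The weight of the paths that make the step `(x, a, x')` at time `k` is the weight of the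
prefixes that lead to `x`, times the weight of the step: the later steps have total weight `1`. -/
lemma pathSum_step (hπ : IsPolicy π) (x : X) (a : A) (x' : X) {k n : ℕ} (hk : k < n) {y : X}
    (hy : (E.layer y : ℕ) + n = L) :
    pathSum n (fun j z b z' => π z b * E.P z b z' *
      if j = k then (if z = x ∧ b = a ∧ z' = x' then 1 else 0) else 1) y
      = (E.stepMatrix π ^ k) y x * (π x a * E.P x a x') := by
  induction k generalizing n y with
  | zero =>
    obtain ⟨n, rfl⟩ : ∃ n', n = n' + 1 := ⟨n - 1, by omega⟩
    rw [pathSum_succ]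
    simp only [if_true, Nat.add_eq_zero_iff, one_ne_zero, and_false, if_false, mul_one, pow_zero]
    rw [Matrix.one_apply]
    by_cases hyx : y = x
    · subst hyx
      rw [Finset.sum_eq_single a, Finset.sum_eq_single x']
      · by_cases hz : E.P y a x' = 0
        · simp [hz]
        · rw [E.pathSum_policy hπ (by have := E.P_loopfree y a x' hz; omega)]; simp
      · intro z _ hz; simp [hz]
      · simp
      · intro b _ hb; simp [hb]
      · simp
    · simp [hyx]
  | succ k ih =>
    obtain ⟨n, rfl⟩ : ∃ n', n = n' + 1 := ⟨n - 1, by omega⟩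
    rw [pathSum_succ, Finset.sum_comm, pow_succ', Matrix.mul_apply, Finset.sum_mul]
    refine Finset.sum_congr rfl fun z _ => ?_
    conv_rhs => enter [1, 1]; unfold stepMatrix
    rw [Finset.sum_mul, Finset.sum_mul]
    refine Finset.sum_congr rfl fun b _ => ?_
    by_cases hz : E.P y b z = 0
    · simp [hz]
    · have h1 := E.P_loopfree y b z hz
      have := ih (n := n) (y := z) (by omega) (by omega)
      simp only [Nat.add_right_cancel_iff]
      rw [this]
      simp [mul_assoc]

variable (π) in
/-- The probability that the state `x` is reached, at the time given by its layer. -/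
noncomputable def reach (x : X) : ℝ := (E.stepMatrix π ^ (E.layer x : ℕ)) E.start x

lemma layer_start : E.layer E.start = 0 := (E.layer_eq_zero_iff _).2 rfl

lemma val_layer_start : (E.layer E.start : ℕ) = 0 := by simp [E.layer_start]

lemma P_eq_zero_of_last {x : X} (hx : ¬ (E.layer x : ℕ) < L) (a : A) (x' : X) :
    E.P x a x' = 0 := by
  by_contra h
  have := E.P_loopfree x a x' h
  omega

lemma occ_eq (hπ : IsPolicy π) (x : X) (a : A) (x' : X) :
    E.occ π x a x' = E.reach π x * π x a * E.P x a x' := by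
  unfold occ
  by_cases hx : (E.layer x : ℕ) < L
  · rw [Finset.sum_eq_single (⟨E.layer x, hx⟩ : Fin L)]
    · rw [if_pos (show (⟨E.layer x, hx⟩ : Fin L).castSucc = E.layer x from Fin.ext rfl), reach,
        mul_assoc, ← E.pathSum_step hπ x a x' hx (y := E.start) (by rw [E.val_layer_start, zero_add])]
      unfold pathSum
      refine Finset.sum_congr rfl fun s _ => ?_
      rw [Finset.prod_mul_distrib, trajProb]
      have : ∏ i : Fin L, (if (i : ℕ) = (E.layer x : ℕ) then
          (if s.1 i.castSucc = x ∧ s.2 i = a ∧ s.1 i.succ = x' then (1 : ℝ) else 0) else 1)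
          = if s.1 (⟨E.layer x, hx⟩ : Fin L).castSucc = x ∧ s.2 ⟨E.layer x, hx⟩ = a ∧
            s.1 (⟨E.layer x, hx⟩ : Fin L).succ = x' then 1 else 0 := by
        rw [Finset.prod_eq_single (⟨E.layer x, hx⟩ : Fin L)]
        · simp
        · intro i _ hi
          rw [if_neg fun h => hi (Fin.ext h)]
        · simp
      rw [this]
      split_ifs <;> simp
    · intro k _ hk
      rw [if_neg]
      intro h
      have h' : (k : ℕ) = E.layer x := congrArg Fin.val h
      exact hk (Fin.ext h')
    · simp
  · rw [E.P_eq_zero_of_last hx, mul_zero]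
    refine Finset.sum_eq_zero fun k _ => if_neg fun h => hx ?_
    rw [← h]; exact k.2

lemma reach_nonneg (hπ : IsPolicy π) (x : X) : 0 ≤ E.reach π x :=
  E.stepMatrix_pow_nonneg hπ _ _ _

lemma occ_nonneg (hπ : IsPolicy π) (x : X) (a : A) (x' : X) : 0 ≤ E.occ π x a x' := by
  rw [E.occ_eq hπ]
  exact mul_nonneg (mul_nonneg (E.reach_nonneg hπ x) (hπ.1 x a)) (E.P_nonneg x a x')

lemma pairOcc_occ (hπ : IsPolicy π) {x : X} (hx : (E.layer x : ℕ) < L) (a : A) :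
    pairOcc (E.occ π) x a = E.reach π x * π x a := by
  simp only [pairOcc, E.occ_eq hπ, ← Finset.mul_sum, E.P_sum x a (E.ne_last_of_lt hx), mul_one]

lemma occ_eq_P_mul (hπ : IsPolicy π) (x : X) (a : A) (x' : X) :
    E.occ π x a x' = E.P x a x' * pairOcc (E.occ π) x a := by
  by_cases hx : (E.layer x : ℕ) < L
  · rw [E.pairOcc_occ hπ hx, E.occ_eq hπ, mul_comm]
  · rw [E.occ_eq hπ, E.P_eq_zero_of_last hx, mul_zero, zero_mul]

lemma pairOcc_occ_of_last (hπ : IsPolicy π) {x : X} (hx : ¬ (E.layer x : ℕ) < L) (a : A) :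
    pairOcc (E.occ π) x a = 0 := by
  simp [pairOcc, E.occ_eq hπ, E.P_eq_zero_of_last hx]

lemma stateOcc_occ (hπ : IsPolicy π) {x : X} (hx : (E.layer x : ℕ) < L) :
    stateOcc (E.occ π) x = E.reach π x := by
  simp only [stateOcc, E.pairOcc_occ hπ hx, ← Finset.mul_sum, hπ.2 x, mul_one]

lemma pairOcc_occ_eq_policy_mul (hπ : IsPolicy π) (x : X) (a : A) :
    pairOcc (E.occ π) x a = π x a * stateOcc (E.occ π) x := by
  by_cases hx : (E.layer x : ℕ) < L
  · rw [E.pairOcc_occ hπ hx, E.stateOcc_occ hπ hx, mul_comm]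
  · simp [stateOcc, E.pairOcc_occ_of_last hπ hx]

lemma pairOcc_occ_nonneg (hπ : IsPolicy π) (x : X) (a : A) : 0 ≤ pairOcc (E.occ π) x a :=
  Finset.sum_nonneg fun _ _ => E.occ_nonneg hπ _ _ _

lemma sum_stateOcc_occ (hπ : IsPolicy π) {k : ℕ} (hk : k < L) :
    ∑ x with (E.layer x : ℕ) = k, stateOcc (E.occ π) x = 1 := by
  rw [← E.sum_stepMatrix_pow hπ (k := k) (x := E.start) (by rw [E.val_layer_start]; omega),
    Finset.sum_filter]
  refine Finset.sum_congr rfl fun x _ => ?_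
  split_ifs with h
  · rw [E.stateOcc_occ hπ (by omega), reach, h]
  · by_contra h0
    have := E.layer_of_stepMatrix_pow_ne_zero (Ne.symm h0)
    rw [E.val_layer_start] at this
    omega

lemma stateOcc_occ_flow (hπ : IsPolicy π) {x : X} (h0 : E.layer x ≠ 0)
    (hL : E.layer x ≠ Fin.last L) :
    stateOcc (E.occ π) x = ∑ x', ∑ a, E.occ π x' a x := by
  obtain ⟨k, hk⟩ : ∃ k, (E.layer x : ℕ) = k + 1 :=
    ⟨(E.layer x : ℕ) - 1, by
      have : (E.layer x : ℕ) ≠ 0 := fun h => h0 (Fin.ext h)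
      omega⟩
  rw [E.stateOcc_occ hπ (E.lt_of_ne_last hL), reach, hk, pow_succ, Matrix.mul_apply]
  refine Finset.sum_congr rfl fun y _ => ?_
  simp only [E.occ_eq hπ, mul_assoc, ← Finset.mul_sum]
  by_cases hy : E.stepMatrix π y x = 0
  · rw [hy, mul_zero]
    change _ = _ * E.stepMatrix π y x
    rw [hy, mul_zero]
  · have := E.layer_of_stepMatrix_ne_zero hy
    have : (E.layer y : ℕ) = k := by omega
    rw [reach, this]
    rfl

lemma pairOcc_occ_le_one (hπ : IsPolicy π) (x : X) (a : A) : pairOcc (E.occ π) x a ≤ 1 := by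
  by_cases hx : (E.layer x : ℕ) < L
  · rw [← E.sum_stateOcc_occ hπ hx]
    refine le_trans ?_ (Finset.single_le_sum (f := stateOcc (E.occ π))
      (fun y _ => Finset.sum_nonneg fun b _ => E.pairOcc_occ_nonneg hπ y b)
      (Finset.mem_filter.2 ⟨Finset.mem_univ x, rfl⟩))
    exact Finset.single_le_sum (f := pairOcc (E.occ π) x)
      (fun b _ => E.pairOcc_occ_nonneg hπ x b) (Finset.mem_univ a)
  · rw [E.pairOcc_occ_of_last hπ hx]; exact zero_le_one

end Environment

/-- The state at time `k` belongs to the layer `X_k`. -/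
def Trajectory.Layered {X A : Type*} {L : ℕ} (lay : Layering X L) (s : Trajectory X A L) : Prop :=
  ∀ k, lay.layer (s.1 k) = k

lemma Trajectory.Layered.moves_iff {lay : Layering X L} {s : Trajectory X A L}
    (hs : s.Layered lay) (x : X) (a : A) (x' : X) {k : Fin L} (hk : k.castSucc = lay.layer x) :
    s.Moves x a x' ↔ s.1 k.castSucc = x ∧ s.2 k = a ∧ s.1 k.succ = x' := by
  refine ⟨?_, fun h => ⟨k, h⟩⟩
  rintro ⟨j, hj⟩
  have : j = k := by
    have := hs j.castSucc
    rw [hj.1, ← hk] at this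
    exact (Fin.castSucc_injective _ this).symm
  rwa [← this]

lemma Trajectory.Moves.visits {s : Trajectory X A L} {x : X} {a : A} {x' : X}
    (h : s.Moves x a x') : s.Visits x a := by
  obtain ⟨k, h1, h2, -⟩ := h
  exact ⟨k, h1, h2⟩

open Classical in
/-- A layered trajectory visits `(x, a)` at most once, and then moves to a single state. -/
lemma Trajectory.Layered.sum_moves {lay : Layering X L} {s : Trajectory X A L}
    (hs : s.Layered lay) (x : X) (a : A) :
    ∑ x', (if s.Moves x a x' then (1 : ℝ) else 0) = if s.Visits x a then 1 else 0 := by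
  split_ifs with h
  · obtain ⟨k, h1, h2⟩ := h
    have hk : k.castSucc = lay.layer x := by rw [← h1, hs]
    simp only [hs.moves_iff x a _ hk, h1, h2, true_and]
    simp
  · exact Finset.sum_eq_zero fun x' _ => if_neg fun h' => h h'.visits

namespace Environment

variable (E : Environment X A m L) {π : X → A → ℝ}

lemma layered_of_trajProb_ne_zero {s : Trajectory X A L} (h : E.trajProb π s ≠ 0) :
    s.Layered E.toLayering := by
  unfold trajProb at h
  have h0 : s.1 0 = E.start := by
    by_contra h'; simp [h'] at h
  have h1 : ∀ k : Fin L, E.P (s.1 k.castSucc) (s.2 k) (s.1 k.succ) ≠ 0 := fun k =>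
    right_ne_zero_of_mul (Finset.prod_ne_zero_iff.1 (right_ne_zero_of_mul h) k (Finset.mem_univ k))
  intro k
  induction k using Fin.induction with
  | zero => rw [h0]; exact E.layer_start
  | succ k ih =>
    have := E.P_loopfree _ _ _ (h1 k)
    rw [ih] at this
    exact Fin.ext (by simpa using this)

lemma trajProb_nonneg (hπ : IsPolicy π) (s : Trajectory X A L) : 0 ≤ E.trajProb π s :=
  mul_nonneg (by split_ifs <;> norm_num)
    (Finset.prod_nonneg fun _ _ => mul_nonneg (hπ.1 _ _) (E.P_nonneg _ _ _))

lemma P_le_one (x : X) (a : A) (x' : X) : E.P x a x' ≤ 1 := by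
  by_cases hx : (E.layer x : ℕ) < L
  · rw [← E.P_sum x a (E.ne_last_of_lt hx)]
    exact Finset.single_le_sum (fun y _ => E.P_nonneg x a y) (Finset.mem_univ x')
  · rw [E.P_eq_zero_of_last hx]; exact zero_le_one

lemma _root_.CMDP.IsPolicy.le_one (hπ : IsPolicy π) (x : X) (a : A) : π x a ≤ 1 := by
  rw [← hπ.2 x]
  exact Finset.single_le_sum (fun y _ => hπ.1 x y) (Finset.mem_univ a)

lemma trajProb_le_one (hπ : IsPolicy π) (s : Trajectory X A L) : E.trajProb π s ≤ 1 := by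
  unfold trajProb
  refine mul_le_one₀ (by split_ifs <;> norm_num)
    (Finset.prod_nonneg fun _ _ => mul_nonneg (hπ.1 _ _) (E.P_nonneg _ _ _))
    (Finset.prod_le_one (fun _ _ => mul_nonneg (hπ.1 _ _) (E.P_nonneg _ _ _)) fun _ _ =>
      mul_le_one₀ (hπ.le_one _ _) (E.P_nonneg _ _ _) (E.P_le_one _ _ _))

open Classical in
lemma sum_trajProb_moves (x : X) (a : A) (x' : X) :
    ∑ s : Trajectory X A L, (if s.Moves x a x' then (1 : ℝ) else 0) * E.trajProb π s
      = E.occ π x a x' := by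
  unfold occ
  simp_rw [← Finset.sum_filter (fun k : Fin L => k.castSucc = E.layer x)]
  rw [Finset.sum_comm]
  refine Finset.sum_congr rfl fun s _ => ?_
  by_cases h0 : E.trajProb π s = 0
  · simp [h0]
  have hs := E.layered_of_trajProb_ne_zero h0
  by_cases hx : (E.layer x : ℕ) < L
  · rw [Finset.sum_eq_single (⟨E.layer x, hx⟩ : Fin L)]
    · simp only [hs.moves_iff x a x' (k := ⟨E.layer x, hx⟩) (Fin.ext rfl), ite_mul, one_mul,
        zero_mul]
    · intro k hk hne
      have h' : (k : ℕ) = E.layer x := congrArg Fin.val (Finset.mem_filter.1 hk).2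
      exact absurd (Fin.ext h') hne
    · intro hn
      exact absurd (by simp only [Finset.mem_filter, Finset.mem_univ, true_and]; rfl) hn
  · rw [if_neg, zero_mul, Finset.sum_eq_zero]
    · intro k hk
      rw [← (Finset.mem_filter.1 hk).2] at hx
      exact absurd k.2 hx
    · rintro ⟨k, hk, -⟩
      have := hs k.castSucc
      rw [hk] at this
      rw [this] at hx
      exact hx k.2

open Classical in
lemma sum_trajProb_visits (x : X) (a : A) :
    ∑ s : Trajectory X A L, (if s.Visits x a then (1 : ℝ) else 0) * E.trajProb π s
      = pairOcc (E.occ π) x a := by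
  unfold pairOcc
  simp_rw [← E.sum_trajProb_moves]
  rw [Finset.sum_comm]
  refine Finset.sum_congr rfl fun s _ => ?_
  by_cases h0 : E.trajProb π s = 0
  · simp [h0]
  rw [← (E.layered_of_trajProb_ne_zero h0).sum_moves, Finset.sum_mul]

end Environment
end Occupancy

/-! ### Exponential supermartingales -/

section Supermartingale

variable {Ω : Type w} {mΩ : MeasurableSpace Ω} {μ : Measure Ω}

/-- `Y` is measurable with respect to `m'` and almost surely bounded: the class of test functions
against which conditional expectations are computed. Only an almost sure bound is available for
rewards, costs and policies. -/
structure BddMeas (μ : Measure Ω) (m' : MeasurableSpace Ω) (Y : Ω → ℝ) : Prop where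
  meas : Measurable[m'] Y
  bdd : ∃ K, ∀ᵐ ω ∂μ, |Y ω| ≤ K

namespace BddMeas

variable {m' m'' : MeasurableSpace Ω} {Y Z : Ω → ℝ}

lemma const (c : ℝ) : BddMeas μ m' fun _ => c :=
  ⟨measurable_const, |c|, Filter.Eventually.of_forall fun _ => le_rfl⟩

lemma of_forall_le (h : Measurable[m'] Y) {K : ℝ} (hK : ∀ ω, |Y ω| ≤ K) : BddMeas μ m' Y :=
  ⟨h, K, Filter.Eventually.of_forall hK⟩

lemma mono (hY : BddMeas μ m' Y) (h : m' ≤ m'') : BddMeas μ m'' Y :=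
  ⟨hY.meas.mono h le_rfl, hY.bdd⟩

lemma mul (hY : BddMeas μ m' Y) (hZ : BddMeas μ m' Z) : BddMeas μ m' fun ω => Y ω * Z ω := by
  obtain ⟨K, hK⟩ := hY.bdd
  obtain ⟨K', hK'⟩ := hZ.bdd
  refine ⟨hY.meas.mul hZ.meas, K * K', ?_⟩
  filter_upwards [hK, hK'] with ω h h'
  rw [abs_mul]
  exact mul_le_mul h h' (abs_nonneg _) ((abs_nonneg _).trans h)

lemma add (hY : BddMeas μ m' Y) (hZ : BddMeas μ m' Z) : BddMeas μ m' fun ω => Y ω + Z ω := by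
  obtain ⟨K, hK⟩ := hY.bdd
  obtain ⟨K', hK'⟩ := hZ.bdd
  refine ⟨hY.meas.add hZ.meas, K + K', ?_⟩
  filter_upwards [hK, hK'] with ω h h'
  exact (abs_add_le _ _).trans (add_le_add h h')

lemma const_mul (c : ℝ) (hY : BddMeas μ m' Y) : BddMeas μ m' fun ω => c * Y ω :=
  (const c).mul hY

lemma sub (hY : BddMeas μ m' Y) (hZ : BddMeas μ m' Z) : BddMeas μ m' fun ω => Y ω - Z ω := by
  simpa [sub_eq_add_neg] using hY.add (hZ.const_mul (-1))

lemma sum {ι : Type*} {s : Finset ι} {Y : ι → Ω → ℝ} (h : ∀ i ∈ s, BddMeas μ m' (Y i)) :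
    BddMeas μ m' fun ω => ∑ i ∈ s, Y i ω := by
  classical
  induction s using Finset.induction_on with
  | empty => simpa using const 0
  | insert i s hi ih =>
    simp_rw [Finset.sum_insert hi]
    exact (h i (Finset.mem_insert_self _ _)).add
      (ih fun j hj => h j (Finset.mem_insert_of_mem hj))

lemma prod {ι : Type*} {s : Finset ι} {Y : ι → Ω → ℝ} (h : ∀ i ∈ s, BddMeas μ m' (Y i)) :
    BddMeas μ m' fun ω => ∏ i ∈ s, Y i ω := by
  classical
  induction s using Finset.induction_on with
  | empty => simpa using const 1
  | insert i s hi ih =>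
    simp_rw [Finset.prod_insert hi]
    exact (h i (Finset.mem_insert_self _ _)).mul
      (ih fun j hj => h j (Finset.mem_insert_of_mem hj))

lemma exp (hY : BddMeas μ m' Y) : BddMeas μ m' fun ω => Real.exp (Y ω) := by
  obtain ⟨K, hK⟩ := hY.bdd
  refine ⟨Real.measurable_exp.comp hY.meas, Real.exp K, ?_⟩
  filter_upwards [hK] with ω h
  rw [Real.abs_exp]
  exact Real.exp_le_exp.2 ((le_abs_self _).trans h)

lemma integrable [IsFiniteMeasure μ] (hY : BddMeas μ m' Y) (h : m' ≤ mΩ) : Integrable Y μ := by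
  obtain ⟨K, hK⟩ := hY.bdd
  exact Integrable.of_bound (hY.meas.mono h le_rfl).aestronglyMeasurable K hK

end BddMeas

variable [IsProbabilityMeasure μ] {ℋ : Filtration ℕ mΩ}

/-- If every factor has conditional mean at most `1` given the past, then so has the product.
The condition on conditional means is expressed by integration against test functions. -/
lemma integral_prod_le_one {Z : ℕ → Ω → ℝ} {T : ℕ}
    (hZ : ∀ t < T, BddMeas μ (ℋ (t + 1)) (Z t)) (hZ0 : ∀ t < T, ∀ ω, 0 ≤ Z t ω)
    (h : ∀ t < T, ∀ Y, BddMeas μ (ℋ t) Y → (∀ ω, 0 ≤ Y ω) → ∫ ω, Y ω * Z t ω ∂μ ≤ ∫ ω, Y ω ∂μ) :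
    ∫ ω, ∏ t ∈ Finset.range T, Z t ω ∂μ ≤ 1 := by
  induction T with
  | zero => simp
  | succ T ih =>
    simp_rw [Finset.prod_range_succ]
    refine (h T (Nat.lt_succ_self T) _ ?_ ?_).trans
      (ih (fun t ht => hZ t (by omega)) (fun t ht => hZ0 t (by omega)) fun t ht => h t (by omega))
    · exact BddMeas.prod fun t ht => (hZ t (by have := Finset.mem_range.1 ht; omega)).mono
        (ℋ.mono (by have := Finset.mem_range.1 ht; omega))
    · exact fun ω => Finset.prod_nonneg fun t ht =>
        hZ0 t (by have := Finset.mem_range.1 ht; omega) ω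

/-- Markov's inequality for the exponential supermartingale with factors `exp (ξ t)`. -/
lemma measureReal_le_sum_le_exp_neg {ξ : ℕ → Ω → ℝ} {T : ℕ}
    (hξ : ∀ t < T, BddMeas μ (ℋ (t + 1)) (ξ t))
    (h : ∀ t < T, ∀ Y, BddMeas μ (ℋ t) Y → (∀ ω, 0 ≤ Y ω) →
      ∫ ω, Y ω * Real.exp (ξ t ω) ∂μ ≤ ∫ ω, Y ω ∂μ) (c : ℝ) :
    μ.real {ω | c ≤ ∑ t ∈ Finset.range T, ξ t ω} ≤ Real.exp (-c) := by
  have h1 := integral_prod_le_one (fun t ht => (hξ t ht).exp)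
    (fun t _ ω => (Real.exp_pos (ξ t ω)).le) h
  have hint : Integrable (fun ω => ∏ t ∈ Finset.range T, Real.exp (ξ t ω)) μ :=
    (BddMeas.prod (m' := mΩ) fun t ht =>
      ((hξ t (Finset.mem_range.1 ht)).exp).mono (ℋ.le _)).integrable le_rfl
  have h2 := mul_meas_ge_le_integral_of_nonneg
    (Filter.Eventually.of_forall fun ω => Finset.prod_nonneg fun t _ =>
      (Real.exp_pos (ξ t ω)).le) hint (Real.exp c)
  simp only [← Real.exp_sum, Real.exp_le_exp] at h2 h1
  rw [Real.exp_neg, ← div_le_one (inv_pos.2 (Real.exp_pos c)), div_inv_eq_mul, mul_comm]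
  exact h2.trans h1

end Supermartingale

/-! ### The law of one episode given the past -/

section Interaction

variable {X : Type u} {A : Type v} [Fintype X] [Fintype A] [DecidableEq X] [DecidableEq A]
  {m L T : ℕ} {E : Environment X A m L}
  {Ω : Type w} {mΩ : MeasurableSpace Ω} {μ : Measure Ω} [IsProbabilityMeasure μ]
  {ℋ : Filtration ℕ mΩ} {π : ℕ → Ω → X → A → ℝ} {H : ℕ → Ω → Episode X A m L}

lemma Environment.measurable_trajProb (E : Environment X A m L) (s : Trajectory X A L) :
    Measurable fun π : X → A → ℝ => E.trajProb π s := by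
  unfold Environment.trajProb
  fun_prop

namespace Environment.IsInteraction

lemma feedback_measurable (hI : E.IsInteraction T μ ℋ π H) {t : ℕ} (ht : t < T) :
    Measurable[ℋ (t + 1)] fun ω => ((H (t + 1) ω).reward, (H (t + 1) ω).cost) :=
  (hI.reward_measurable t ht).prodMk (hI.cost_measurable t ht)

lemma bddMeas_trajProb (hI : E.IsInteraction T μ ℋ π H) {t : ℕ} (ht : t < T)
    (s : Trajectory X A L) : BddMeas μ (ℋ t) fun ω => E.trajProb (π (t + 1) ω) s := by
  refine ⟨(E.measurable_trajProb s).comp (hI.policy_measurable t ht), 1, ?_⟩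
  filter_upwards [hI.policy t ht] with ω h
  rw [abs_of_nonneg (E.trajProb_nonneg h s)]
  exact E.trajProb_le_one h s

lemma bddMeas_traj (hI : E.IsInteraction T μ ℋ π H) {t : ℕ} (ht : t < T)
    (g : Trajectory X A L → ℝ) : BddMeas μ (ℋ (t + 1)) fun ω => g (H (t + 1) ω).traj := by
  have : (fun ω => g (H (t + 1) ω).traj) = fun ω => ∑ s : Trajectory X A L,
      g s * Set.indicator {ω | (H (t + 1) ω).traj = s} (fun _ => (1 : ℝ)) ω := by
    ext ω
    rw [Finset.sum_eq_single (H (t + 1) ω).traj]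
    · simp
    · intro s _ hs
      simp [Ne.symm hs]
    · simp
  rw [this]
  refine BddMeas.sum fun s _ => BddMeas.const_mul _ ⟨?_, 1, ?_⟩
  · exact measurable_const.indicator (hI.traj_measurable t ht s)
  · refine Filter.Eventually.of_forall fun ω => ?_
    by_cases h : (H (t + 1) ω).traj = s <;> simp [h]

lemma bddMeas_feedback (hI : E.IsInteraction T μ ℋ π H) {t : ℕ} (ht : t < T)
    {f : (X → A → ℝ) × (Fin m → X → A → ℝ) → ℝ} (hf : Measurable f)
    (hb : ∃ K, ∀ᵐ ω ∂μ, |f ((H (t + 1) ω).reward, (H (t + 1) ω).cost)| ≤ K) :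
    BddMeas μ (ℋ (t + 1)) fun ω => f ((H (t + 1) ω).reward, (H (t + 1) ω).cost) :=
  ⟨hf.comp (hI.feedback_measurable ht), hb⟩

/-- The case of a single trajectory `s`. The law of the trajectory is known given the past and the
feedback of the episode, hence the conditional expectation with respect to `ℋ t ⊔ m₀`, where `m₀` is
generated by the feedback; then the feedback is independent of the past. -/
lemma integral_mul_indicator_traj_mul (hI : E.IsInteraction T μ ℋ π H) {t : ℕ} (ht : t < T)
    {Y : Ω → ℝ} (hY : BddMeas μ (ℋ t) Y) (s : Trajectory X A L)
    {f : (X → A → ℝ) × (Fin m → X → A → ℝ) → ℝ} (hf : Measurable f)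
    (hb : ∃ K, ∀ᵐ ω ∂μ, |f ((H (t + 1) ω).reward, (H (t + 1) ω).cost)| ≤ K) :
    ∫ ω, Y ω * f ((H (t + 1) ω).reward, (H (t + 1) ω).cost) *
        Set.indicator {ω | (H (t + 1) ω).traj = s} (fun _ => (1 : ℝ)) ω ∂μ
      = (∫ ω, Y ω * E.trajProb (π (t + 1) ω) s ∂μ) *
        ∫ ω, f ((H (t + 1) ω).reward, (H (t + 1) ω).cost) ∂μ := by
  set F : Ω → (X → A → ℝ) × (Fin m → X → A → ℝ) :=
    fun ω => ((H (t + 1) ω).reward, (H (t + 1) ω).cost) with hF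
  set m₀ : MeasurableSpace Ω := MeasurableSpace.comap F inferInstance with hm₀
  have hm₀le : m₀ ≤ mΩ :=
    ((hI.feedback_measurable ht).mono (ℋ.le _) le_rfl).comap_le
  have hle : ℋ t ⊔ m₀ ≤ mΩ := sup_le (ℋ.le t) hm₀le
  set I : Ω → ℝ := Set.indicator {ω | (H (t + 1) ω).traj = s} (fun _ => (1 : ℝ)) with hIdef
  have hfF : BddMeas μ m₀ fun ω => f (F ω) := ⟨hf.comp (comap_measurable F), hb⟩
  have hIb : BddMeas μ mΩ I := ⟨measurable_const.indicator
      (ℋ.le _ _ (hI.traj_measurable t ht s)), 1, Filter.Eventually.of_forall fun ω => by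
      by_cases h : (H (t + 1) ω).traj = s <;> simp [hIdef, h]⟩
  have hYf : BddMeas μ (ℋ t ⊔ m₀) fun ω => Y ω * f (F ω) :=
    (hY.mono le_sup_left).mul (hfF.mono le_sup_right)
  have h1 : ∫ ω, Y ω * f (F ω) * I ω ∂μ
      = ∫ ω, Y ω * f (F ω) * E.trajProb (π (t + 1) ω) s ∂μ := by
    rw [← integral_condExp hle]
    refine integral_congr_ae ?_
    have h2 := condExp_mul_of_stronglyMeasurable_left (m := ℋ t ⊔ m₀) (μ := μ)
      (f := fun ω => Y ω * f (F ω)) (g := I) hYf.meas.stronglyMeasurable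
      (((hYf.mono hle).mul hIb).integrable le_rfl) (hIb.integrable le_rfl)
    filter_upwards [h2, hI.traj_law t ht s] with ω h3 h4
    rw [show (fun ω => Y ω * f (F ω) * I ω) = (fun ω => Y ω * f (F ω)) * I from rfl, h3,
      Pi.mul_apply, h4]
  rw [h1]
  have hYp : BddMeas μ (ℋ t) fun ω => Y ω * E.trajProb (π (t + 1) ω) s :=
    hY.mul (hI.bddMeas_trajProb ht s)
  have hind : IndepFun (fun ω => Y ω * E.trajProb (π (t + 1) ω) s) (fun ω => f (F ω)) μ := by
    rw [IndepFun_iff_Indep]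
    exact (indep_of_indep_of_le_left (indep_of_indep_of_le_right (hI.indep_past t ht)
      hYp.meas.comap_le) hfF.meas.comap_le).symm
  have h5 := hind.integral_mul_eq_mul_integral
    (hYp.mono (ℋ.le t)).meas.aestronglyMeasurable
    (hfF.mono hm₀le).meas.aestronglyMeasurable
  rw [← h5]
  refine integral_congr_ae (Filter.Eventually.of_forall fun ω => ?_)
  simp only [Pi.mul_apply]
  ring

/-- Given the past and the feedback, the trajectory has the law `trajProb`, and the feedback is
independent of the past. Here `Y` is a test function depending on the past, `g` a function of the
trajectory and `f` a function of the feedback. -/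
lemma integral_mul_traj_mul (hI : E.IsInteraction T μ ℋ π H) {t : ℕ} (ht : t < T)
    {Y : Ω → ℝ} (hY : BddMeas μ (ℋ t) Y) (g : Trajectory X A L → ℝ)
    {f : (X → A → ℝ) × (Fin m → X → A → ℝ) → ℝ} (hf : Measurable f)
    (hb : ∃ K, ∀ᵐ ω ∂μ, |f ((H (t + 1) ω).reward, (H (t + 1) ω).cost)| ≤ K) :
    ∫ ω, Y ω * g (H (t + 1) ω).traj * f ((H (t + 1) ω).reward, (H (t + 1) ω).cost) ∂μ
      = (∫ ω, Y ω * ∑ s, g s * E.trajProb (π (t + 1) ω) s ∂μ) *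
        ∫ ω, f ((H (t + 1) ω).reward, (H (t + 1) ω).cost) ∂μ := by
  have e1 : ∀ ω, Y ω * g (H (t + 1) ω).traj * f ((H (t + 1) ω).reward, (H (t + 1) ω).cost)
      = ∑ s, g s * (Y ω * f ((H (t + 1) ω).reward, (H (t + 1) ω).cost) *
        Set.indicator {ω | (H (t + 1) ω).traj = s} (fun _ => (1 : ℝ)) ω) := by
    intro ω
    rw [Finset.sum_eq_single (H (t + 1) ω).traj]
    · simp; ring
    · intro s _ hs
      simp [Ne.symm hs]
    · simp
  have hbf := hI.bddMeas_feedback ht hf hb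
  simp_rw [e1]
  rw [integral_finsetSum]
  · simp_rw [Finset.mul_sum]
    rw [integral_finsetSum]
    · rw [Finset.sum_mul]
      refine Finset.sum_congr rfl fun s _ => ?_
      rw [integral_const_mul, hI.integral_mul_indicator_traj_mul ht hY s hf hb, ← mul_assoc]
      congr 1
      rw [← integral_const_mul]
      refine integral_congr_ae (Filter.Eventually.of_forall fun ω => ?_)
      dsimp only
      ring
    · intro s _
      exact ((hY.mul ((hI.bddMeas_trajProb ht s).const_mul (g s)))).integrable (ℋ.le _)
  · intro s _
    refine ((((hY.mono (ℋ.mono (Nat.le_succ t))).mul hbf).mul ⟨measurable_const.indicator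
      (hI.traj_measurable t ht s), 1, Filter.Eventually.of_forall fun ω => ?_⟩).const_mul
      (g s)).integrable (ℋ.le (t + 1))
    by_cases h : (H (t + 1) ω).traj = s <;> simp [h]

lemma integral_mul_traj (hI : E.IsInteraction T μ ℋ π H) {t : ℕ} (ht : t < T)
    {Y : Ω → ℝ} (hY : BddMeas μ (ℋ t) Y) (g : Trajectory X A L → ℝ) :
    ∫ ω, Y ω * g (H (t + 1) ω).traj ∂μ
      = ∫ ω, Y ω * ∑ s, g s * E.trajProb (π (t + 1) ω) s ∂μ := by
  have := hI.integral_mul_traj_mul ht hY g (f := fun _ => 1) measurable_const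
    ⟨1, Filter.Eventually.of_forall fun _ => by simp⟩
  simpa using this

/-- Trajectories that do not respect the layers have probability zero under every policy. -/
lemma ae_layered (hI : E.IsInteraction T μ ℋ π H) {t : ℕ} (ht : t < T) :
    ∀ᵐ ω ∂μ, (H (t + 1) ω).traj.Layered E.toLayering := by
  classical
  have h := hI.integral_mul_traj ht (BddMeas.const 1)
    (fun s => if s.Layered E.toLayering then 0 else 1)
  have h0 : ∀ (p : X → A → ℝ) (s : Trajectory X A L),
      (if s.Layered E.toLayering then (0 : ℝ) else 1) * E.trajProb p s = 0 := by
    intro p s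
    by_cases hs : E.trajProb p s = 0
    · simp [hs]
    · simp [E.layered_of_trajProb_ne_zero hs]
  simp only [h0, Finset.sum_const_zero, mul_zero, integral_zero, one_mul] at h
  rw [integral_eq_zero_iff_of_nonneg (fun ω => by dsimp only; split_ifs <;> norm_num)
    ((hI.bddMeas_traj ht fun s => if s.Layered E.toLayering then 0 else 1).integrable
      (ℋ.le _))] at h
  filter_upwards [h] with ω hω
  by_contra hc
  simp [hc] at hω

end Environment.IsInteraction
end Interaction

/-! ### Counting visits -/

section Counting

variable {X : Type u} {A : Type v} [Fintype X] [Fintype A] {m L : ℕ}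

lemma sum_Icc_one_eq_sum_range {M : Type*} [AddCommMonoid M] (f : ℕ → M) (t : ℕ) :
    ∑ τ ∈ Finset.Icc 1 t, f τ = ∑ j ∈ Finset.range t, f (j + 1) := by
  induction t with
  | zero => simp
  | succ t ih => rw [Finset.sum_Icc_succ_top (by omega), ih, Finset.sum_range_succ]

variable (H : ℕ → Episode X A m L)

lemma visitCount_zero (x : X) (a : A) : visitCount H 0 x a = 0 := by simp [visitCount]

open Classical in
lemma visitCount_succ (t : ℕ) (x : X) (a : A) : visitCount H (t + 1) x a =
    visitCount H t x a + if (H (t + 1)).traj.Visits x a then 1 else 0 := by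
  unfold visitCount
  simp only [Finset.card_filter, sum_Icc_one_eq_sum_range, Finset.sum_range_succ]

open Classical in
lemma moveCount_eq_sum (t : ℕ) (x : X) (a : A) (x' : X) : (moveCount H t x a x' : ℝ) =
    ∑ j ∈ Finset.range t, if (H (j + 1)).traj.Moves x a x' then 1 else 0 := by
  unfold moveCount
  simp only [Finset.card_filter, sum_Icc_one_eq_sum_range]
  push_cast
  rfl

open Classical in
lemma visitCount_eq_sum (t : ℕ) (x : X) (a : A) : (visitCount H t x a : ℝ) =
    ∑ j ∈ Finset.range t, if (H (j + 1)).traj.Visits x a then 1 else 0 := by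
  unfold visitCount
  simp only [Finset.card_filter, sum_Icc_one_eq_sum_range]
  push_cast
  rfl

lemma visitCount_mono (x : X) (a : A) : Monotone fun t => visitCount H t x a :=
  monotone_nat_of_le_succ fun t => by rw [visitCount_succ]; omega

lemma visitCount_le (t : ℕ) (x : X) (a : A) : visitCount H t x a ≤ t := by
  induction t with
  | zero => rw [visitCount_zero]
  | succ t ih => rw [visitCount_succ]; split_ifs <;> omega

open Classical in
/-- Restricting a sum over the visits to the first `n` visits does not change it before the next
visit. -/
lemma sum_first_visits (V : ℕ → ℝ) {t T n : ℕ} (x : X) (a : A) (htT : t ≤ T)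
    (hn : visitCount H t x a = n) :
    ∑ j ∈ Finset.range T,
        (if visitCount H j x a < n ∧ (H (j + 1)).traj.Visits x a then V j else 0)
      = ∑ j ∈ Finset.range t, if (H (j + 1)).traj.Visits x a then V j else 0 := by
  rw [← Finset.sum_range_add_sum_Ico _ htT,
    Finset.sum_eq_zero (s := Finset.Ico t T) fun j hj => if_neg ?_, add_zero]
  · refine Finset.sum_congr rfl fun j hj => ?_
    by_cases hv : (H (j + 1)).traj.Visits x a
    · have h1 := visitCount_mono H x a (show j + 1 ≤ t from Finset.mem_range.1 hj)
      simp only [visitCount_succ, hv, if_true] at h1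
      rw [if_pos ⟨by omega, hv⟩, if_pos hv]
    · simp [hv]
  · have h1 := visitCount_mono H x a (Finset.mem_Ico.1 hj).1
    simp only at h1
    omega

open Classical in
lemma sum_first_visits_one_le (T n : ℕ) (x : X) (a : A) :
    ∑ j ∈ Finset.range T,
      (if visitCount H j x a < n ∧ (H (j + 1)).traj.Visits x a then (1 : ℝ) else 0) ≤ n := by
  suffices h : ∑ j ∈ Finset.range T,
      (if visitCount H j x a < n ∧ (H (j + 1)).traj.Visits x a then (1 : ℝ) else 0)
      = (min (visitCount H T x a) n : ℕ) by
    rw [h]; exact_mod_cast min_le_right _ _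
  induction T with
  | zero => simp [visitCount_zero]
  | succ T ih =>
    rw [Finset.sum_range_succ, ih, visitCount_succ]
    by_cases hv : (H (T + 1)).traj.Visits x a
    · by_cases hn : visitCount H T x a < n
      · simp only [hn, hv, and_self, if_true]
        rw [min_eq_left hn.le, min_eq_left hn]
        push_cast; ring
      · simp only [hn, hv, false_and, if_false, if_true, add_zero]
        congr 1; omega
    · simp [hv]

open Classical in
/-- Summing over the visits a quantity that depends on the number of previous visits. -/
lemma sum_visits_comp_visitCount (f : ℕ → ℝ) (T : ℕ) (x : X) (a : A) :
    ∑ j ∈ Finset.range T, f (visitCount H j x a) *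
        (if (H (j + 1)).traj.Visits x a then (1 : ℝ) else 0)
      = ∑ n ∈ Finset.range (visitCount H T x a), f n := by
  induction T with
  | zero => simp [visitCount_zero]
  | succ T ih =>
    rw [Finset.sum_range_succ, ih, visitCount_succ]
    split_ifs with hv
    · rw [Finset.sum_range_succ, mul_one]
    · simp

open Classical in
lemma Trajectory.sum_visits_mul_le (s : Trajectory X A L) (f : X → ℝ) :
    ∑ x, ∑ a, (if s.Visits x a then (1 : ℝ) else 0) * |f x| ≤ ∑ k : Fin L, |f (s.1 k.castSucc)| := by
  have h : ∀ x a, (if s.Visits x a then (1 : ℝ) else 0) * |f x|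
      ≤ ∑ k : Fin L, if s.1 k.castSucc = x ∧ s.2 k = a then |f (s.1 k.castSucc)| else 0 := by
    intro x a
    have hnn : ∀ k ∈ Finset.univ (α := Fin L),
        0 ≤ (if s.1 k.castSucc = x ∧ s.2 k = a then |f (s.1 k.castSucc)| else 0) := by
      intro k _; split_ifs <;> simp
    split_ifs with hv
    · obtain ⟨k, h1, h2⟩ := hv
      refine le_trans ?_ (Finset.single_le_sum hnn (Finset.mem_univ k))
      simp [h1, h2]
    · simpa using Finset.sum_nonneg hnn
  refine (Finset.sum_le_sum fun x _ => Finset.sum_le_sum fun a _ => h x a).trans (le_of_eq ?_)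
  rw [Finset.sum_congr rfl fun x _ => Finset.sum_comm, Finset.sum_comm]
  refine Finset.sum_congr rfl fun k _ => ?_
  rw [Finset.sum_eq_single (s.1 k.castSucc), Finset.sum_eq_single (s.2 k)]
  · simp
  · intro b _ hb; simp [Ne.symm hb]
  · simp
  · intro y _ hy; simp [Ne.symm hy]
  · simp

open Classical in
lemma Trajectory.sum_visits_le (s : Trajectory X A L) :
    ∑ x, ∑ a, (if s.Visits x a then (1 : ℝ) else 0) ≤ L := by
  simpa using s.sum_visits_mul_le fun _ => 1

end Counting

/-! ### Deviation inequalities -/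

section Deviations

variable {X : Type u} {A : Type v} [Fintype X] [Fintype A] [DecidableEq X] [DecidableEq A]
  {m L T : ℕ} {E : Environment X A m L}
  {Ω : Type w} {mΩ : MeasurableSpace Ω} {μ : Measure Ω} [IsProbabilityMeasure μ]
  {ℋ : Filtration ℕ mΩ} {π : ℕ → Ω → X → A → ℝ} {H : ℕ → Ω → Episode X A m L}

lemma exp_neg_le_quadratic {x : ℝ} (hx : 0 ≤ x) : Real.exp (-x) ≤ 1 - x + x ^ 2 / 2 := by
  have h1 := Real.quadratic_le_exp_of_nonneg hx
  have h2 : Real.exp (-x) * Real.exp x = 1 := by rw [← Real.exp_add]; simp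
  have h3 : 0 < 1 - x + x ^ 2 / 2 := by nlinarith [sq_nonneg (x - 1)]
  have h4 : 1 ≤ (1 - x + x ^ 2 / 2) * Real.exp x := by
    refine le_trans ?_ (mul_le_mul_of_nonneg_left h1 h3.le)
    nlinarith [sq_nonneg (x ^ 2)]
  exact le_of_mul_le_mul_right (h2.trans_le h4) (Real.exp_pos x)

namespace Environment.IsInteraction

lemma measurableSet_traj (hI : E.IsInteraction T μ ℋ π H) {t : ℕ} (ht : t < T)
    (Q : Trajectory X A L → Prop) : MeasurableSet[ℋ (t + 1)] {ω | Q (H (t + 1) ω).traj} := by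
  have : {ω | Q (H (t + 1) ω).traj} = ⋃ s ∈ {s | Q s}, {ω | (H (t + 1) ω).traj = s} := by
    ext ω; simp
  rw [this]
  exact MeasurableSet.biUnion (Set.to_countable _) fun s _ => hI.traj_measurable t ht s

lemma measurable_visitCount (hI : E.IsInteraction T μ ℋ π H) {t : ℕ} (ht : t ≤ T)
    (x : X) (a : A) : Measurable[ℋ t] fun ω => visitCount (fun τ => H τ ω) t x a := by
  induction t with
  | zero => simp only [visitCount_zero]; exact measurable_const
  | succ t ih =>
    simp only [visitCount_succ]
    exact ((ih (by omega)).mono (ℋ.mono (Nat.le_succ t)) le_rfl).add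
      (Measurable.ite (hI.measurableSet_traj (by omega) fun s => s.Visits x a)
        measurable_const measurable_const)

lemma bddMeas_comp_visitCount (hI : E.IsInteraction T μ ℋ π H) {t : ℕ} (ht : t ≤ T)
    (x : X) (a : A) {f : ℕ → ℝ} {b : ℝ} (hf : ∀ n, |f n| ≤ b) :
    BddMeas μ (ℋ t) fun ω => f (visitCount (fun τ => H τ ω) t x a) :=
  .of_forall_le ((measurable_from_nat (f := f)).comp (hI.measurable_visitCount ht x a))
    fun _ => hf _

lemma bddMeas_pairOcc (hI : E.IsInteraction T μ ℋ π H) {t : ℕ} (ht : t < T) (x : X) (a : A) :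
    BddMeas μ (ℋ t) fun ω => pairOcc (E.occ (π (t + 1) ω)) x a := by
  classical
  simp_rw [← E.sum_trajProb_visits]
  exact .sum fun s _ => (hI.bddMeas_trajProb ht s).const_mul _

open Classical in
lemma integral_mul_visits (hI : E.IsInteraction T μ ℋ π H) {t : ℕ} (ht : t < T)
    {Y : Ω → ℝ} (hY : BddMeas μ (ℋ t) Y) (x : X) (a : A) :
    ∫ ω, Y ω * (if (H (t + 1) ω).traj.Visits x a then (1 : ℝ) else 0) ∂μ
      = ∫ ω, Y ω * pairOcc (E.occ (π (t + 1) ω)) x a ∂μ := by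
  rw [hI.integral_mul_traj ht hY fun s => if s.Visits x a then (1 : ℝ) else 0]
  simp_rw [E.sum_trajProb_visits]

open Classical in
/-- An exponential inequality for sums over the first `n` visits to `(x, a)`. The hypothesis on
`η` says that `exp (η t)` has conditional mean at most `1` given the past and a visit in the
episode `t + 1`. -/
lemma measureReal_le_sum_first_visits (hI : E.IsInteraction T μ ℋ π H) (x : X) (a : A) (n : ℕ)
    {η : ℕ → Ω → ℝ} (hη : ∀ t < T, BddMeas μ (ℋ (t + 1)) (η t))
    (h : ∀ t < T, ∀ Y, BddMeas μ (ℋ t) Y → (∀ ω, 0 ≤ Y ω) →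
      ∫ ω, Y ω * ((if (H (t + 1) ω).traj.Visits x a then (1 : ℝ) else 0) * Real.exp (η t ω)) ∂μ
        ≤ ∫ ω, Y ω * (if (H (t + 1) ω).traj.Visits x a then (1 : ℝ) else 0) ∂μ) (c : ℝ) :
    μ.real {ω | c ≤ ∑ t ∈ Finset.range T,
      if visitCount (fun τ => H τ ω) t x a < n ∧ (H (t + 1) ω).traj.Visits x a
        then η t ω else 0} ≤ Real.exp (-c) := by
  have hind : ∀ t < T, BddMeas μ (ℋ t) fun ω =>
      if visitCount (fun τ => H τ ω) t x a < n then (1 : ℝ) else 0 := fun t ht =>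
    hI.bddMeas_comp_visitCount (f := fun k => if k < n then (1 : ℝ) else 0) (b := 1) ht.le x a
      fun k => by split_ifs <;> simp
  have hvis : ∀ t < T, BddMeas μ (ℋ (t + 1)) fun ω =>
      if (H (t + 1) ω).traj.Visits x a then (1 : ℝ) else 0 := fun t ht =>
    hI.bddMeas_traj ht fun s => if s.Visits x a then (1 : ℝ) else 0
  refine measureReal_le_sum_le_exp_neg (ℋ := ℋ) (fun t ht => ?_) (fun t ht Y hY hY0 => ?_) c
  · convert (((hind t ht).mono (ℋ.mono (Nat.le_succ t))).mul (hvis t ht)).mul (hη t ht) using 2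
      with ω
    split_ifs <;> simp_all
  · have hYc := hY.mul (hind t ht)
    have hYc0 : ∀ ω, 0 ≤ Y ω * if visitCount (fun τ => H τ ω) t x a < n then (1 : ℝ) else 0 :=
      fun ω => mul_nonneg (hY0 ω) (by split_ifs <;> norm_num)
    have h1 := h t ht _ hYc hYc0
    have hle := ℋ.mono (Nat.le_succ t)
    have e : ∀ ω, Y ω * Real.exp
        (if visitCount (fun τ => H τ ω) t x a < n ∧ (H (t + 1) ω).traj.Visits x a
          then η t ω else 0)
        = Y ω + (Y ω * (if visitCount (fun τ => H τ ω) t x a < n then (1 : ℝ) else 0) *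
          ((if (H (t + 1) ω).traj.Visits x a then (1 : ℝ) else 0) * Real.exp (η t ω))
          - Y ω * (if visitCount (fun τ => H τ ω) t x a < n then (1 : ℝ) else 0) *
            (if (H (t + 1) ω).traj.Visits x a then (1 : ℝ) else 0)) := by
      intro ω
      by_cases h1 : visitCount (fun τ => H τ ω) t x a < n <;>
      by_cases h2 : (H (t + 1) ω).traj.Visits x a <;> simp [h1, h2]
    have i1 := ((hYc.mono hle).mul ((hvis t ht).mul (hη t ht).exp)).integrable (ℋ.le _)
    have i2 := ((hYc.mono hle).mul (hvis t ht)).integrable (ℋ.le _)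
    simp_rw [e]
    have i3 := integral_add (hY.integrable (ℋ.le _)) (i1.sub i2)
    simp only [Pi.sub_apply] at i3
    rw [i3, integral_sub i1 i2]
    linarith

open Classical in
/-- Hoeffding's inequality for the first `n` visits to `(x, a)`; the summands are centred functions
of the feedback that satisfy the conclusion of Hoeffding's lemma for variables in `[0, 1]`. -/
lemma measureReal_hoeffding (hI : E.IsInteraction T μ ℋ π H) (x : X) (a : A) {n : ℕ}
    (hn : 0 < n) {f : ℕ → (X → A → ℝ) × (Fin m → X → A → ℝ) → ℝ} (hf : ∀ t, Measurable (f t))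
    (hb : ∀ t < T, ∃ K, ∀ᵐ ω ∂μ, |f t ((H (t + 1) ω).reward, (H (t + 1) ω).cost)| ≤ K)
    (hsub : ∀ t < T, ∀ l : ℝ, ∫ ω, Real.exp
      (l * f t ((H (t + 1) ω).reward, (H (t + 1) ω).cost)) ∂μ ≤ Real.exp (l ^ 2 / 8))
    {c : ℝ} (hc : 0 < c) :
    μ.real {ω | √(n * c / 2) < ∑ t ∈ Finset.range T,
      if visitCount (fun τ => H τ ω) t x a < n ∧ (H (t + 1) ω).traj.Visits x a
        then f t ((H (t + 1) ω).reward, (H (t + 1) ω).cost) else 0} ≤ Real.exp (-c) := by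
  have hn' : (0 : ℝ) < n := by exact_mod_cast hn
  set s := √(n * c / 2) with hs
  have hs2 : s ^ 2 = n * c / 2 := Real.sq_sqrt (by positivity)
  -- This parameter maximizes the exponent `l s - n l ^ 2 / 8`, with the value `c`.
  set l : ℝ := 4 * s / n with hl
  have hl0 : 0 ≤ l := by positivity
  have key := hI.measureReal_le_sum_first_visits x a n
    (η := fun t ω => l * f t ((H (t + 1) ω).reward, (H (t + 1) ω).cost) - l ^ 2 / 8)
    (fun t ht => ((hI.bddMeas_feedback ht (hf t) (hb t ht)).const_mul l).sub (.const _))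
    (fun t ht Y hY hY0 => ?_) c
  · refine (measureReal_mono fun ω hω => ?_).trans key
    simp only [Set.mem_ofPred_eq] at hω ⊢
    have hcount := sum_first_visits_one_le (fun τ => H τ ω) T n x a
    have e : ∑ t ∈ Finset.range T,
        (if visitCount (fun τ => H τ ω) t x a < n ∧ (H (t + 1) ω).traj.Visits x a
          then l * f t ((H (t + 1) ω).reward, (H (t + 1) ω).cost) - l ^ 2 / 8 else 0)
        = l * (∑ t ∈ Finset.range T,
        if visitCount (fun τ => H τ ω) t x a < n ∧ (H (t + 1) ω).traj.Visits x a
          then f t ((H (t + 1) ω).reward, (H (t + 1) ω).cost) else 0)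
        - l ^ 2 / 8 * (∑ t ∈ Finset.range T,
        if visitCount (fun τ => H τ ω) t x a < n ∧ (H (t + 1) ω).traj.Visits x a
          then 1 else 0) := by
      rw [Finset.mul_sum, Finset.mul_sum, ← Finset.sum_sub_distrib]
      refine Finset.sum_congr rfl fun t _ => ?_
      split_ifs <;> ring
    rw [e]
    have h1 := mul_le_mul_of_nonneg_left hω.le hl0
    have h2 := mul_le_mul_of_nonneg_left hcount (by positivity : 0 ≤ l ^ 2 / 8)
    have h3 : l * s - l ^ 2 / 8 * n = c := by
      rw [hl]; field_simp; rw [hs2]; ring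
    linarith
  · have hfm : Measurable fun z => Real.exp (l * f t z - l ^ 2 / 8) := by
      have := hf t
      fun_prop
    have hbb : ∃ K, ∀ᵐ ω ∂μ,
        |Real.exp (l * f t ((H (t + 1) ω).reward, (H (t + 1) ω).cost) - l ^ 2 / 8)| ≤ K :=
      (((hI.bddMeas_feedback ht (hf t) (hb t ht)).const_mul l).sub (.const _)).exp.bdd
    have h1 := hI.integral_mul_traj_mul ht hY (fun s => if s.Visits x a then (1 : ℝ) else 0)
      hfm hbb
    have h2 := hI.integral_mul_traj ht hY (fun s => if s.Visits x a then (1 : ℝ) else 0)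
    simp only [← mul_assoc]
    rw [h1, h2]
    refine mul_le_of_le_one_right (integral_nonneg_of_ae ?_) ?_
    · filter_upwards [hI.policy t ht] with ω hω
      exact mul_nonneg (hY0 ω) (Finset.sum_nonneg fun s _ =>
        mul_nonneg (by split_ifs <;> norm_num) (E.trajProb_nonneg hω s))
    · simp_rw [Real.exp_sub, integral_div]
      rw [div_le_one (Real.exp_pos _)]
      exact hsub t ht l

open Classical in
/-- The Chernoff bound for the transitions observed at the first `n` visits to `(x, a)`. The
logarithm of the moment generating function of a centred Bernoulli variable with mean `p` is bounded
by that of the Poisson law, `p (exp l - 1 - l)`; both signs of `l` are allowed. -/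
lemma measureReal_chernoff (hI : E.IsInteraction T μ ℋ π H) (x : X) (a : A) (x' : X) (n : ℕ)
    (l c d : ℝ) (hd : c ≤ l * d - n * (E.P x a x' * (Real.exp l - 1 - l))) :
    μ.real {ω | l * d ≤ l * ∑ t ∈ Finset.range T,
      if visitCount (fun τ => H τ ω) t x a < n ∧ (H (t + 1) ω).traj.Visits x a
        then (if (H (t + 1) ω).traj.Moves x a x' then (1 : ℝ) else 0) - E.P x a x' else 0}
      ≤ Real.exp (-c) := by
  set p := E.P x a x' with hp
  have hp0 : 0 ≤ p := E.P_nonneg x a x'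
  set ψ : ℝ := p * (Real.exp l - 1 - l) with hψ
  have hψ0 : 0 ≤ ψ := mul_nonneg hp0 (by linarith [Real.add_one_le_exp l])
  have key := hI.measureReal_le_sum_first_visits x a n
    (η := fun t ω => l * ((if (H (t + 1) ω).traj.Moves x a x' then (1 : ℝ) else 0) - p) - ψ)
    (fun t ht => hI.bddMeas_traj ht fun s =>
      l * ((if s.Moves x a x' then (1 : ℝ) else 0) - p) - ψ)
    (fun t ht Y hY hY0 => ?_) c
  · refine (measureReal_mono fun ω hω => ?_).trans key
    simp only [Set.mem_ofPred_eq] at hω ⊢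
    have hcount := sum_first_visits_one_le (fun τ => H τ ω) T n x a
    have e : ∑ t ∈ Finset.range T,
        (if visitCount (fun τ => H τ ω) t x a < n ∧ (H (t + 1) ω).traj.Visits x a
          then l * ((if (H (t + 1) ω).traj.Moves x a x' then (1 : ℝ) else 0) - p) - ψ else 0)
        = l * (∑ t ∈ Finset.range T,
        if visitCount (fun τ => H τ ω) t x a < n ∧ (H (t + 1) ω).traj.Visits x a
          then (if (H (t + 1) ω).traj.Moves x a x' then (1 : ℝ) else 0) - p else 0)
        - ψ * (∑ t ∈ Finset.range T,
        if visitCount (fun τ => H τ ω) t x a < n ∧ (H (t + 1) ω).traj.Visits x a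
          then 1 else 0) := by
      rw [Finset.mul_sum, Finset.mul_sum, ← Finset.sum_sub_distrib]
      refine Finset.sum_congr rfl fun t _ => ?_
      by_cases h1 : visitCount (fun τ => H τ ω) t x a < n ∧ (H (t + 1) ω).traj.Visits x a
      · simp only [h1, and_self, if_true, mul_one]
      · simp only [h1, if_false, mul_zero, sub_zero]
    rw [e]
    have h2 := mul_le_mul_of_nonneg_left hcount hψ0
    linarith
  · set κ := Real.exp (-(p * (Real.exp l - 1))) with hκ
    have e : ∀ s : Trajectory X A L, (if s.Visits x a then (1 : ℝ) else 0) *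
        Real.exp (l * ((if s.Moves x a x' then (1 : ℝ) else 0) - p) - ψ)
        = κ * (if s.Visits x a then (1 : ℝ) else 0)
          + κ * (Real.exp l - 1) * (if s.Moves x a x' then (1 : ℝ) else 0) := by
      intro s
      by_cases h1 : s.Moves x a x'
      · simp only [h1, h1.visits, if_true, mul_one, one_mul]
        rw [show l * (1 - p) - ψ = -(p * (Real.exp l - 1)) + l by rw [hψ]; ring, Real.exp_add]
        ring
      · simp only [h1, if_false, mul_zero, add_zero, zero_sub]
        rw [show l * -p - ψ = -(p * (Real.exp l - 1)) by rw [hψ]; ring]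
        ring
    simp_rw [e]
    rw [hI.integral_mul_traj ht hY fun s => κ * (if s.Visits x a then (1 : ℝ) else 0)
          + κ * (Real.exp l - 1) * (if s.Moves x a x' then (1 : ℝ) else 0),
      hI.integral_mul_visits ht hY]
    have hq := hY.mul (hI.bddMeas_pairOcc ht x a)
    have e2 : ∀ᵐ ω ∂μ, Y ω * ∑ s, (κ * (if s.Visits x a then (1 : ℝ) else 0)
          + κ * (Real.exp l - 1) * (if s.Moves x a x' then (1 : ℝ) else 0)) *
            E.trajProb (π (t + 1) ω) s ≤ Y ω * pairOcc (E.occ (π (t + 1) ω)) x a := by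
      filter_upwards [hI.policy t ht] with ω hω
      refine mul_le_mul_of_nonneg_left ?_ (hY0 ω)
      simp_rw [add_mul, Finset.sum_add_distrib, mul_assoc, ← Finset.mul_sum]
      rw [E.sum_trajProb_visits, E.sum_trajProb_moves, E.occ_eq_P_mul hω]
      have h3 : κ * (1 + p * (Real.exp l - 1)) ≤ 1 := by
        rw [hκ, Real.exp_neg, inv_mul_le_iff₀ (Real.exp_pos _), mul_one]
        linarith [Real.add_one_le_exp (p * (Real.exp l - 1))]
      have := mul_le_mul_of_nonneg_right h3 (E.pairOcc_occ_nonneg hω x a)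
      linarith
    refine integral_mono_ae ?_ (hq.integrable (ℋ.le _)) e2
    refine (hY.mul (.sum fun s _ => ?_)).integrable (ℋ.le t)
    exact (hI.bddMeas_trajProb ht s).const_mul _

open Classical in
/-- The lower tail is subgaussian with variance proxy `n p`, hence has no first-order term. -/
lemma measureReal_moves_lower (hI : E.IsInteraction T μ ℋ π H) (x : X) (a : A) (x' : X) {n : ℕ}
    (hn : 0 < n) {c : ℝ} (hc : 0 < c) :
    μ.real {ω | 2 * √(n * E.P x a x' * c) < -∑ t ∈ Finset.range T,
      if visitCount (fun τ => H τ ω) t x a < n ∧ (H (t + 1) ω).traj.Visits x a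
        then (if (H (t + 1) ω).traj.Moves x a x' then (1 : ℝ) else 0) - E.P x a x' else 0}
      ≤ Real.exp (-(2 * c)) := by
  have hn' : (0 : ℝ) < n := by exact_mod_cast hn
  set p := E.P x a x' with hp
  rcases (E.P_nonneg x a x').eq_or_lt with h0 | hp0
  -- If the transition is impossible, then so is the deviation.
  · rw [← hp] at h0
    refine (le_of_eq ?_).trans (Real.exp_pos _).le
    convert measureReal_empty (μ := μ)
    refine Set.eq_empty_of_forall_notMem fun ω hω => ?_
    simp only [Set.mem_ofPred_eq, ← h0, mul_zero, zero_mul, Real.sqrt_zero, sub_zero] at hω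
    have : 0 ≤ ∑ t ∈ Finset.range T,
      if visitCount (fun τ => H τ ω) t x a < n ∧ (H (t + 1) ω).traj.Visits x a
      then (if (H (t + 1) ω).traj.Moves x a x' then (1 : ℝ) else 0) else 0 :=
      Finset.sum_nonneg fun t _ => by split_ifs <;> norm_num
    linarith
  rw [← hp] at hp0
  set r := √(n * p) with hr
  set s := √c with hs
  have hr0 : 0 < r := Real.sqrt_pos.2 (by positivity)
  have hs0 : 0 < s := Real.sqrt_pos.2 hc
  have hr2 : r ^ 2 = n * p := Real.sq_sqrt (by positivity)
  have hs2 : s ^ 2 = c := Real.sq_sqrt hc.le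
  have hsq : √(n * p * c) = r * s := Real.sqrt_mul (by positivity) _
  set l : ℝ := 2 * s / r with hl
  have hl0 : 0 < l := by positivity
  refine (measureReal_mono fun ω hω => ?_).trans
    (hI.measureReal_chernoff x a x' n (-l) (2 * c) (-(2 * (r * s))) ?_)
  · simp only [Set.mem_ofPred_eq] at hω ⊢
    rw [hsq] at hω
    nlinarith
  · have h1 := exp_neg_le_quadratic hl0.le
    have h2 : (n : ℝ) * (p * (Real.exp (-l) - 1 - -l)) ≤ n * p * (l ^ 2 / 2) := by
      rw [mul_assoc]
      gcongr
      linarith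
    have h3 : n * p * (l ^ 2 / 2) = 2 * c := by
      rw [← hr2, hl, ← hs2]; field_simp
    have h4 : -l * -(2 * (r * s)) = 4 * c := by
      rw [hl, ← hs2]; field_simp; ring
    linarith

open Classical in
/-- The upper tail is of Bernstein type: the term `2 c` takes over for rare transitions. -/
lemma measureReal_moves_upper (hI : E.IsInteraction T μ ℋ π H) (x : X) (a : A) (x' : X) {n : ℕ}
    {c : ℝ} (hc : 0 < c) :
    μ.real {ω | 2 * √(n * E.P x a x' * c) + 2 * c < ∑ t ∈ Finset.range T,
      if visitCount (fun τ => H τ ω) t x a < n ∧ (H (t + 1) ω).traj.Visits x a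
        then (if (H (t + 1) ω).traj.Moves x a x' then (1 : ℝ) else 0) - E.P x a x' else 0}
      ≤ Real.exp (-(2 * c)) := by
  set p := E.P x a x' with hp
  have hp0 : 0 ≤ p := E.P_nonneg x a x'
  set r := √(n * p) with hr
  set s := √c with hs
  have hr0 : 0 ≤ r := Real.sqrt_nonneg _
  have hs0 : 0 < s := Real.sqrt_pos.2 hc
  have hr2 : r ^ 2 = n * p := Real.sq_sqrt (by positivity)
  have hs2 : s ^ 2 = c := Real.sq_sqrt hc.le
  have hsq : √(n * p * c) = r * s := Real.sqrt_mul (by positivity) _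
  -- The optimal parameter `2 s / r` is used if it is at most `1`.
  rcases le_total (2 * s) r with h | h
  · have hr1 : 0 < r := by linarith
    set l : ℝ := 2 * s / r with hl
    have hl0 : 0 < l := by positivity
    have hl1 : l ≤ 1 := (div_le_one hr1).2 h
    refine (measureReal_mono fun ω hω => ?_).trans
      (hI.measureReal_chernoff x a x' n l (2 * c) (2 * (r * s) + 2 * c) ?_)
    · simp only [Set.mem_ofPred_eq] at hω ⊢
      rw [hsq] at hω
      exact mul_le_mul_of_nonneg_left hω.le hl0.le
    · have h1 := Real.exp_bound' hl0.le hl1 (n := 3) (by norm_num)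
      norm_num [Finset.sum_range_succ, Nat.factorial] at h1
      have h2 : (n : ℝ) * (p * (Real.exp l - 1 - l)) ≤ n * p * (l ^ 2 / 2 + l ^ 3 * (2 / 9)) := by
        rw [mul_assoc]
        gcongr
        linarith
      have h3 : n * p * (l ^ 2 / 2 + l ^ 3 * (2 / 9)) = 2 * c + 8 / 9 * (l * c) := by
        rw [← hr2, hl, ← hs2]; field_simp; ring
      have h4 : l * (2 * (r * s)) = 4 * c := by
        rw [hl, ← hs2]; field_simp; ring
      have h5 : 0 < l * c := by positivity
      linarith
  · refine (measureReal_mono fun ω hω => ?_).trans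
      (hI.measureReal_chernoff x a x' n 1 (2 * c) (2 * (r * s) + 2 * c) ?_)
    · simp only [Set.mem_ofPred_eq] at hω ⊢
      rw [hsq] at hω
      linarith
    · have h1 := Real.exp_one_lt_d9
      have h2 : (n : ℝ) * (p * (Real.exp 1 - 1 - 1)) ≤ n * p * 1 := by
        rw [mul_assoc]
        gcongr
        linarith
      rw [← hr2] at h2
      nlinarith

open Classical in
/-- An Azuma-type inequality: the weights of the visits, which may depend on the numbers of past
visits, are compared with their conditional means. -/
lemma measureReal_azuma (hI : E.IsInteraction T μ ℋ π H) (hT : 0 < T) (hL : 0 < L)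
    {w : X → A → ℕ → ℝ} {b : ℝ} (hb : 0 < b) (hw0 : ∀ x a n, 0 ≤ w x a n)
    (hwb : ∀ x a n, w x a n ≤ b) {c : ℝ} (hc : 0 < c) :
    μ.real {ω | b * L * √(2 * T * c) < ∑ t ∈ Finset.range T, ∑ x, ∑ a,
      w x a (visitCount (fun τ => H τ ω) t x a) * (pairOcc (E.occ (π (t + 1) ω)) x a
        - if (H (t + 1) ω).traj.Visits x a then (1 : ℝ) else 0)} ≤ Real.exp (-c) := by
  have hT' : (0 : ℝ) < T := by exact_mod_cast hT
  have hL' : (0 : ℝ) < L := by exact_mod_cast hL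
  set B : ℝ := b * L with hB
  have hB0 : 0 < B := by positivity
  set r := √(2 * T * c) with hr
  have hr0 : 0 < r := Real.sqrt_pos.2 (by positivity)
  have hr2 : r ^ 2 = 2 * T * c := Real.sq_sqrt (by positivity)
  -- An episode contributes at most `B` to the sum over visits; this `l` optimizes the exponent
  -- `l B r - T l ^ 2 B ^ 2 / 2`.
  set l : ℝ := r / (T * B) with hl
  have hl0 : 0 < l := by positivity
  set κ : ℝ := l ^ 2 * B ^ 2 / 2 with hκ
  have hwm : ∀ t < T, ∀ x a, BddMeas μ (ℋ t) fun ω =>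
      w x a (visitCount (fun τ => H τ ω) t x a) := fun t ht x a =>
    hI.bddMeas_comp_visitCount ht.le x a (b := b) fun n => by
      rw [abs_of_nonneg (hw0 x a n)]; exact hwb x a n
  have hvis : ∀ t < T, ∀ x a, BddMeas μ (ℋ (t + 1)) fun ω =>
      if (H (t + 1) ω).traj.Visits x a then (1 : ℝ) else 0 := fun t ht x a =>
    hI.bddMeas_traj ht fun s => if s.Visits x a then (1 : ℝ) else 0
  set M : ℕ → Ω → ℝ := fun t ω => ∑ x, ∑ a,
    w x a (visitCount (fun τ => H τ ω) t x a) * pairOcc (E.occ (π (t + 1) ω)) x a with hM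
  set W : ℕ → Ω → ℝ := fun t ω => ∑ x, ∑ a, w x a (visitCount (fun τ => H τ ω) t x a) *
    (if (H (t + 1) ω).traj.Visits x a then (1 : ℝ) else 0) with hW
  have hMb : ∀ t < T, BddMeas μ (ℋ t) (M t) := fun t ht =>
    .sum fun x _ => .sum fun a _ => (hwm t ht x a).mul (hI.bddMeas_pairOcc ht x a)
  have hWb : ∀ t < T, BddMeas μ (ℋ (t + 1)) (W t) := fun t ht =>
    .sum fun x _ => .sum fun a _ =>
      ((hwm t ht x a).mono (ℋ.mono (Nat.le_succ t))).mul (hvis t ht x a)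
  have hW0 : ∀ t ω, 0 ≤ W t ω := fun t ω => Finset.sum_nonneg fun x _ =>
    Finset.sum_nonneg fun a _ => mul_nonneg (hw0 _ _ _) (by split_ifs <;> norm_num)
  have hWB : ∀ t ω, W t ω ≤ B := by
    intro t ω
    have h1 := mul_le_mul_of_nonneg_left ((H (t + 1) ω).traj.sum_visits_le) hb.le
    rw [Finset.mul_sum] at h1
    simp_rw [Finset.mul_sum] at h1
    refine le_trans ?_ h1
    refine Finset.sum_le_sum fun x _ => Finset.sum_le_sum fun a _ => ?_
    exact mul_le_mul_of_nonneg_right (hwb _ _ _) (by split_ifs <;> norm_num)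
  have key := measureReal_le_sum_le_exp_neg (μ := μ) (ℋ := ℋ) (T := T)
    (ξ := fun t ω => l * (M t ω - W t ω) - κ)
    (fun t ht => ((((hMb t ht).mono (ℋ.mono (Nat.le_succ t))).sub (hWb t ht)).const_mul l).sub
      (.const κ)) (fun t ht Y hY hY0 => ?_) c
  · refine (measureReal_mono fun ω hω => ?_).trans key
    simp only [Set.mem_ofPred_eq] at hω ⊢
    have e : ∑ t ∈ Finset.range T, (l * (M t ω - W t ω) - κ)
        = l * (∑ t ∈ Finset.range T, ∑ x, ∑ a,
          w x a (visitCount (fun τ => H τ ω) t x a) * (pairOcc (E.occ (π (t + 1) ω)) x a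
          - if (H (t + 1) ω).traj.Visits x a then (1 : ℝ) else 0)) - T * κ := by
      rw [Finset.sum_sub_distrib, ← Finset.mul_sum, Finset.sum_const, Finset.card_range,
        nsmul_eq_mul]
      simp only [hM, hW, ← Finset.sum_sub_distrib, mul_sub]
    rw [e]
    have h1 := mul_le_mul_of_nonneg_left hω.le hl0.le
    have h2 : l * (B * r) = 2 * c := by
      rw [hl]; field_simp; rw [hr2]; ring
    have h3 : T * κ = c := by
      rw [hκ, hl]; field_simp; rw [hr2]; ring
    linarith
  · have hY' : BddMeas μ (ℋ t) fun ω => Y ω * Real.exp (l * M t ω - κ) :=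
      hY.mul (((hMb t ht).const_mul l).sub (.const κ)).exp
    have hle := ℋ.mono (Nat.le_succ t)
    have i0 := hY'.integrable (ℋ.le t)
    have iW := ((hY'.mono hle).mul (hWb t ht)).integrable (ℋ.le _)
    have iM := (hY'.mul (hMb t ht)).integrable (ℋ.le _)
    have hWM : ∀ Y' : Ω → ℝ, BddMeas μ (ℋ t) Y' →
        ∫ ω, Y' ω * W t ω ∂μ = ∫ ω, Y' ω * M t ω ∂μ := by
      intro Y' hY'
      simp only [hW, hM, Finset.mul_sum]
      rw [integral_finsetSum, integral_finsetSum]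
      · refine Finset.sum_congr rfl fun x _ => ?_
        rw [integral_finsetSum, integral_finsetSum]
        · refine Finset.sum_congr rfl fun a _ => ?_
          have := hI.integral_mul_visits ht (hY'.mul (hwm t ht x a)) x a
          simpa only [mul_assoc] using this
        · intro a _
          exact (hY'.mul ((hwm t ht x a).mul (hI.bddMeas_pairOcc ht x a))).integrable (ℋ.le _)
        · intro a _
          exact ((hY'.mono hle).mul (((hwm t ht x a).mono hle).mul (hvis t ht x a))).integrable
            (ℋ.le _)
      · intro x _
        exact (BddMeas.sum fun a _ =>
          hY'.mul ((hwm t ht x a).mul (hI.bddMeas_pairOcc ht x a))).integrable (ℋ.le _)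
      · intro x _
        exact (BddMeas.sum fun a _ =>
          (hY'.mono hle).mul (((hwm t ht x a).mono hle).mul (hvis t ht x a))).integrable (ℋ.le _)
    -- `exp (-l W)` is bounded by `1 - l W + κ`, which is linear in `W`, so that only the conditional
    -- mean `M` of `W` is needed.
    calc ∫ ω, Y ω * Real.exp (l * (M t ω - W t ω) - κ) ∂μ
        ≤ ∫ ω, ((1 + κ) * (Y ω * Real.exp (l * M t ω - κ))
            - l * (Y ω * Real.exp (l * M t ω - κ) * W t ω)) ∂μ := by
          refine integral_mono ?_ ((i0.const_mul _).sub (iW.const_mul _)) fun ω => ?_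
          · exact ((hY.mono hle).mul ((((((hMb t ht).mono hle).sub
              (hWb t ht)).const_mul l).sub (.const κ)).exp)).integrable (ℋ.le _)
          · have h1 := exp_neg_le_quadratic (mul_nonneg hl0.le (hW0 t ω))
            have h2 : (l * W t ω) ^ 2 / 2 ≤ κ := by
              rw [hκ, mul_pow]
              have := pow_le_pow_left₀ (hW0 t ω) (hWB t ω) 2
              gcongr
            dsimp only
            rw [show l * (M t ω - W t ω) - κ = (l * M t ω - κ) + -(l * W t ω) by ring,
              Real.exp_add]
            have h3 : 0 ≤ Y ω * Real.exp (l * M t ω - κ) :=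
              mul_nonneg (hY0 ω) (Real.exp_pos _).le
            have h4 := mul_le_mul_of_nonneg_left (h1.trans (add_le_add_right h2 _)) h3
            linarith
      _ = ∫ ω, ((1 + κ) * (Y ω * Real.exp (l * M t ω - κ))
            - l * (Y ω * Real.exp (l * M t ω - κ) * M t ω)) ∂μ := by
          rw [integral_sub (i0.const_mul _) (iW.const_mul _),
            integral_sub (i0.const_mul _) (iM.const_mul _), integral_const_mul l,
            integral_const_mul l, hWM _ hY']
      _ ≤ ∫ ω, Y ω ∂μ := by
          refine integral_mono ((i0.const_mul _).sub (iM.const_mul _))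
            (hY.integrable (ℋ.le _)) fun ω => ?_
          dsimp only
          have h1 := Real.add_one_le_exp (-(l * M t ω - κ))
          have h2 : Real.exp (l * M t ω - κ) * Real.exp (-(l * M t ω - κ)) = 1 := by
            rw [← Real.exp_add]; simp
          have h3 : Real.exp (l * M t ω - κ) * (1 + κ - l * M t ω) ≤ 1 := by
            rw [← h2]
            exact mul_le_mul_of_nonneg_left (by linarith) (Real.exp_pos _).le
          have h4 := mul_le_mul_of_nonneg_left h3 (hY0 ω)
          linarith

end Environment.IsInteraction
end Deviations

/-! ### Corruption -/

section Corruption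

lemma sum_abs_sub_avg_le {T : ℕ} (hT : 0 < T) (f : ℕ → ℝ) (r : ℝ) :
    T * |r - 1 / (T : ℝ) * ∑ t ∈ Finset.Icc 1 T, f t| ≤ ∑ t ∈ Finset.Icc 1 T, |f t - r| := by
  have hT' : (0 : ℝ) < T := by exact_mod_cast hT
  have e : T * |r - 1 / (T : ℝ) * ∑ t ∈ Finset.Icc 1 T, f t|
      = |∑ t ∈ Finset.Icc 1 T, (f t - r)| := by
    trans |(T : ℝ) * (r - 1 / (T : ℝ) * ∑ t ∈ Finset.Icc 1 T, f t)|
    · rw [abs_mul, abs_of_pos hT']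
    rw [← abs_neg]
    congr 1
    rw [Finset.sum_sub_distrib, Finset.sum_const, Nat.card_Icc, nsmul_eq_mul]
    field_simp
    simp [mul_comm]
  rw [e]
  exact Finset.abs_sum_le_sum_abs _ _

variable {X : Type u} {A : Type v} [Fintype X] [Fintype A] [DecidableEq X] [DecidableEq A]
  {m L : ℕ} (E : Environment X A m L)

namespace Environment

lemma corruptionReward_nonneg (T : ℕ) : 0 ≤ E.corruptionReward T :=
  Real.iInf_nonneg fun _ => Finset.sum_nonneg fun _ _ => Finset.sum_nonneg fun _ _ =>
    Finset.sum_nonneg fun _ _ => abs_nonneg _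

lemma corruption_nonneg (T : ℕ) : 0 ≤ E.corruption T :=
  (E.corruptionReward_nonneg T).trans (le_max_right _ _)

/-- A quantity bounded by a multiple of the distance to every candidate for the uncorrupted
rewards is bounded by the same multiple of the corruption. -/
lemma le_mul_corruptionReward {T : ℕ} {D κ : ℝ} (hκ : 0 < κ)
    (h : ∀ r : X → A → unitInterval,
      D ≤ κ * ∑ t ∈ Finset.Icc 1 T, ∑ x, ∑ a, |E.meanReward t x a - r x a|) :
    D ≤ κ * E.corruptionReward T := by
  rw [← div_le_iff₀' hκ]
  exact le_ciInf fun r => (div_le_iff₀' hκ).2 (h r)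

lemma le_mul_corruptionCost {T : ℕ} {D κ : ℝ} (hκ : 0 < κ) (i : Fin m)
    (h : ∀ r : X → A → unitInterval,
      D ≤ κ * ∑ t ∈ Finset.Icc 1 T, ∑ x, ∑ a, |E.meanCost t i x a - r x a|) :
    D ≤ κ * E.corruptionCost T := by
  rw [← div_le_iff₀' hκ]
  refine le_ciInf fun g => (div_le_iff₀' hκ).2 ((h (g i)).trans ?_)
  refine mul_le_mul_of_nonneg_left (Finset.sum_le_sum fun t _ => ?_) hκ.le
  exact le_ciSup (f := fun i => ∑ x, ∑ a, |E.meanCost t i x a - g i x a|)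
    (Set.finite_range _).bddAbove i

lemma sum_abs_le_sum_sum_sum (f : ℕ → X → A → ℝ) (s : Finset ℕ) (x : X) (a : A) :
    ∑ t ∈ s, |f t x a| ≤ ∑ t ∈ s, ∑ x, ∑ a, |f t x a| := by
  refine Finset.sum_le_sum fun t _ => ?_
  refine le_trans ?_ (Finset.single_le_sum (f := fun x => ∑ a, |f t x a|)
    (fun y _ => Finset.sum_nonneg fun b _ => abs_nonneg _) (Finset.mem_univ x))
  exact Finset.single_le_sum (f := fun a => |f t x a|) (fun b _ => abs_nonneg _)
    (Finset.mem_univ a)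

/-- For any reference value `r`, the sum over `s` is that of the deviations from `r`, plus `s.card`
times the deviation of the average from `r`. -/
lemma abs_sum_sub_avg_le_of_range {T : ℕ} (hT : 0 < T) (f : ℕ → ℝ) (r : ℝ) {s : Finset ℕ}
    (hs : s ⊆ Finset.range T) :
    |∑ j ∈ s, (f (j + 1) - 1 / (T : ℝ) * ∑ t ∈ Finset.Icc 1 T, f t)|
      ≤ (1 + s.card / T) * ∑ t ∈ Finset.Icc 1 T, |f t - r| := by
  have hT' : (0 : ℝ) < T := by exact_mod_cast hT
  have h1 := sum_abs_sub_avg_le hT f r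
  set g := 1 / (T : ℝ) * ∑ t ∈ Finset.Icc 1 T, f t
  have h2 : ∑ j ∈ s, |f (j + 1) - r| ≤ ∑ t ∈ Finset.Icc 1 T, |f t - r| := by
    rw [sum_Icc_one_eq_sum_range (fun t => |f t - r|)]
    exact Finset.sum_le_sum_of_subset_of_nonneg hs fun _ _ _ => abs_nonneg _
  have h3 : ∑ j ∈ s, (f (j + 1) - g) = ∑ j ∈ s, (f (j + 1) - r) + s.card * (r - g) := by
    rw [← nsmul_eq_mul, ← Finset.sum_const, ← Finset.sum_add_distrib]
    exact Finset.sum_congr rfl fun _ _ => by ring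
  rw [h3]
  refine (abs_add_le _ _).trans ?_
  have h4 := (Finset.abs_sum_le_sum_abs (fun j => f (j + 1) - r) s).trans h2
  have h5 : |(s.card : ℝ) * (r - g)| ≤ s.card / T * ∑ t ∈ Finset.Icc 1 T, |f t - r| := by
    rw [abs_mul, Nat.abs_cast, div_mul_eq_mul_div, le_div_iff₀ hT', mul_assoc]
    refine mul_le_mul_of_nonneg_left ?_ (Nat.cast_nonneg _)
    linarith
  linarith

lemma abs_sum_meanReward_sub_avg_le {T : ℕ} (hT : 0 < T) {C : ℝ} (hC : E.corruption T ≤ C)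
    (x : X) (a : A) {s : Finset ℕ} (hs : s ⊆ Finset.range T) :
    |∑ j ∈ s, (E.meanReward (j + 1) x a - E.avgReward T x a)| ≤ (1 + s.card / T) * C := by
  have hκ : (0 : ℝ) < 1 + s.card / T := by positivity
  refine (E.le_mul_corruptionReward hκ fun r => ?_).trans
    (mul_le_mul_of_nonneg_left ((le_max_right _ _).trans hC) hκ.le)
  refine (abs_sum_sub_avg_le_of_range hT (fun t => E.meanReward t x a) (r x a) hs).trans
    (mul_le_mul_of_nonneg_left ?_ hκ.le)
  exact sum_abs_le_sum_sum_sum (fun t x a => E.meanReward t x a - r x a) _ x a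

lemma abs_sum_meanCost_sub_avg_le {T : ℕ} (hT : 0 < T) {C : ℝ} (hC : E.corruption T ≤ C)
    (i : Fin m) (x : X) (a : A) {s : Finset ℕ} (hs : s ⊆ Finset.range T) :
    |∑ j ∈ s, (E.meanCost (j + 1) i x a - E.avgCost T i x a)| ≤ (1 + s.card / T) * C := by
  have hκ : (0 : ℝ) < 1 + s.card / T := by positivity
  refine (E.le_mul_corruptionCost hκ i fun r => ?_).trans
    (mul_le_mul_of_nonneg_left ((le_max_left _ _).trans hC) hκ.le)
  refine (abs_sum_sub_avg_le_of_range hT (fun t => E.meanCost t i x a) (r x a) hs).trans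
    (mul_le_mul_of_nonneg_left ?_ hκ.le)
  exact sum_abs_le_sum_sum_sum (fun t x a => E.meanCost t i x a - r x a) _ x a

lemma sum_abs_meanReward_sub_avg_le {T : ℕ} (hT : 0 < T) {C : ℝ} (hC : E.corruption T ≤ C) :
    ∑ t ∈ Finset.Icc 1 T, ∑ x, ∑ a, |E.meanReward t x a - E.avgReward T x a| ≤ 2 * C := by
  refine (E.le_mul_corruptionReward two_pos fun r => ?_).trans
    (mul_le_mul_of_nonneg_left ((le_max_right _ _).trans hC) two_pos.le)
  have h : ∀ x a, ∑ t ∈ Finset.Icc 1 T, |E.meanReward t x a - E.avgReward T x a|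
      ≤ 2 * ∑ t ∈ Finset.Icc 1 T, |E.meanReward t x a - r x a| := by
    intro x a
    have h1 := sum_abs_sub_avg_le hT (fun t => E.meanReward t x a) (r x a)
    have h2 : ∑ t ∈ Finset.Icc 1 T, |E.meanReward t x a - E.avgReward T x a|
        ≤ ∑ t ∈ Finset.Icc 1 T, (|E.meanReward t x a - r x a| + |r x a - E.avgReward T x a|) :=
      Finset.sum_le_sum fun t _ => abs_sub_le _ _ _
    rw [Finset.sum_add_distrib, Finset.sum_const, Nat.card_Icc, nsmul_eq_mul,
      Nat.add_sub_cancel] at h2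
    unfold avgReward at *
    linarith
  have swap : ∀ F : ℕ → X → A → ℝ, ∑ t ∈ Finset.Icc 1 T, ∑ x, ∑ a, F t x a
      = ∑ x, ∑ a, ∑ t ∈ Finset.Icc 1 T, F t x a := by
    intro F
    rw [Finset.sum_comm]
    exact Finset.sum_congr rfl fun x _ => Finset.sum_comm
  rw [swap, swap, Finset.mul_sum]
  refine Finset.sum_le_sum fun x _ => ?_
  rw [Finset.mul_sum]
  exact Finset.sum_le_sum fun a _ => h x a

lemma integral_mem_unitInterval {Ω : Type*} [MeasurableSpace Ω] {μ : Measure Ω}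
    [IsProbabilityMeasure μ] {f : Ω → ℝ} (h : ∀ᵐ ω ∂μ, f ω ∈ Set.Icc (0 : ℝ) 1) :
    ∫ ω, f ω ∂μ ∈ Set.Icc (0 : ℝ) 1 := by
  refine ⟨integral_nonneg_of_ae (h.mono fun ω hω => hω.1), ?_⟩
  have := norm_integral_le_of_norm_le_const (μ := μ) (f := f) (C := 1)
    (h.mono fun ω hω => by rw [Real.norm_eq_abs, abs_of_nonneg hω.1]; exact hω.2)
  simp only [probReal_univ, mul_one, Real.norm_eq_abs] at this
  exact (le_abs_self _).trans this

lemma meanReward_mem (t : ℕ) (x : X) (a : A) : E.meanReward t x a ∈ Set.Icc (0 : ℝ) 1 :=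
  haveI := E.rewardLaw_prob t
  integral_mem_unitInterval ((E.rewardLaw_mem t).mono fun _ h => h x a)

lemma meanCost_mem (t : ℕ) (i : Fin m) (x : X) (a : A) :
    E.meanCost t i x a ∈ Set.Icc (0 : ℝ) 1 :=
  haveI := E.costLaw_prob t
  integral_mem_unitInterval ((E.costLaw_mem t).mono fun _ h => h i x a)

lemma avg_mem {T : ℕ} (hT : 0 < T) {f : ℕ → ℝ} (hf : ∀ t, f t ∈ Set.Icc (0 : ℝ) 1) :
    1 / (T : ℝ) * ∑ t ∈ Finset.Icc 1 T, f t ∈ Set.Icc (0 : ℝ) 1 := by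
  have hT' : (0 : ℝ) < T := by exact_mod_cast hT
  have h1 : ∑ t ∈ Finset.Icc 1 T, f t ≤ ∑ t ∈ Finset.Icc 1 T, (1 : ℝ) :=
    Finset.sum_le_sum fun t _ => (hf t).2
  simp only [Finset.sum_const, Nat.card_Icc, Nat.add_sub_cancel, nsmul_eq_mul, mul_one] at h1
  refine ⟨mul_nonneg (by positivity) (Finset.sum_nonneg fun t _ => (hf t).1), ?_⟩
  rw [one_div_mul_eq_div, div_le_one hT']
  exact h1

lemma avgReward_mem {T : ℕ} (hT : 0 < T) (x : X) (a : A) :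
    E.avgReward T x a ∈ Set.Icc (0 : ℝ) 1 := avg_mem hT fun t => E.meanReward_mem t x a

lemma avgCost_mem {T : ℕ} (hT : 0 < T) (i : Fin m) (x : X) (a : A) :
    E.avgCost T i x a ∈ Set.Icc (0 : ℝ) 1 := avg_mem hT fun t => E.meanCost_mem t i x a

end Environment
end Corruption

/-! ### Confidence intervals -/

section Confidence

variable {X : Type u} {A : Type v} [Fintype X] [Fintype A] [DecidableEq X] [DecidableEq A]
  {m L T : ℕ} {E : Environment X A m L} {δ C : ℝ}

open Classical in
/-- The event on which the regret of the algorithm is controlled: the sampled quantities are in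
their ranges, the observed rewards, costs and transitions deviate little from their conditional
means, and the visits, with the weights `w`, are close to their conditional probabilities. Only the
deviations that the regret depends on are included: costs are not overestimated, and the weighted
visits are not much fewer than expected. -/
structure IsTypicalRun (E : Environment X A m L) (T : ℕ) (δ : ℝ) (w : X → A → ℕ → ℝ) (b : ℝ)
    (H : ℕ → Episode X A m L) (π : ℕ → X → A → ℝ) : Prop where
  policy : ∀ t < T, IsPolicy (π (t + 1))
  layered : ∀ t < T, (H (t + 1)).traj.Layered E.toLayering
  reward_mem : ∀ t < T, ∀ x a, (H (t + 1)).reward x a ∈ Set.Icc (0 : ℝ) 1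
  cost_mem : ∀ t < T, ∀ i x a, (H (t + 1)).cost i x a ∈ Set.Icc (0 : ℝ) 1
  reward_dev : ∀ t ≤ T, ∀ x a, 0 < visitCount H t x a →
    |∑ j ∈ Finset.range t, if (H (j + 1)).traj.Visits x a then
      (H (j + 1)).reward x a - E.meanReward (j + 1) x a else 0|
      ≤ √(visitCount H t x a * Real.log (2 * T * Fintype.card X * Fintype.card A / δ) / 2)
  cost_dev : ∀ t ≤ T, ∀ i x a, 0 < visitCount H t x a →
    ∑ j ∈ Finset.range t, (if (H (j + 1)).traj.Visits x a then
      (H (j + 1)).cost i x a - E.meanCost (j + 1) i x a else 0)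
      ≤ √(visitCount H t x a * Real.log (2 * m * T * Fintype.card X * Fintype.card A / δ) / 2)
  moves_lower : ∀ t ≤ T, ∀ x a x', 0 < visitCount H t x a →
    visitCount H t x a * E.P x a x' - moveCount H t x a x'
      ≤ 2 * √(visitCount H t x a * E.P x a x' * logTerm X A T δ)
  moves_upper : ∀ t ≤ T, ∀ x a x', 0 < visitCount H t x a →
    moveCount H t x a x' - visitCount H t x a * E.P x a x'
      ≤ 2 * √(visitCount H t x a * E.P x a x' * logTerm X A T δ) + 2 * logTerm X A T δ
  visits_dev : ∑ t ∈ Finset.range T, ∑ x, ∑ a, w x a (visitCount H t x a) *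
      (pairOcc (E.occ (π (t + 1))) x a - if (H (t + 1)).traj.Visits x a then (1 : ℝ) else 0)
    ≤ b * L * √(2 * T * logTerm X A T δ)

lemma sqrt_mul_div_self {n c : ℝ} (hn : 0 < n) : √(n * c / 2) / n = √(c / (2 * n)) := by
  rw [div_eq_iff hn.ne']
  nth_rewrite 3 [← Real.sqrt_sq hn.le]
  rw [← Real.sqrt_mul' _ (by positivity)]
  congr 1
  field_simp

open Classical in
/-- The error of the empirical mean of the observations `V` is at most the sum of a stochastic
deviation `s` and of a bias caused by the corruption. -/
lemma empirical_sub_avg_le (H : ℕ → Episode X A m L) {t : ℕ} (htT : t ≤ T) (x : X) (a : A)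
    (hN : 0 < visitCount H t x a) {V mean : ℕ → ℝ} {avg s : ℝ}
    (hs : ∑ j ∈ Finset.range t, (if (H (j + 1)).traj.Visits x a then V j - mean j else 0) ≤ s)
    (hb : ∀ S ⊆ Finset.range T, ∑ j ∈ S, (mean j - avg) ≤ (1 + S.card / T) * C) :
    (∑ j ∈ Finset.range t, if (H (j + 1)).traj.Visits x a then V j else 0) /
        max (visitCount H t x a : ℝ) 1 - avg
      ≤ s / visitCount H t x a + C / max (visitCount H t x a : ℝ) 1 + C / T := by
  set N := visitCount H t x a with hNdef
  have hN' : (0 : ℝ) < N := by exact_mod_cast hN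
  have hN1 : max (N : ℝ) 1 = N := max_eq_left (by exact_mod_cast hN)
  set S := (Finset.range t).filter fun j => (H (j + 1)).traj.Visits x a with hS
  have hcard : (S.card : ℝ) = N := by
    rw [hNdef, visitCount_eq_sum, hS, Finset.card_filter]
    push_cast
    rfl
  have h1 := hb S ((Finset.filter_subset _ _).trans (Finset.range_mono htT))
  rw [hcard] at h1
  rw [← Finset.sum_filter, ← hS] at hs ⊢
  have h2 : ∑ j ∈ S, V j = ∑ j ∈ S, (V j - mean j) + ∑ j ∈ S, (mean j - avg) + N * avg := by
    rw [← hcard, ← nsmul_eq_mul, ← Finset.sum_const, ← Finset.sum_add_distrib,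
      ← Finset.sum_add_distrib]
    exact Finset.sum_congr rfl fun _ _ => by ring
  rw [hN1, h2, ← sub_nonneg]
  have h3 : s / N + C / N + C / T - ((∑ j ∈ S, (V j - mean j) + ∑ j ∈ S, (mean j - avg)
      + N * avg) / N - avg) = ((s - ∑ j ∈ S, (V j - mean j)) +
        ((1 + N / T) * C - ∑ j ∈ S, (mean j - avg))) / N := by
    field_simp
    ring
  rw [h3]
  exact div_nonneg (by linarith) hN'.le

lemma two_le_card (E : Environment X A m L) (hL : 0 < L) : 2 ≤ Fintype.card X := by
  have : E.start ≠ E.terminal := by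
    intro h
    have h1 := E.layer_start
    rw [h, (E.layer_eq_last_iff _).2 rfl] at h1
    have := congrArg Fin.val h1
    simp at this
    omega
  exact Fintype.one_lt_card_iff.2 ⟨_, _, this⟩

namespace IsTypicalRun

variable {w : X → A → ℕ → ℝ} {b : ℝ} {H : ℕ → Episode X A m L} {π : ℕ → X → A → ℝ}

open Classical in
lemma empirical_mem (H : ℕ → Episode X A m L) {t : ℕ} (x : X) (a : A) {V : ℕ → ℝ}
    (hV : ∀ j < t, V j ∈ Set.Icc (0 : ℝ) 1) :
    (∑ j ∈ Finset.range t, if (H (j + 1)).traj.Visits x a then V j else 0) /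
        max (visitCount H t x a : ℝ) 1 ∈ Set.Icc (0 : ℝ) 1 := by
  have hpos : (0 : ℝ) < max (visitCount H t x a : ℝ) 1 := lt_max_of_lt_right one_pos
  refine ⟨div_nonneg (Finset.sum_nonneg fun j hj => ?_) hpos.le, (div_le_one hpos).2 ?_⟩
  · split_ifs
    · exact (hV j (Finset.mem_range.1 hj)).1
    · exact le_rfl
  · refine le_max_of_le_left ?_
    rw [visitCount_eq_sum]
    refine Finset.sum_le_sum fun j hj => ?_
    split_ifs
    · exact (hV j (Finset.mem_range.1 hj)).2
    · exact le_rfl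

/-- For a pair without visits the width must be `1`; this is where the lower bound on the logarithm is
needed. -/
lemma abs_empReward_sub_le (h : IsTypicalRun E T δ w b H π) (hT : 0 < T)
    (hC : E.corruption T ≤ C)
    (hlog : 2 ≤ Real.log (2 * T * Fintype.card X * Fintype.card A / δ))
    {t : ℕ} (ht : t ≤ T) (x : X) (a : A) :
    |empReward H t x a - E.avgReward T x a| ≤ rewardWidth T δ C H t x a := by
  classical
  have hC0 : 0 ≤ C := (E.corruption_nonneg T).trans hC
  have havg := E.avgReward_mem hT x a
  have hemp : empReward H t x a = (∑ j ∈ Finset.range t,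
      if (H (j + 1)).traj.Visits x a then (H (j + 1)).reward x a else 0) /
        max (visitCount H t x a : ℝ) 1 := by
    unfold empReward
    rw [sum_Icc_one_eq_sum_range fun τ => if (H τ).traj.Visits x a then (H τ).reward x a else 0]
  have hmem : empReward H t x a ∈ Set.Icc (0 : ℝ) 1 := by
    rw [hemp]
    exact empirical_mem H x a fun j hj => h.reward_mem j (by omega) x a
  unfold rewardWidth
  refine le_min (abs_sub_le_iff.2 ⟨by linarith [hmem.2, havg.1], by linarith [hmem.1, havg.2]⟩) ?_
  rcases Nat.eq_zero_or_pos (visitCount H t x a) with h0 | hN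
  · rw [h0]
    have h1 : 1 ≤ √(Real.log (2 * T * Fintype.card X * Fintype.card A / δ) /
        (2 * max ((0 : ℕ) : ℝ) 1)) := by
      rw [Real.one_le_sqrt, Nat.cast_zero, max_eq_right zero_le_one, mul_one]
      linarith
    have h2 : 0 ≤ C / max ((0 : ℕ) : ℝ) 1 := by positivity
    have h3 : 0 ≤ C / T := by positivity
    rw [abs_sub_le_iff]
    constructor <;> linarith [hmem.1, hmem.2, havg.1, havg.2]
  · have hN' : (0 : ℝ) < visitCount H t x a := by exact_mod_cast hN
    have hN1 : max (visitCount H t x a : ℝ) 1 = visitCount H t x a :=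
      max_eq_left (by exact_mod_cast hN)
    have hdev := abs_le.1 (h.reward_dev t ht x a hN)
    have e := sqrt_mul_div_self (c := Real.log (2 * T * Fintype.card X * Fintype.card A / δ)) hN'
    rw [abs_sub_le_iff]
    constructor
    · have := empirical_sub_avg_le (C := C) (V := fun j => (H (j + 1)).reward x a)
        (mean := fun j => E.meanReward (j + 1) x a) (avg := E.avgReward T x a) H ht x a hN hdev.2
        fun S hS => (abs_le.1 (E.abs_sum_meanReward_sub_avg_le hT hC x a hS)).2
      rw [e, ← hemp] at this
      rwa [hN1] at this ⊢
    · have := empirical_sub_avg_le (C := C) (V := fun j => -(H (j + 1)).reward x a)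
        (mean := fun j => -E.meanReward (j + 1) x a) (avg := -E.avgReward T x a)
        (s := √(visitCount H t x a *
          Real.log (2 * T * Fintype.card X * Fintype.card A / δ) / 2)) H ht x a hN
        (by
          refine le_trans (le_of_eq ?_) (neg_le.1 hdev.1)
          rw [← Finset.sum_neg_distrib]
          refine Finset.sum_congr rfl fun j _ => ?_
          split_ifs <;> ring)
        fun S hS => by
          refine le_trans (le_of_eq ?_)
            (neg_le.1 (abs_le.1 (E.abs_sum_meanReward_sub_avg_le hT hC x a hS)).1)
          rw [← Finset.sum_neg_distrib]
          exact Finset.sum_congr rfl fun j _ => by ring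
      have e2 : ∑ j ∈ Finset.range t,
          (if (H (j + 1)).traj.Visits x a then -(H (j + 1)).reward x a else 0)
          = -∑ j ∈ Finset.range t,
          if (H (j + 1)).traj.Visits x a then (H (j + 1)).reward x a else 0 := by
        rw [← Finset.sum_neg_distrib]
        refine Finset.sum_congr rfl fun j _ => ?_
        split_ifs <;> simp
      rw [e, e2, neg_div, ← hemp] at this
      rw [hN1] at this ⊢
      linarith

/-- The benchmark can become infeasible only if costs are overestimated. A pair without visits, whose
empirical cost is `0`, is therefore harmless, and no lower bound on the logarithm is needed. -/
lemma empCost_sub_le (h : IsTypicalRun E T δ w b H π) (hT : 0 < T)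
    (hC : E.corruption T ≤ C) {t : ℕ} (ht : t ≤ T) (i : Fin m) (x : X) (a : A) :
    empCost H t i x a - E.avgCost T i x a ≤ costWidth T δ C H t x a := by
  classical
  have hC0 : 0 ≤ C := (E.corruption_nonneg T).trans hC
  have havg := E.avgCost_mem hT i x a
  have hemp : empCost H t i x a = (∑ j ∈ Finset.range t,
      if (H (j + 1)).traj.Visits x a then (H (j + 1)).cost i x a else 0) /
        max (visitCount H t x a : ℝ) 1 := by
    unfold empCost
    rw [sum_Icc_one_eq_sum_range fun τ => if (H τ).traj.Visits x a then (H τ).cost i x a else 0]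
  have hmem : empCost H t i x a ∈ Set.Icc (0 : ℝ) 1 := by
    rw [hemp]
    exact empirical_mem H x a fun j hj => h.cost_mem j (by omega) i x a
  unfold costWidth
  refine le_min (by linarith [hmem.2, havg.1]) ?_
  rcases Nat.eq_zero_or_pos (visitCount H t x a) with h0 | hN
  · have h1 : empCost H t i x a = 0 := by
      rw [hemp, Finset.sum_eq_zero, zero_div]
      intro j hj
      rw [if_neg]
      intro hv
      have h2 := visitCount_mono H x a (Nat.succ_le_of_lt (Finset.mem_range.1 hj))
      simp only [Nat.succ_eq_add_one, visitCount_succ, hv, if_true, h0] at h2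
      omega
    rw [h1]
    have h2 : (0 : ℝ) ≤ √(Real.log (2 * m * T * Fintype.card X * Fintype.card A / δ) /
      (2 * max (visitCount H t x a : ℝ) 1)) + C / max (visitCount H t x a : ℝ) 1 + C / T := by
      positivity
    linarith [havg.1]
  · have hN' : (0 : ℝ) < visitCount H t x a := by exact_mod_cast hN
    have hN1 : max (visitCount H t x a : ℝ) 1 = visitCount H t x a :=
      max_eq_left (by exact_mod_cast hN)
    have e := sqrt_mul_div_self
      (c := Real.log (2 * m * T * Fintype.card X * Fintype.card A / δ)) hN'
    have := empirical_sub_avg_le (C := C) (V := fun j => (H (j + 1)).cost i x a)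
      (mean := fun j => E.meanCost (j + 1) i x a) (avg := E.avgCost T i x a) H ht x a hN
      (h.cost_dev t ht i x a hN)
      fun S hS => (abs_le.1 (E.abs_sum_meanCost_sub_avg_le hT hC i x a hS)).2
    rw [e, ← hemp] at this
    rwa [hN1] at this ⊢

lemma moveCount_le_visitCount (H : ℕ → Episode X A m L) (t : ℕ) (x : X) (a : A) (x' : X) :
    moveCount H t x a x' ≤ visitCount H t x a := by
  classical
  unfold moveCount visitCount
  exact Finset.card_le_card (Finset.monotone_filter_right _ fun _ _ h => h.visits)

/-- The deviation bounds involve the true variance `N p`; solving a quadratic inequality for `√(N p)`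
replaces it by the number `M` of moves. -/
lemma abs_empTrans_sub_le (h : IsTypicalRun E T δ w b H π) (hl : 1 / 2 ≤ logTerm X A T δ)
    {t : ℕ} (ht : t ≤ T) (x : X) (a : A) (x' : X) :
    |empTrans H t x a x' - E.P x a x'| ≤ transWidth T δ H t x a x' := by
  unfold transWidth
  set l := logTerm X A T δ with hldef
  have hl0 : 0 < l := by linarith
  rcases Nat.eq_zero_or_pos (visitCount H t x a) with h0 | hN
  · have h1 : moveCount H t x a x' = 0 := by
      have := moveCount_le_visitCount H t x a x'; omega
    have h2 : empTrans H t x a x' = 0 := by simp [empTrans, h1]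
    rw [h2, h0, zero_sub, abs_neg, abs_of_nonneg (E.P_nonneg _ _ _)]
    have := E.P_le_one x a x'
    simp only [Nat.cast_zero, zero_sub, zero_mul, zero_div, Real.sqrt_zero, mul_zero, zero_add]
    rw [max_eq_left (by norm_num)]
    linarith
  set N : ℝ := (visitCount H t x a : ℝ) with hNdef
  have hN1 : (1 : ℝ) ≤ N := by rw [hNdef]; exact_mod_cast hN
  have hN0 : 0 < N := by linarith
  set M : ℝ := (moveCount H t x a x' : ℝ) with hM
  set p := E.P x a x' with hp
  have hp0 : 0 ≤ p := E.P_nonneg _ _ _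
  have hM0 : 0 ≤ M := Nat.cast_nonneg _
  have hlow := h.moves_lower t ht x a x' hN
  have hup := h.moves_upper t ht x a x' hN
  rw [← hM, ← hNdef, ← hp, ← hldef] at hlow hup
  set u := √(N * p) with hu
  set s := √l with hs
  set v := √M with hv
  have hu0 : 0 ≤ u := Real.sqrt_nonneg _
  have hs0 : 0 ≤ s := Real.sqrt_nonneg _
  have hv0 : 0 ≤ v := Real.sqrt_nonneg _
  have hu2 : u ^ 2 = N * p := Real.sq_sqrt (by positivity)
  have hs2 : s ^ 2 = l := Real.sq_sqrt hl0.le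
  have hv2 : v ^ 2 = M := Real.sq_sqrt hM0
  rw [show √(N * p * l) = u * s from Real.sqrt_mul (by positivity) _, ← hu2, ← hv2] at hlow hup
  rw [← hs2] at hup
  have key : |M - N * p| ≤ 2 * √(M * l) + 4 * l := by
    rw [Real.sqrt_mul hM0, ← hs2, ← hu2, ← hv2, Real.sqrt_sq hv0, Real.sqrt_sq hs0,
      abs_sub_le_iff]
    constructor
    · rcases le_total u v with h1 | h1
      · nlinarith [mul_nonneg hs0 (sub_nonneg.2 h1), sq_nonneg s]
      · nlinarith [mul_nonneg hs0 hv0, sq_nonneg s]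
    · have h1 : u ≤ v + 2 * s := by
        have : (u - s) ^ 2 ≤ (v + s) ^ 2 := by nlinarith [mul_nonneg hs0 hv0]
        have := abs_le_of_sq_le_sq' this (by positivity)
        linarith [this.2]
      nlinarith [mul_le_mul_of_nonneg_right h1 hs0]
  have hD : max 1 (N - 1) ≤ N := max_le hN1 (by linarith)
  have hD0 : 0 < max 1 (N - 1) := lt_max_of_lt_left one_pos
  have hemp : empTrans H t x a x' = M / N := by
    unfold empTrans; rw [max_eq_right hN1]
  rw [hemp]
  have e1 : M / N - p = (M - N * p) / N := by field_simp
  rw [e1, abs_div, abs_of_pos hN0]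
  have e2 : √(M * l) / N = √(M / N * l / N) := by
    rw [div_eq_iff hN0.ne']
    nth_rewrite 3 [← Real.sqrt_sq hN0.le]
    rw [← Real.sqrt_mul' _ (by positivity)]
    congr 1
    field_simp
  calc |M - N * p| / N ≤ (2 * √(M * l) + 4 * l) / N := by gcongr
    _ = 2 * √(M / N * l / N) + 4 * l / N := by rw [← e2]; ring
    _ ≤ 2 * √(M / N * l / max 1 (N - 1)) + 4 * l / max 1 (N - 1) := by gcongr
    _ ≤ _ := by
        gcongr 2 * √(M / N * l / max 1 (N - 1)) + ?_
        rw [div_le_div_iff₀ hD0 (by positivity)]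
        nlinarith [mul_pos hl0 hD0]

lemma sum_empTrans_le_one (h : IsTypicalRun E T δ w b H π) {t : ℕ} (ht : t ≤ T) (x : X) (a : A) :
    ∑ x', empTrans H t x a x' ≤ 1 := by
  classical
  unfold empTrans
  rw [← Finset.sum_div, div_le_one (lt_max_of_lt_left one_pos)]
  refine le_max_of_le_right (le_of_eq ?_)
  simp_rw [moveCount_eq_sum]
  rw [Finset.sum_comm, visitCount_eq_sum]
  exact Finset.sum_congr rfl fun j hj =>
    (h.layered j (by have := Finset.mem_range.1 hj; omega)).sum_moves x a

end IsTypicalRun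
end Confidence

/-! ### Comparison of occupancy measures -/

section Simulation

variable {X : Type u} {A : Type v} [Fintype X] [Fintype A] [DecidableEq X] [DecidableEq A]
  {m L T : ℕ} {E : Environment X A m L} {δ C : ℝ} {H : ℕ → Episode X A m L}

lemma pairing_le_pairing {v w : X → A → ℝ} {q : X → A → X → ℝ} (hvw : ∀ x a, v x a ≤ w x a)
    (hq : ∀ x a, 0 ≤ pairOcc q x a) : pairing v q ≤ pairing w q :=
  Finset.sum_le_sum fun x _ => Finset.sum_le_sum fun a _ =>
    mul_le_mul_of_nonneg_right (hvw x a) (hq x a)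

namespace ConfOcc

variable {t : ℕ} {q : X → A → X → ℝ}

lemma pairOcc_nonneg (h : ConfOcc E.toLayering T δ H t q) (x : X) (a : A) : 0 ≤ pairOcc q x a :=
  Finset.sum_nonneg fun _ _ => h.nonneg _ _ _

lemma pairOcc_of_last (h : ConfOcc E.toLayering T δ H t q) {x : X} (hx : ¬ (E.layer x : ℕ) < L)
    (a : A) : pairOcc q x a = 0 :=
  Finset.sum_eq_zero fun x' _ => h.support x a x' (by have := (E.layer x').2; omega)

lemma pairOcc_eq_policy_mul (h : ConfOcc E.toLayering T δ H t q) {π : X → A → ℝ}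
    (hπ : IsInducedPolicy q π) (x : X) (a : A) : pairOcc q x a = π x a * stateOcc q x := by
  by_cases h0 : stateOcc q x = 0
  · rw [h0, mul_zero]
    exact (Finset.sum_eq_zero_iff_of_nonneg fun b _ => h.pairOcc_nonneg x b).1 h0 a
      (Finset.mem_univ a)
  · rw [hπ.2 x a h0, div_mul_cancel₀ _ h0]

end ConfOcc

/-- If the transition function lies in the confidence set, then the true occupancy measures are
among those considered by the learner. -/
lemma confOcc_occ {t : ℕ} {π : X → A → ℝ} (hπ : IsPolicy π)
    (hP : ∀ x a x', |empTrans H t x a x' - E.P x a x'| ≤ transWidth T δ H t x a x') :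
    ConfOcc E.toLayering T δ H t (E.occ π) where
  nonneg := E.occ_nonneg hπ
  support x a x' hne := by
    rw [E.occ_eq_P_mul hπ]
    by_contra h
    exact hne (E.P_loopfree x a x' (left_ne_zero_of_mul h))
  mass k hk := E.sum_stateOcc_occ hπ hk
  flow x h0 hL := E.stateOcc_occ_flow hπ h0 hL
  upper x a x' _ := by
    rw [E.occ_eq_P_mul hπ]
    refine mul_le_mul_of_nonneg_right ?_ (E.pairOcc_occ_nonneg hπ x a)
    linarith [(abs_le.1 (hP x a x')).1]
  lower x a x' _ := by
    rw [E.occ_eq_P_mul hπ x a x']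
    refine mul_le_mul_of_nonneg_right ?_ (E.pairOcc_occ_nonneg hπ x a)
    linarith [(abs_le.1 (hP x a x')).2]

/-- Two occupancy measures of the same policy, for the transition functions `E.P` and `Q`, differ
on the layer `k` by at most the errors of `Q` accumulated in the previous layers. -/
lemma sum_abs_stateOcc_sub_le {t : ℕ} {q : X → A → X → ℝ} {π : X → A → ℝ}
    (hq : ConfOcc E.toLayering T δ H t q) (hπ : IsInducedPolicy q π) {Q : X → A → X → ℝ}
    (hQ0 : ∀ x a x', 0 ≤ Q x a x') (hQ1 : ∀ x a, ∑ x', Q x a x' ≤ 1)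
    (hQ : ∀ x a x', q x a x' = Q x a x' * pairOcc q x a) {k : ℕ} (hk : k < L) :
    ∑ x with (E.layer x : ℕ) = k, |stateOcc q x - stateOcc (E.occ π) x|
      ≤ ∑ x with (E.layer x : ℕ) < k, ∑ a, pairOcc (E.occ π) x a * ∑ x', |Q x a x' - E.P x a x'| := by
  induction k with
  | zero =>
    have hs : Finset.univ.filter (fun x => (E.layer x : ℕ) = 0) = {E.start} := by
      ext x
      simp only [Finset.mem_filter, Finset.mem_univ, true_and, Finset.mem_singleton]
      rw [← E.layer_eq_zero_iff, Fin.ext_iff]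
      rfl
    have h1 := hq.mass 0 hk
    have h2 := E.sum_stateOcc_occ hπ.1 hk
    simp only [hs, Finset.sum_singleton] at h1 h2 ⊢
    rw [h1, h2]
    simp
  | succ k ih =>
    have hstep : ∀ x, (E.layer x : ℕ) = k + 1 → |stateOcc q x - stateOcc (E.occ π) x|
        ≤ ∑ y with (E.layer y : ℕ) = k, ∑ a, (Q y a x * (π y a *
          |stateOcc q y - stateOcc (E.occ π) y|)
            + pairOcc (E.occ π) y a * |Q y a x - E.P y a x|) := by
      intro x hx
      have h0 : E.layer x ≠ 0 := fun h => by rw [h] at hx; simp at hx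
      have hL : E.layer x ≠ Fin.last L := E.ne_last_of_lt (by omega)
      rw [hq.flow x h0 hL, E.stateOcc_occ_flow hπ.1 h0 hL, ← Finset.sum_sub_distrib,
        Finset.sum_filter]
      refine (Finset.abs_sum_le_sum_abs _ _).trans (Finset.sum_le_sum fun y _ => ?_)
      split_ifs with hy
      · rw [← Finset.sum_sub_distrib]
        refine (Finset.abs_sum_le_sum_abs _ _).trans (Finset.sum_le_sum fun a _ => ?_)
        rw [hQ y a x, E.occ_eq_P_mul hπ.1 y a x]
        have e : Q y a x * pairOcc q y a - E.P y a x * pairOcc (E.occ π) y a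
            = Q y a x * (π y a * (stateOcc q y - stateOcc (E.occ π) y))
              + pairOcc (E.occ π) y a * (Q y a x - E.P y a x) := by
          rw [hq.pairOcc_eq_policy_mul hπ, E.pairOcc_occ_eq_policy_mul hπ.1]; ring
        rw [e]
        refine (abs_add_le _ _).trans (le_of_eq ?_)
        rw [abs_mul, abs_mul, abs_mul, abs_of_nonneg (hQ0 y a x), abs_of_nonneg (hπ.1.1 y a),
          abs_of_nonneg (E.pairOcc_occ_nonneg hπ.1 y a)]
      · have h1 : ∀ a, q y a x = 0 := fun a => hq.support y a x (by omega)
        have h2 : ∀ a, E.occ π y a x = 0 := fun a => by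
          rw [E.occ_eq_P_mul hπ.1]
          by_contra h
          have := E.P_loopfree y a x (left_ne_zero_of_mul h)
          omega
        simp [h1, h2]
    have hpos : ∀ y a x, 0 ≤ Q y a x * (π y a * |stateOcc q y - stateOcc (E.occ π) y|)
        + pairOcc (E.occ π) y a * |Q y a x - E.P y a x| := fun y a x =>
      add_nonneg (mul_nonneg (hQ0 _ _ _) (mul_nonneg (hπ.1.1 _ _) (abs_nonneg _)))
        (mul_nonneg (E.pairOcc_occ_nonneg hπ.1 _ _) (abs_nonneg _))
    have hsplit : Finset.univ.filter (fun x => (E.layer x : ℕ) < k + 1)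
        = Finset.univ.filter (fun x => (E.layer x : ℕ) < k) ∪
          Finset.univ.filter (fun x => (E.layer x : ℕ) = k) := by
      ext x; simp; omega
    rw [hsplit, Finset.sum_union (by
      rw [Finset.disjoint_filter]; intro x _ h1 h2; omega)]
    calc ∑ x with (E.layer x : ℕ) = k + 1, |stateOcc q x - stateOcc (E.occ π) x|
        ≤ ∑ x with (E.layer x : ℕ) = k + 1, ∑ y with (E.layer y : ℕ) = k, ∑ a,
          (Q y a x * (π y a * |stateOcc q y - stateOcc (E.occ π) y|)
            + pairOcc (E.occ π) y a * |Q y a x - E.P y a x|) :=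
          Finset.sum_le_sum fun x hx => hstep x (Finset.mem_filter.1 hx).2
      _ ≤ ∑ x, ∑ y with (E.layer y : ℕ) = k, ∑ a,
          (Q y a x * (π y a * |stateOcc q y - stateOcc (E.occ π) y|)
            + pairOcc (E.occ π) y a * |Q y a x - E.P y a x|) :=
          Finset.sum_le_sum_of_subset_of_nonneg (Finset.filter_subset _ _) fun x _ _ =>
            Finset.sum_nonneg fun y _ => Finset.sum_nonneg fun a _ => hpos y a x
      _ = ∑ y with (E.layer y : ℕ) = k, ∑ a,
          ((∑ x, Q y a x) * (π y a * |stateOcc q y - stateOcc (E.occ π) y|)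
            + pairOcc (E.occ π) y a * ∑ x, |Q y a x - E.P y a x|) := by
          rw [Finset.sum_comm]
          refine Finset.sum_congr rfl fun y _ => ?_
          rw [Finset.sum_comm]
          refine Finset.sum_congr rfl fun a _ => ?_
          rw [Finset.sum_add_distrib, Finset.sum_mul, Finset.mul_sum]
      _ ≤ ∑ y with (E.layer y : ℕ) = k, ∑ a,
          (π y a * |stateOcc q y - stateOcc (E.occ π) y|
            + pairOcc (E.occ π) y a * ∑ x, |Q y a x - E.P y a x|) := by
          refine Finset.sum_le_sum fun y _ => Finset.sum_le_sum fun a _ =>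
            add_le_add_left (mul_le_of_le_one_left ?_ (hQ1 y a)) _
          exact mul_nonneg (hπ.1.1 _ _) (abs_nonneg _)
      _ = ∑ y with (E.layer y : ℕ) = k, |stateOcc q y - stateOcc (E.occ π) y|
          + ∑ y with (E.layer y : ℕ) = k, ∑ a,
            pairOcc (E.occ π) y a * ∑ x, |Q y a x - E.P y a x| := by
          rw [← Finset.sum_add_distrib]
          refine Finset.sum_congr rfl fun y _ => ?_
          rw [Finset.sum_add_distrib, ← Finset.sum_mul, hπ.1.2 y, one_mul]
      _ ≤ _ := add_le_add_left (ih (by omega)) _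

/-- The simulation lemma: every layer contributes at most the total error of `Q` collected along the
true occupancy measure. -/
lemma sum_abs_pairOcc_sub_le {t : ℕ} {q : X → A → X → ℝ} {π : X → A → ℝ}
    (hq : ConfOcc E.toLayering T δ H t q) (hπ : IsInducedPolicy q π) {Q : X → A → X → ℝ}
    (hQ0 : ∀ x a x', 0 ≤ Q x a x') (hQ1 : ∀ x a, ∑ x', Q x a x' ≤ 1)
    (hQ : ∀ x a x', q x a x' = Q x a x' * pairOcc q x a) :
    ∑ x, ∑ a, |pairOcc q x a - pairOcc (E.occ π) x a|
      ≤ L * ∑ x, ∑ a, pairOcc (E.occ π) x a * ∑ x', |Q x a x' - E.P x a x'| := by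
  have h1 : ∀ x, ∑ a, |pairOcc q x a - pairOcc (E.occ π) x a|
      = ∑ k ∈ Finset.range L, if (E.layer x : ℕ) = k then
        |stateOcc q x - stateOcc (E.occ π) x| else 0 := by
    intro x
    rw [Finset.sum_ite_eq]
    by_cases hx : (E.layer x : ℕ) < L
    · rw [if_pos (Finset.mem_range.2 hx)]
      simp_rw [hq.pairOcc_eq_policy_mul hπ, E.pairOcc_occ_eq_policy_mul hπ.1, ← mul_sub, abs_mul,
        abs_of_nonneg (hπ.1.1 _ _), ← Finset.sum_mul]
      rw [hπ.1.2 x, one_mul]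
    · rw [if_neg (fun h => hx (Finset.mem_range.1 h))]
      simp [hq.pairOcc_of_last hx, E.pairOcc_occ_of_last hπ.1 hx]
  simp_rw [h1]
  rw [Finset.sum_comm]
  have h2 : ∀ k ∈ Finset.range L, (∑ x, if (E.layer x : ℕ) = k then
        |stateOcc q x - stateOcc (E.occ π) x| else 0)
      ≤ ∑ x, ∑ a, pairOcc (E.occ π) x a * ∑ x', |Q x a x' - E.P x a x'| := by
    intro k hk
    rw [← Finset.sum_filter]
    refine (sum_abs_stateOcc_sub_le hq hπ hQ0 hQ1 hQ (Finset.mem_range.1 hk)).trans ?_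
    refine Finset.sum_le_sum_of_subset_of_nonneg (Finset.filter_subset _ _) fun x _ _ =>
      Finset.sum_nonneg fun a _ => mul_nonneg (E.pairOcc_occ_nonneg hπ.1 _ _)
        (Finset.sum_nonneg fun _ _ => abs_nonneg _)
  refine (Finset.sum_le_sum h2).trans (le_of_eq ?_)
  rw [Finset.sum_const, Finset.card_range, nsmul_eq_mul]

/-- The number of states in the layer that follows the layer of `x`. -/
noncomputable def nextCard (E : Environment X A m L) (x : X) : ℕ :=
  (Finset.univ.filter fun x' => (E.layer x' : ℕ) = E.layer x + 1).card

/-- A bound on the `ℓ¹` diameter of the confidence set for the transitions from `x`, after `n`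
visits. The first-order term of the width is absorbed by the bound `2`. -/
noncomputable def transError (E : Environment X A m L) (T : ℕ) (δ : ℝ) (x : X) (n : ℕ) : ℝ :=
  min 2 (14 * √(nextCard E x * logTerm X A T δ / max 1 ((n : ℝ) - 1)))

/-- The transition function that generates `q`; it is `E.P` where `q` does not determine it. -/
noncomputable def inducedTrans (E : Environment X A m L) (q : X → A → X → ℝ) (x : X) (a : A)
    (x' : X) : ℝ :=
  if pairOcc q x a = 0 then E.P x a x' else q x a x' / pairOcc q x a

section InducedTrans

variable {t : ℕ} {q : X → A → X → ℝ}

lemma inducedTrans_nonneg (hq : ConfOcc E.toLayering T δ H t q) (x : X) (a : A) (x' : X) :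
    0 ≤ inducedTrans E q x a x' := by
  unfold inducedTrans
  split_ifs
  · exact E.P_nonneg _ _ _
  · exact div_nonneg (hq.nonneg _ _ _) (hq.pairOcc_nonneg _ _)

lemma sum_P_le_one (E : Environment X A m L) (x : X) (a : A) : ∑ x', E.P x a x' ≤ 1 := by
  by_cases hx : (E.layer x : ℕ) < L
  · exact (E.P_sum x a (E.ne_last_of_lt hx)).le
  · simp [E.P_eq_zero_of_last hx]

lemma sum_inducedTrans_le_one (q : X → A → X → ℝ) (x : X) (a : A) :
    ∑ x', inducedTrans E q x a x' ≤ 1 := by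
  unfold inducedTrans
  split_ifs with h
  · exact sum_P_le_one E x a
  · rw [← Finset.sum_div]
    exact (div_self h).le

lemma inducedTrans_mul (hq : ConfOcc E.toLayering T δ H t q) (x : X) (a : A) (x' : X) :
    q x a x' = inducedTrans E q x a x' * pairOcc q x a := by
  unfold inducedTrans
  split_ifs with h
  · rw [h, mul_zero]
    exact (Finset.sum_eq_zero_iff_of_nonneg fun y _ => hq.nonneg x a y).1 h x' (Finset.mem_univ _)
  · rw [div_mul_cancel₀ _ h]

lemma abs_inducedTrans_sub_le (hq : ConfOcc E.toLayering T δ H t q)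
    (hP : ∀ x a x', |empTrans H t x a x' - E.P x a x'| ≤ transWidth T δ H t x a x')
    (x : X) (a : A) (x' : X) : |inducedTrans E q x a x' - E.P x a x'|
      ≤ if (E.layer x' : ℕ) = E.layer x + 1 then 2 * transWidth T δ H t x a x' else 0 := by
  have h1 := abs_le.1 (hP x a x')
  unfold inducedTrans
  split_ifs with h0 hl hl
  · rw [sub_self, abs_zero]
    have := (abs_nonneg _).trans (hP x a x')
    linarith
  · rw [sub_self, abs_zero]
  · have hpos : 0 < pairOcc q x a := lt_of_le_of_ne (hq.pairOcc_nonneg x a) (Ne.symm h0)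
    have h2 := (div_le_iff₀ hpos).2 (hq.upper x a x' hl)
    have h3 := (le_div_iff₀ hpos).2 (hq.lower x a x' hl)
    rw [abs_le]
    constructor <;> linarith
  · rw [hq.support x a x' hl]
    have : E.P x a x' = 0 := by
      by_contra h
      exact hl (E.P_loopfree x a x' h)
    simp [this]

lemma sum_abs_inducedTrans_sub_le (hq : ConfOcc E.toLayering T δ H t q)
    (hl : 0 ≤ logTerm X A T δ)
    (hP : ∀ x a x', |empTrans H t x a x' - E.P x a x'| ≤ transWidth T δ H t x a x')
    (hsum : ∀ x a, ∑ x', empTrans H t x a x' ≤ 1) (x : X) (a : A) :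
    ∑ x', |inducedTrans E q x a x' - E.P x a x'| ≤ transError E T δ x (visitCount H t x a) := by
  have h2 : ∑ x', |inducedTrans E q x a x' - E.P x a x'| ≤ 2 := by
    have h1 : ∀ x', |inducedTrans E q x a x' - E.P x a x'|
        ≤ inducedTrans E q x a x' + E.P x a x' := fun x' => by
      rw [abs_le]
      constructor <;> linarith [inducedTrans_nonneg hq x a x', E.P_nonneg x a x']
    refine (Finset.sum_le_sum fun x' _ => h1 x').trans ?_
    rw [Finset.sum_add_distrib]
    linarith [sum_inducedTrans_le_one (E := E) q x a, sum_P_le_one E x a]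
  refine le_min h2 ?_
  set S := Finset.univ.filter fun x' => (E.layer x' : ℕ) = E.layer x + 1 with hS
  set D : ℝ := max 1 ((visitCount H t x a : ℝ) - 1) with hD
  have hD0 : 0 < D := lt_max_of_lt_left one_pos
  set l := logTerm X A T δ with hldef
  set y : ℝ := nextCard E x * l / D with hy
  have hy0 : 0 ≤ y := by positivity
  have hd : (nextCard E x : ℝ) = S.card := rfl
  have hemp0 : ∀ x', 0 ≤ empTrans H t x a x' := fun x' => by unfold empTrans; positivity
  have hsq : ∑ x' ∈ S, √(empTrans H t x a x') ≤ √(S.card) := by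
    refine Real.le_sqrt_of_sq_le ?_
    refine sq_sum_le_card_mul_sum_sq.trans ?_
    refine mul_le_of_le_one_right (Nat.cast_nonneg _) ?_
    refine le_trans ?_ (hsum x a)
    simp_rw [Real.sq_sqrt (hemp0 _)]
    exact Finset.sum_le_sum_of_subset_of_nonneg (Finset.filter_subset _ _) fun x' _ _ => hemp0 x'
  have h3 : ∑ x', |inducedTrans E q x a x' - E.P x a x'| ≤ 4 * √y + 28 / 3 * y := by
    refine (Finset.sum_le_sum fun x' _ => abs_inducedTrans_sub_le hq hP x a x').trans ?_
    rw [← Finset.sum_filter, ← hS]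
    have e : ∀ x', 2 * transWidth T δ H t x a x'
        = 4 * √(l / D) * √(empTrans H t x a x') + 28 / 3 * (l / D) := by
      intro x'
      unfold transWidth
      rw [← hldef, ← hD, mul_div_assoc, Real.sqrt_mul (hemp0 x')]
      field_simp
      ring
    simp_rw [e]
    rw [Finset.sum_add_distrib, ← Finset.mul_sum, Finset.sum_const, nsmul_eq_mul]
    refine add_le_add ?_ (le_of_eq ?_)
    · rw [hy, hd, mul_div_assoc, Real.sqrt_mul (Nat.cast_nonneg _)]
      have := mul_le_mul_of_nonneg_left hsq (by positivity : 0 ≤ 4 * √(l / D))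
      linarith
    · rw [hy, hd]; ring
  -- If `y ≤ 1`, then `y ≤ √y` and `4 + 28 / 3 ≤ 14`; otherwise the bound is at least `2`.
  rcases le_total y 1 with h1 | h1
  · refine h3.trans ?_
    have h4 : y ≤ √y := by
      rw [Real.le_sqrt hy0 hy0]
      nlinarith
    linarith
  · refine h2.trans ?_
    have : 1 ≤ √y := Real.one_le_sqrt.2 h1
    linarith

end InducedTrans
end Simulation

/-! ### Regret of a typical run -/

section Regret

lemma sum_one_div_sqrt_le {D : ℕ → ℝ} (hD : ∀ n : ℕ, (n : ℝ) + 1 ≤ 3 * D n) (N : ℕ) :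
    ∑ n ∈ Finset.range N, 1 / √(D n) ≤ 4 * √N := by
  induction N with
  | zero => simp
  | succ N ih =>
    rw [Finset.sum_range_succ]
    have hN : (0 : ℝ) ≤ N := Nat.cast_nonneg N
    have hDN := hD N
    have hD0 : 0 < D N := by linarith
    push_cast
    set u := √((N : ℝ) + 1) with hu
    set v := √(N : ℝ) with hv
    set w := √(D N) with hw
    have hw0 : 0 < w := Real.sqrt_pos.2 hD0
    have hu0 : 0 ≤ u := Real.sqrt_nonneg _
    have hu2 : u ^ 2 = N + 1 := Real.sq_sqrt (by linarith)
    have hv2 : v ^ 2 = N := Real.sq_sqrt hN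
    have hw2 : w ^ 2 = D N := Real.sq_sqrt hD0.le
    have hvu : v ≤ u := Real.sqrt_le_sqrt (by linarith)
    have huw : u ≤ 2 * w := abs_le_of_sq_le_sq' (by nlinarith) (by positivity) |>.2
    have h1 : 1 / w ≤ 4 * (u - v) := by
      rw [div_le_iff₀ hw0]
      nlinarith [mul_nonneg (sub_nonneg.2 hvu) (by linarith : 0 ≤ 4 * w - (u + v))]
    linarith

lemma sum_one_div_max_le {N T : ℕ} (hNT : N ≤ T) :
    ∑ n ∈ Finset.range N, 1 / max (n : ℝ) 1 ≤ 2 + Real.log T := by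
  have hlogT : 0 ≤ Real.log T := Real.log_natCast_nonneg T
  rcases N with _ | N
  · simp; linarith
  rw [Finset.sum_range_succ']
  have h1 : ∑ n ∈ Finset.range N, 1 / max (((n + 1 : ℕ)) : ℝ) 1 = (harmonic N : ℝ) := by
    unfold harmonic
    push_cast
    refine Finset.sum_congr rfl fun n _ => ?_
    rw [max_eq_left (by linarith [Nat.cast_nonneg (α := ℝ) n]), one_div]
  rw [h1]
  have h2 := harmonic_le_one_add_log N
  have h3 : Real.log N ≤ Real.log T := by
    rcases Nat.eq_zero_or_pos N with h0 | h0
    · simpa [h0] using hlogT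
    · exact Real.log_le_log (by exact_mod_cast h0) (by exact_mod_cast (by omega : N ≤ T))
  norm_num
  linarith

variable {X : Type u} {A : Type v} [Fintype X] [Fintype A] [DecidableEq X] [DecidableEq A]
  {m L T : ℕ} {E : Environment X A m L} {δ C : ℝ} {H : ℕ → Episode X A m L}
  {π : ℕ → X → A → ℝ}

/-- The width of the confidence interval of a mean reward after `n` visits. -/
noncomputable def visitWidth (X A : Type*) [Fintype X] [Fintype A] (T : ℕ) (δ C : ℝ) (n : ℕ) :
    ℝ :=
  min 1 (√(Real.log (2 * T * Fintype.card X * Fintype.card A / δ) / (2 * max (n : ℝ) 1))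
    + C / max (n : ℝ) 1 + C / T)

/-- The contribution to the regret of a visit to a pair that has been visited `n` times before. The
factor `3` bounds the optimistic reward `r̄ + 2 φ`, and `L` comes from the simulation lemma. -/
noncomputable def regretWeight (E : Environment X A m L) (T : ℕ) (δ C : ℝ) (x : X) (_ : A)
    (n : ℕ) : ℝ :=
  3 * L * transError E T δ x n + 2 * visitWidth X A T δ C n

lemma transError_nonneg (E : Environment X A m L) (T : ℕ) (δ : ℝ) (x : X) (n : ℕ) :
    0 ≤ transError E T δ x n := by
  unfold transError; positivity

lemma visitWidth_nonneg (hC : 0 ≤ C) (n : ℕ) : 0 ≤ visitWidth X A T δ C n := by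
  unfold visitWidth; positivity

lemma regretWeight_nonneg (hC : 0 ≤ C) (x : X) (a : A) (n : ℕ) :
    0 ≤ regretWeight E T δ C x a n :=
  add_nonneg (mul_nonneg (by positivity) (transError_nonneg E T δ x n))
    (mul_nonneg two_pos.le (visitWidth_nonneg hC n))

lemma regretWeight_le (hL : 0 < L) (x : X) (a : A) (n : ℕ) :
    regretWeight E T δ C x a n ≤ 8 * L := by
  have hL' : (1 : ℝ) ≤ L := by exact_mod_cast hL
  have h1 : transError E T δ x n ≤ 2 := min_le_left _ _
  have h2 : visitWidth X A T δ C n ≤ 1 := min_le_left _ _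
  have h3 := mul_le_mul_of_nonneg_left h1 (by positivity : (0 : ℝ) ≤ 3 * L)
  unfold regretWeight
  linarith

lemma pairing_occ_nonneg {p : X → A → ℝ} (hp : IsPolicy p) {v : X → A → ℝ}
    (hv : ∀ x a, 0 ≤ v x a) : 0 ≤ pairing v (E.occ p) :=
  Finset.sum_nonneg fun x _ => Finset.sum_nonneg fun a _ =>
    mul_nonneg (hv x a) (E.pairOcc_occ_nonneg hp x a)

lemma sum_pairOcc_occ {p : X → A → ℝ} (hp : IsPolicy p) :
    ∑ x, ∑ a, pairOcc (E.occ p) x a = L := by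
  have h1 : ∀ x, ∑ a, pairOcc (E.occ p) x a
      = ∑ k ∈ Finset.range L, if (E.layer x : ℕ) = k then stateOcc (E.occ p) x else 0 := by
    intro x
    rw [Finset.sum_ite_eq]
    by_cases hx : (E.layer x : ℕ) < L
    · rw [if_pos (Finset.mem_range.2 hx)]; rfl
    · rw [if_neg (fun h => hx (Finset.mem_range.1 h))]
      simp [E.pairOcc_occ_of_last hp hx]
  simp_rw [h1]
  rw [Finset.sum_comm]
  simp_rw [← Finset.sum_filter]
  rw [Finset.sum_congr rfl fun k hk => E.sum_stateOcc_occ hp (Finset.mem_range.1 hk)]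
  simp

lemma pairing_occ_le {p : X → A → ℝ} (hp : IsPolicy p) {v : X → A → ℝ}
    (hv : ∀ x a, v x a ≤ 1) : pairing v (E.occ p) ≤ L := by
  rw [← sum_pairOcc_occ (E := E) hp]
  refine Finset.sum_le_sum fun x _ => Finset.sum_le_sum fun a _ => ?_
  exact mul_le_of_le_one_left (E.pairOcc_occ_nonneg hp x a) (hv x a)

namespace IsTypicalRun

variable {w : X → A → ℕ → ℝ} {b : ℝ}

/-- The benchmark is feasible for the optimistic program, so that its value is at most the value of
the optimistic solution, and the latter exceeds the value of the policy played by at most the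
widths of the confidence sets. -/
lemma pairing_le_add_regretWeight (h : IsTypicalRun E T δ w b H π) (hT : 0 < T)
    (hC : E.corruption T ≤ C)
    (hlog : 2 ≤ Real.log (2 * T * Fintype.card X * Fintype.card A / δ))
    (hl : 1 / 2 ≤ logTerm X A T δ) {t : ℕ} (ht : t < T) {q : X → A → X → ℝ}
    (hq : q ∈ E.feasibleSet (E.avgCost T)) {q' : X → A → X → ℝ}
    (hq' : IsChoice E.toLayering E.α T δ C H t q') (hπ : IsInducedPolicy q' (π (t + 1))) :
    pairing (E.avgReward T) q ≤ pairing (E.avgReward T) (E.occ (π (t + 1)))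
      + ∑ x, ∑ a, regretWeight E T δ C x a (visitCount H t x a) *
        pairOcc (E.occ (π (t + 1))) x a := by
  have hP := h.abs_empTrans_sub_le hl ht.le
  have hR := h.abs_empReward_sub_le hT hC hlog ht.le
  obtain ⟨⟨p, hp, rfl⟩, hfeas⟩ := hq
  have hmem : E.occ p ∈ optFeasible E.toLayering E.α T δ C H t :=
    ⟨confOcc_occ hp hP, fun i => (pairing_le_pairing (fun x a => by
      have := h.empCost_sub_le hT hC ht.le i x a
      unfold optCost
      linarith) (E.pairOcc_occ_nonneg hp)).trans (hfeas i)⟩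
  obtain ⟨hq'mem, hmax⟩ := hq'.1 ⟨_, hmem⟩
  have hconf := hq'mem.1
  have h1 : pairing (E.avgReward T) (E.occ p) ≤ pairing (optReward T δ C H t) (E.occ p) :=
    pairing_le_pairing (fun x a => by
      unfold optReward; linarith [(abs_le.1 (hR x a)).1]) (E.pairOcc_occ_nonneg hp)
  have h2 : pairing (optReward T δ C H t) (E.occ p) ≤ pairing (optReward T δ C H t) q' := hmax hmem
  have h3 : pairing (optReward T δ C H t) q'
      ≤ pairing (fun x a => E.avgReward T x a + 2 * rewardWidth T δ C H t x a) q' :=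
    pairing_le_pairing (fun x a => by
      unfold optReward; linarith [(abs_le.1 (hR x a)).2]) hconf.pairOcc_nonneg
  have h4 : pairing (fun x a => E.avgReward T x a + 2 * rewardWidth T δ C H t x a) q'
      ≤ pairing (fun x a => E.avgReward T x a + 2 * rewardWidth T δ C H t x a)
        (E.occ (π (t + 1)))
        + 3 * ∑ x, ∑ a, |pairOcc q' x a - pairOcc (E.occ (π (t + 1))) x a| := by
    unfold pairing
    rw [Finset.mul_sum, ← Finset.sum_add_distrib]
    refine Finset.sum_le_sum fun x _ => ?_
    rw [Finset.mul_sum, ← Finset.sum_add_distrib]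
    refine Finset.sum_le_sum fun a _ => ?_
    have h5 := E.avgReward_mem hT x a
    have h6 : rewardWidth T δ C H t x a ≤ 1 := min_le_left _ _
    have h7 : 0 ≤ rewardWidth T δ C H t x a := (abs_nonneg _).trans (hR x a)
    have h8 : (E.avgReward T x a + 2 * rewardWidth T δ C H t x a) *
        (pairOcc q' x a - pairOcc (E.occ (π (t + 1))) x a)
        ≤ 3 * |pairOcc q' x a - pairOcc (E.occ (π (t + 1))) x a| :=
      (mul_le_mul_of_nonneg_left (le_abs_self _) (by linarith [h5.1])).trans
        (mul_le_mul_of_nonneg_right (by linarith [h5.2]) (abs_nonneg _))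
    linarith
  have h5 := sum_abs_pairOcc_sub_le hconf hπ (inducedTrans_nonneg hconf)
    (sum_inducedTrans_le_one q') (inducedTrans_mul hconf)
  have h6 : ∑ x, ∑ a, pairOcc (E.occ (π (t + 1))) x a *
        ∑ x', |inducedTrans E q' x a x' - E.P x a x'|
      ≤ ∑ x, ∑ a, pairOcc (E.occ (π (t + 1))) x a * transError E T δ x (visitCount H t x a) :=
    Finset.sum_le_sum fun x _ => Finset.sum_le_sum fun a _ =>
      mul_le_mul_of_nonneg_left (sum_abs_inducedTrans_sub_le hconf (by linarith) hP
        (h.sum_empTrans_le_one ht.le) x a) (E.pairOcc_occ_nonneg hπ.1 x a)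
  have h7 := h5.trans (mul_le_mul_of_nonneg_left h6 (Nat.cast_nonneg L))
  have e : pairing (fun x a => E.avgReward T x a + 2 * rewardWidth T δ C H t x a)
        (E.occ (π (t + 1)))
        + 3 * (L * ∑ x, ∑ a, pairOcc (E.occ (π (t + 1))) x a *
          transError E T δ x (visitCount H t x a))
      = pairing (E.avgReward T) (E.occ (π (t + 1)))
      + ∑ x, ∑ a, regretWeight E T δ C x a (visitCount H t x a) *
        pairOcc (E.occ (π (t + 1))) x a := by
    unfold pairing
    simp only [Finset.mul_sum, ← Finset.sum_add_distrib]
    refine Finset.sum_congr rfl fun x _ => Finset.sum_congr rfl fun a _ => ?_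
    unfold regretWeight
    rw [show rewardWidth T δ C H t x a = visitWidth X A T δ C (visitCount H t x a) from rfl]
    ring
  linarith

open Classical in
/-- The successor layers of the states visited in one episode are disjoint, so that an episode
contributes at most the number of states. -/
lemma sum_nextCard_mul_visitCount_le (h : IsTypicalRun E T δ w b H π) :
    ∑ x, ∑ a, (nextCard E x : ℝ) * visitCount H T x a ≤ T * Fintype.card X := by
  have e : ∑ x, ∑ a, (nextCard E x : ℝ) * visitCount H T x a
      = ∑ j ∈ Finset.range T, ∑ x, ∑ a,
        (if (H (j + 1)).traj.Visits x a then (1 : ℝ) else 0) * |(nextCard E x : ℝ)| := by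
    simp_rw [visitCount_eq_sum, Finset.mul_sum, Nat.abs_cast, mul_comm (nextCard E _ : ℝ)]
    rw [Finset.sum_congr rfl fun x _ => Finset.sum_comm, Finset.sum_comm]
  rw [e]
  have h1 : ∀ j ∈ Finset.range T, ∑ x, ∑ a,
      (if (H (j + 1)).traj.Visits x a then (1 : ℝ) else 0) * |(nextCard E x : ℝ)|
      ≤ Fintype.card X := by
    intro j hj
    refine ((H (j + 1)).traj.sum_visits_mul_le fun x => (nextCard E x : ℝ)).trans ?_
    have hlay := h.layered j (Finset.mem_range.1 hj)
    simp_rw [Nat.abs_cast]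
    rw [← Nat.cast_sum]
    norm_cast
    have h2 : ∀ k : Fin L, nextCard E ((H (j + 1)).traj.1 k.castSucc)
        = (Finset.univ.filter fun x => E.layer x = k.succ).card := by
      intro k
      unfold nextCard
      rw [hlay k.castSucc]
      congr 1
      ext x
      simp [Fin.ext_iff]
    simp_rw [h2]
    rw [← Finset.card_biUnion]
    · exact Finset.card_le_univ _
    · intro k _ k' _ hne
      rw [Function.onFun, Finset.disjoint_filter]
      intro x _ hk hk'
      exact hne (Fin.succ_injective _ (hk.symm.trans hk'))
  refine (Finset.sum_le_sum h1).trans (le_of_eq ?_)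
  simp

/-- The sum of the contributions of all the visits. The arithmetic-geometric mean inequality
`√(d N) ≤ (√T + d N / √T) / 2`, for `N` visits to a pair with `d` possible successors, avoids the
factor that the separate bounds for `d` and `N` would cost. -/
lemma sum_regretWeight_le (h : IsTypicalRun E T δ w b H π) (hT : 0 < T) (hC : 0 ≤ C)
    (hA : 0 < Fintype.card A) (hl : 0 ≤ logTerm X A T δ)
    (hlog : Real.log (2 * T * Fintype.card X * Fintype.card A / δ) ≤ 2 * logTerm X A T δ) :
    ∑ x, ∑ a, ∑ n ∈ Finset.range (visitCount H T x a), regretWeight E T δ C x a n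
      ≤ (168 * L + 8) * (Fintype.card X * Fintype.card A * √(T * logTerm X A T δ))
        + (6 + 2 * Real.log T) * (Fintype.card X * Fintype.card A * C) := by
  set l := logTerm X A T δ with hldef
  have hT' : (0 : ℝ) < T := by exact_mod_cast hT
  have hA' : (1 : ℝ) ≤ Fintype.card A := by exact_mod_cast hA
  have hsT : 0 < √(T : ℝ) := Real.sqrt_pos.2 hT'
  have hsT2 : √(T : ℝ) ^ 2 = T := Real.sq_sqrt hT'.le
  have hN : ∀ x a, (visitCount H T x a : ℝ) ≤ T := fun x a => by
    exact_mod_cast visitCount_le H T x a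
  have hD1 : ∀ n : ℕ, (n : ℝ) + 1 ≤ 3 * max 1 ((n : ℝ) - 1) := fun n => by
    rcases Nat.lt_or_ge n 3 with h1 | h1
    · have : (n : ℝ) ≤ 2 := by exact_mod_cast (by omega : n ≤ 2)
      linarith [le_max_left 1 ((n : ℝ) - 1)]
    · have : (3 : ℝ) ≤ n := by exact_mod_cast h1
      linarith [le_max_right 1 ((n : ℝ) - 1)]
  have hD2 : ∀ n : ℕ, (n : ℝ) + 1 ≤ 3 * max (n : ℝ) 1 := fun n => by
    linarith [le_max_left (n : ℝ) 1, le_max_right (n : ℝ) 1]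
  have hpair : ∀ x a, ∑ n ∈ Finset.range (visitCount H T x a), regretWeight E T δ C x a n
      ≤ 168 * L * √l * √(nextCard E x * visitCount H T x a) + 8 * √l * √T
        + (6 + 2 * Real.log T) * C := by
    intro x a
    set N := visitCount H T x a with hNdef
    have h1 : ∀ n : ℕ, regretWeight E T δ C x a n
        ≤ 42 * L * (√(nextCard E x) * √l) * (1 / √(max 1 ((n : ℝ) - 1)))
          + 2 * √l * (1 / √(max (n : ℝ) 1)) + 2 * C * (1 / max (n : ℝ) 1) + 2 * (C / T) := by
      intro n
      have h2 : transError E T δ x n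
          ≤ 14 * (√(nextCard E x) * √l * (1 / √(max 1 ((n : ℝ) - 1)))) := by
        refine (min_le_right _ _).trans (le_of_eq ?_)
        rw [← hldef, Real.sqrt_div (by positivity), Real.sqrt_mul (Nat.cast_nonneg _)]
        ring
      have h3 : visitWidth X A T δ C n
          ≤ √l * (1 / √(max (n : ℝ) 1)) + C * (1 / max (n : ℝ) 1) + C / T := by
        refine (min_le_right _ _).trans ?_
        rw [mul_one_div C, mul_one_div, ← Real.sqrt_div hl]
        refine add_le_add_left (add_le_add_left (Real.sqrt_le_sqrt ?_) _) _
        rw [← div_div]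
        refine div_le_div_of_nonneg_right ?_ (by positivity)
        linarith
      have h4 := mul_le_mul_of_nonneg_left h2 (by positivity : (0 : ℝ) ≤ 3 * L)
      unfold regretWeight
      linarith
    refine (Finset.sum_le_sum fun n _ => h1 n).trans ?_
    rw [Finset.sum_add_distrib, Finset.sum_add_distrib, Finset.sum_add_distrib,
      ← Finset.mul_sum, ← Finset.mul_sum, ← Finset.mul_sum, Finset.sum_const, Finset.card_range,
      nsmul_eq_mul]
    have s1 := mul_le_mul_of_nonneg_left (sum_one_div_sqrt_le hD1 N)
      (by positivity : 0 ≤ 42 * L * (√(nextCard E x : ℝ) * √l))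
    have s2 := mul_le_mul_of_nonneg_left (sum_one_div_sqrt_le hD2 N)
      (by positivity : 0 ≤ 2 * √l)
    have s3 := mul_le_mul_of_nonneg_left (sum_one_div_max_le (visitCount_le H T x a))
      (by positivity : 0 ≤ 2 * C)
    have s4 : (N : ℝ) * (2 * (C / T)) ≤ 2 * C := by
      have : (N : ℝ) * (2 * (C / T)) = 2 * C * (N / T) := by ring
      rw [this]
      exact mul_le_of_le_one_right (by positivity) ((div_le_one hT').2 (hN x a))
    have s5 : √(N : ℝ) ≤ √T := Real.sqrt_le_sqrt (hN x a)
    have s6 := mul_le_mul_of_nonneg_left s5 (by positivity : 0 ≤ 8 * √l)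
    rw [Real.sqrt_mul (Nat.cast_nonneg _)]
    linarith
  have hAMGM : ∀ x a, √((nextCard E x : ℝ) * visitCount H T x a)
      ≤ (√T + nextCard E x * visitCount H T x a / √T) / 2 := by
    intro x a
    set y : ℝ := nextCard E x * visitCount H T x a
    have hy : 0 ≤ y := by positivity
    have hy2 : √y ^ 2 = y := Real.sq_sqrt hy
    rw [le_div_iff₀ two_pos, ← mul_le_mul_iff_left₀ hsT, add_mul, div_mul_cancel₀ _ hsT.ne']
    nlinarith [sq_nonneg (√y - √(T : ℝ))]
  have hsum : ∑ x, ∑ a, √((nextCard E x : ℝ) * visitCount H T x a)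
      ≤ Fintype.card X * Fintype.card A * √T := by
    refine (Finset.sum_le_sum fun x _ => Finset.sum_le_sum fun a _ => hAMGM x a).trans ?_
    simp_rw [← Finset.sum_div, Finset.sum_add_distrib, ← Finset.sum_div]
    have h1 := h.sum_nextCard_mul_visitCount_le
    simp only [Finset.sum_const, Finset.card_univ, nsmul_eq_mul]
    have h2 : (∑ x, ∑ a, (nextCard E x : ℝ) * visitCount H T x a) / √T
        ≤ Fintype.card X * Fintype.card A * √T := by
      rw [div_le_iff₀ hsT]
      refine h1.trans ?_
      have : (T : ℝ) * Fintype.card X ≤ T * Fintype.card X * Fintype.card A :=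
        le_mul_of_one_le_right (by positivity) hA'
      rw [mul_assoc _ √(T : ℝ), ← sq, hsT2]
      linarith
    linarith
  refine (Finset.sum_le_sum fun x _ => Finset.sum_le_sum fun a _ => hpair x a).trans ?_
  simp_rw [Finset.sum_add_distrib, ← Finset.mul_sum]
  simp only [Finset.sum_const, Finset.card_univ, nsmul_eq_mul]
  have h1 := mul_le_mul_of_nonneg_left hsum (by positivity : 0 ≤ 168 * L * √l)
  rw [Real.sqrt_mul hT'.le]
  linarith

end IsTypicalRun

lemma le_card_of_layering (E : Environment X A m L) (p : X → A → ℝ) (hp : IsPolicy p) :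
    L ≤ Fintype.card X := by
  have hsurj : ∀ k : Fin L, ∃ x, (E.layer x : ℕ) = k := by
    intro k
    by_contra! hk
    have h1 := E.sum_stateOcc_occ hp k.2
    rw [Finset.filter_false_of_mem fun x _ => hk x, Finset.sum_empty] at h1
    exact zero_ne_one h1
  choose f hf using hsurj
  have hinj : Function.Injective f := fun k k' hkk => Fin.ext (by rw [← hf k, ← hf k', hkk])
  simpa using Fintype.card_le_of_injective f hinj

/-- The regret is at most `D` if it is at most `D` with respect to every feasible benchmark. -/
lemma regret_le_of_forall (hne : (E.feasibleSet (E.avgCost T)).Nonempty) {D : ℝ} (hT : 0 < T)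
    (h : ∀ q ∈ E.feasibleSet (E.avgCost T), T * pairing (E.avgReward T) q
      - ∑ t ∈ Finset.Icc 1 T, pairing (E.meanReward t) (E.occ (π t)) ≤ D) :
    E.regret T π ≤ D := by
  have hT' : (0 : ℝ) < T := by exact_mod_cast hT
  unfold Environment.regret Environment.opt
  rw [sub_le_iff_le_add, ← le_div_iff₀' hT']
  refine csSup_le (hne.image _) ?_
  rintro _ ⟨q, hq, rfl⟩
  rw [le_div_iff₀' hT', ← sub_le_iff_le_add]
  exact h q hq

/-- The regret of a run of one episode is at most `L`. -/
lemma regret_one_le (hne : (E.feasibleSet (E.avgCost 1)).Nonempty) (hπ : IsPolicy (π 1)) :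
    E.regret 1 π ≤ L := by
  refine regret_le_of_forall hne one_pos fun q hq => ?_
  obtain ⟨⟨p, hp, rfl⟩, -⟩ := hq
  have h1 := pairing_occ_le (E := E) hp fun x a => (E.avgReward_mem one_pos x a).2
  have h2 := pairing_occ_nonneg (E := E) hπ fun x a => (E.meanReward_mem 1 x a).1
  simp only [Finset.Icc_self, Finset.sum_singleton, Nat.cast_one, one_mul]
  linarith

/-- The policies are compared with the benchmark for the average reward, whereas the regret involves
the mean rewards of the episodes; the difference is paid by the corruption. -/
lemma sum_pairing_avg_sub_mean_le (hπ : ∀ t < T, IsPolicy (π (t + 1))) (hT : 0 < T)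
    (hC : E.corruption T ≤ C) :
    ∑ t ∈ Finset.Icc 1 T, pairing (E.avgReward T) (E.occ (π t))
      - ∑ t ∈ Finset.Icc 1 T, pairing (E.meanReward t) (E.occ (π t)) ≤ 2 * C := by
  refine le_trans ?_ (E.sum_abs_meanReward_sub_avg_le hT hC)
  rw [← Finset.sum_sub_distrib]
  refine Finset.sum_le_sum fun t ht => ?_
  obtain ⟨h1, h2⟩ := Finset.mem_Icc.1 ht
  have hp : IsPolicy (π t) := by
    have := hπ (t - 1) (by omega)
    rwa [Nat.sub_add_cancel h1] at this
  unfold pairing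
  rw [← Finset.sum_sub_distrib]
  refine Finset.sum_le_sum fun x _ => ?_
  rw [← Finset.sum_sub_distrib]
  refine Finset.sum_le_sum fun a _ => ?_
  rw [← sub_mul, abs_sub_comm]
  exact (mul_le_mul_of_nonneg_right (le_abs_self _) (E.pairOcc_occ_nonneg hp x a)).trans
    (mul_le_of_le_one_right (abs_nonneg _) (E.pairOcc_occ_le_one hp x a))

/-- The first episode is bounded by `L`, the later ones by their regret weights. Replacing the
occupancy measures in the latter by visits costs a term of order `L ^ 2 √(T log)`, which is
acceptable because `L ≤ |X|`. -/
lemma IsTypicalRun.regret_le (hT : 2 ≤ T) (hL : 0 < L)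
    (h : IsTypicalRun E T δ (regretWeight E T δ C) (8 * L) H π)
    (halg : IsNSSOPS E.toLayering E.α T δ C H π)
    (hne : (E.feasibleSet (E.avgCost T)).Nonempty) (hC : E.corruption T ≤ C)
    (hA : 0 < Fintype.card A)
    (hlog2 : 2 ≤ Real.log (2 * T * Fintype.card X * Fintype.card A / δ))
    (hlog : Real.log (2 * T * Fintype.card X * Fintype.card A / δ) ≤ 2 * logTerm X A T δ)
    (hl : 1 ≤ logTerm X A T δ) :
    E.regret T π ≤ 200 * (L * Fintype.card X * Fintype.card A * √(T * logTerm X A T δ)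
      + Real.log T * Fintype.card X * Fintype.card A * C) := by
  classical
  have hT0 : 0 < T := by omega
  have hC0 : 0 ≤ C := (E.corruption_nonneg T).trans hC
  have hT2 : (2 : ℝ) ≤ T := by exact_mod_cast hT
  have hL1 : (1 : ℝ) ≤ L := by exact_mod_cast hL
  have hA1 : (1 : ℝ) ≤ Fintype.card A := by exact_mod_cast hA
  have hX : (L : ℝ) ≤ Fintype.card X := by
    exact_mod_cast le_card_of_layering E (π 1) halg.1
  set l := logTerm X A T δ with hldef
  set cX : ℝ := (Fintype.card X : ℝ) with hcX
  set cA : ℝ := (Fintype.card A : ℝ) with hcA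
  have hlogT : (2 : ℝ) / 3 ≤ Real.log T := by
    have h1 := Real.log_two_gt_d9
    have h2 : Real.log 2 ≤ Real.log T := Real.log_le_log two_pos hT2
    linarith
  -- The regret with respect to a benchmark, with the weights of the visits.
  have hbench : E.regret T π ≤ L + 2 * C + ∑ t ∈ Finset.range T, ∑ x, ∑ a,
      regretWeight E T δ C x a (visitCount H t x a) * pairOcc (E.occ (π (t + 1))) x a := by
    refine regret_le_of_forall hne hT0 fun q hq => ?_
    have hcorr := sum_pairing_avg_sub_mean_le (E := E) h.policy hT0 hC
    have hep : ∀ t ∈ Finset.range T, pairing (E.avgReward T) q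
        ≤ pairing (E.avgReward T) (E.occ (π (t + 1))) + (∑ x, ∑ a,
          regretWeight E T δ C x a (visitCount H t x a) * pairOcc (E.occ (π (t + 1))) x a)
          + if t = 0 then (L : ℝ) else 0 := by
      intro t ht
      have htT := Finset.mem_range.1 ht
      rcases Nat.eq_zero_or_pos t with h0 | h0
      · rw [if_pos h0]
        obtain ⟨⟨p, hp, rfl⟩, -⟩ := hq
        have h1 := pairing_occ_le (E := E) hp fun x a => (E.avgReward_mem hT0 x a).2
        have h2 := pairing_occ_nonneg (E := E) (h.policy t htT)
          fun x a => (E.avgReward_mem hT0 x a).1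
        have h3 : 0 ≤ ∑ x, ∑ a, regretWeight E T δ C x a (visitCount H t x a) *
            pairOcc (E.occ (π (t + 1))) x a :=
          Finset.sum_nonneg fun x _ => Finset.sum_nonneg fun a _ =>
            mul_nonneg (regretWeight_nonneg hC0 x a _)
              (E.pairOcc_occ_nonneg (h.policy t htT) x a)
        linarith
      · rw [if_neg h0.ne', add_zero]
        obtain ⟨q', hq', hπ'⟩ := halg.2 t h0 htT
        exact h.pairing_le_add_regretWeight hT0 hC hlog2 (by linarith) htT hq hq' hπ'
    have hs := Finset.sum_le_sum hep
    rw [Finset.sum_add_distrib, Finset.sum_add_distrib, Finset.sum_ite_eq',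
      if_pos (Finset.mem_range.2 hT0), Finset.sum_const, Finset.card_range, nsmul_eq_mul] at hs
    rw [sum_Icc_one_eq_sum_range (fun t => pairing (E.avgReward T) (E.occ (π t)))] at hcorr
    linarith
  have hdev := h.visits_dev
  simp_rw [mul_sub, Finset.sum_sub_distrib] at hdev
  have hvis : ∑ t ∈ Finset.range T, ∑ x, ∑ a, regretWeight E T δ C x a (visitCount H t x a) *
      (if (H (t + 1)).traj.Visits x a then (1 : ℝ) else 0)
      = ∑ x, ∑ a, ∑ n ∈ Finset.range (visitCount H T x a), regretWeight E T δ C x a n := by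
    rw [Finset.sum_comm]
    refine Finset.sum_congr rfl fun x _ => ?_
    rw [Finset.sum_comm]
    exact Finset.sum_congr rfl fun a _ => sum_visits_comp_visitCount H _ T x a
  rw [hvis, ← hldef] at hdev
  have hsum := h.sum_regretWeight_le hT0 hC0 hA (by linarith) hlog
  rw [← hldef, ← hcX, ← hcA] at hsum
  set S := √((T : ℝ) * l) with hS
  have hS1 : 1 ≤ S := by
    rw [hS, Real.one_le_sqrt]
    nlinarith
  have hazuma : 8 * (L : ℝ) * L * √(2 * T * l) ≤ 12 * (L * cX * cA * S) := by
    have h1 : √(2 * T * l) ≤ 3 / 2 * S := by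
      rw [mul_assoc, Real.sqrt_mul two_pos.le]
      refine mul_le_mul_of_nonneg_right ?_ (by positivity)
      rw [Real.sqrt_le_left (by norm_num)]
      norm_num
    have h2 : (L : ℝ) * S ≤ cX * cA * S := by
      refine mul_le_mul_of_nonneg_right ?_ (by positivity)
      exact hX.trans (le_mul_of_one_le_right (by positivity) hA1)
    calc 8 * (L : ℝ) * L * √(2 * T * l) ≤ 8 * (L : ℝ) * L * (3 / 2 * S) := by gcongr
      _ = 12 * L * (L * S) := by ring
      _ ≤ 12 * L * (cX * cA * S) := by gcongr
      _ = _ := by ring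
  have hXA : 1 ≤ cX * cA := one_le_mul_of_one_le_of_one_le (hL1.trans hX) hA1
  have hXAS : cX * cA * S ≤ L * cX * cA * S := by
    rw [mul_assoc (L : ℝ), mul_assoc (L : ℝ)]
    exact le_mul_of_one_le_left (by positivity) hL1
  have hLS : (L : ℝ) ≤ L * cX * cA * S := by
    have : 1 ≤ cX * cA * S := one_le_mul_of_one_le_of_one_le hXA hS1
    calc (L : ℝ) ≤ L * (cX * cA * S) := le_mul_of_one_le_right (by positivity) this
      _ = _ := by ring
  have hCX : C ≤ cX * cA * C := le_mul_of_one_le_left hC0 hXA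
  have hlogC : 2 / 3 * (cX * cA * C) ≤ Real.log T * (cX * cA * C) :=
    mul_le_mul_of_nonneg_right hlogT (by positivity)
  have hXAC : 0 ≤ cX * cA * C := by positivity
  have hB : 0 ≤ L * cX * cA * S := by positivity
  linarith

end Regret

/-! ### Probability of a typical run -/

section Typical

variable {X : Type u} {A : Type v} [Fintype X] [Fintype A] [DecidableEq X] [DecidableEq A]
  {m L T : ℕ} {E : Environment X A m L}
  {Ω : Type w} {mΩ : MeasurableSpace Ω} {μ : Measure Ω} [IsProbabilityMeasure μ]
  {ℋ : Filtration ℕ mΩ} {π : ℕ → Ω → X → A → ℝ} {H : ℕ → Ω → Episode X A m L} {δ : ℝ}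

/-- Hoeffding's lemma for variables in `[0, 1]` and their opposites. -/
lemma integral_exp_mul_sub_le {f : Ω → ℝ} (hf : AEMeasurable f μ)
    (h : ∀ᵐ ω ∂μ, f ω ∈ Set.Icc (0 : ℝ) 1) {c : ℝ} (hc : ∫ ω, f ω ∂μ = c) (l : ℝ) :
    ∫ ω, Real.exp (l * (f ω - c)) ∂μ ≤ Real.exp (l ^ 2 / 8) := by
  have := (hasSubgaussianMGF_of_mem_Icc hf h).mgf_le l
  rw [mgf, hc] at this
  refine this.trans (Real.exp_le_exp.2 (le_of_eq ?_))
  norm_num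
  ring

lemma measureReal_iUnion_fin_le {ι : Type*} [Fintype ι] {s : ι → Set Ω} {c : ℝ}
    (h : ∀ i, μ.real (s i) ≤ c) : μ.real (⋃ i, s i) ≤ Fintype.card ι * c := by
  refine (measureReal_iUnion_fintype_le s).trans ((Finset.sum_le_sum fun i _ => h i).trans ?_)
  simp

lemma sum_ite_neg (s : Finset ℕ) (p : ℕ → Prop) [DecidablePred p] (f : ℕ → ℝ) :
    ∑ j ∈ s, (if p j then -f j else 0) = -∑ j ∈ s, if p j then f j else 0 := by
  rw [← Finset.sum_neg_distrib]
  exact Finset.sum_congr rfl fun j _ => by split_ifs <;> simp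

open Classical in
/-- A union bound over the number of visits: deviations of sums over the first `n` visits, for every
fixed `n`, control the sums over all visits before any episode. -/
lemma exists_measureReal_le_sum_visits {ι : Type*} [Fintype ι] (H : ℕ → Ω → Episode X A m L)
    (V : ι → ℕ → Ω → ℝ) (x : ι → X) (a : ι → A) (r : ι → ℕ → ℝ) {c : ℝ}
    (h : ∀ i n, 0 < n → μ.real {ω | r i n < ∑ t ∈ Finset.range T,
      if visitCount (fun τ => H τ ω) t (x i) (a i) < n ∧ (H (t + 1) ω).traj.Visits (x i) (a i)
        then V i t ω else 0} ≤ c) :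
    ∃ B : Set Ω, μ.real B ≤ Fintype.card ι * T * c ∧ ∀ ω, ω ∉ B → ∀ i, ∀ t ≤ T,
      0 < visitCount (fun τ => H τ ω) t (x i) (a i) →
        ∑ j ∈ Finset.range t, (if (H (j + 1) ω).traj.Visits (x i) (a i) then V i j ω else 0)
          ≤ r i (visitCount (fun τ => H τ ω) t (x i) (a i)) := by
  refine ⟨⋃ p : ι × Fin T, {ω | r p.1 (p.2 + 1) < ∑ t ∈ Finset.range T,
      if visitCount (fun τ => H τ ω) t (x p.1) (a p.1) < p.2 + 1 ∧
        (H (t + 1) ω).traj.Visits (x p.1) (a p.1) then V p.1 t ω else 0}, ?_, ?_⟩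
  · refine (measureReal_iUnion_fin_le fun p : ι × Fin T => h p.1 (p.2 + 1) (Nat.succ_pos _)).trans
      (le_of_eq ?_)
    simp
  intro ω hω i t ht hpos
  have hle := visitCount_le (fun τ => H τ ω) t (x i) (a i)
  obtain ⟨n, hn⟩ := Nat.exists_eq_succ_of_ne_zero hpos.ne'
  have hnT : n < T := by omega
  simp only [Set.mem_iUnion, Set.mem_ofPred_eq, not_exists, not_lt] at hω
  have h2 := hω (i, ⟨n, hnT⟩)
  rw [hn]
  exact (sum_first_visits (fun τ => H τ ω) (fun t => V i t ω) (x i) (a i) ht hn).symm.trans_le h2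

namespace Environment.IsInteraction

lemma reward_mem_ae (hI : E.IsInteraction T μ ℋ π H) {t : ℕ} (ht : t < T) :
    ∀ᵐ ω ∂μ, ∀ x a, (H (t + 1) ω).reward x a ∈ Set.Icc (0 : ℝ) 1 := by
  have h1 := E.rewardLaw_mem (t + 1)
  rw [← hI.reward_law t ht] at h1
  exact ae_of_ae_map ((hI.reward_measurable t ht).mono (ℋ.le _) le_rfl).aemeasurable h1

lemma cost_mem_ae (hI : E.IsInteraction T μ ℋ π H) {t : ℕ} (ht : t < T) :
    ∀ᵐ ω ∂μ, ∀ i x a, (H (t + 1) ω).cost i x a ∈ Set.Icc (0 : ℝ) 1 := by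
  have h1 := E.costLaw_mem (t + 1)
  rw [← hI.cost_law t ht] at h1
  exact ae_of_ae_map ((hI.cost_measurable t ht).mono (ℋ.le _) le_rfl).aemeasurable h1

lemma integral_reward (hI : E.IsInteraction T μ ℋ π H) {t : ℕ} (ht : t < T) (x : X) (a : A) :
    ∫ ω, (H (t + 1) ω).reward x a ∂μ = E.meanReward (t + 1) x a := by
  unfold Environment.meanReward
  rw [← hI.reward_law t ht, integral_map
    ((hI.reward_measurable t ht).mono (ℋ.le _) le_rfl).aemeasurable]
  exact Measurable.aestronglyMeasurable (by fun_prop)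

lemma integral_cost (hI : E.IsInteraction T μ ℋ π H) {t : ℕ} (ht : t < T) (i : Fin m) (x : X)
    (a : A) : ∫ ω, (H (t + 1) ω).cost i x a ∂μ = E.meanCost (t + 1) i x a := by
  unfold Environment.meanCost
  rw [← hI.cost_law t ht, integral_map
    ((hI.cost_measurable t ht).mono (ℋ.le _) le_rfl).aemeasurable]
  exact Measurable.aestronglyMeasurable (by fun_prop)

open Classical in
lemma measureReal_reward_upper (hI : E.IsInteraction T μ ℋ π H) (x : X) (a : A) {n : ℕ}
    (hn : 0 < n) {c : ℝ} (hc : 0 < c) :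
    μ.real {ω | √(n * c / 2) < ∑ t ∈ Finset.range T,
      if visitCount (fun τ => H τ ω) t x a < n ∧ (H (t + 1) ω).traj.Visits x a
        then (H (t + 1) ω).reward x a - E.meanReward (t + 1) x a else 0} ≤ Real.exp (-c) := by
  refine hI.measureReal_hoeffding x a hn (f := fun t z => z.1 x a - E.meanReward (t + 1) x a)
    (fun t => by fun_prop) (fun t ht => ⟨1, ?_⟩) (fun t ht l => ?_) hc
  · filter_upwards [hI.reward_mem_ae ht] with ω hω
    have h1 := hω x a
    have h2 := E.meanReward_mem (t + 1) x a
    rw [abs_le]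
    constructor <;> linarith [h1.1, h1.2, h2.1, h2.2]
  · have hm := (hI.reward_measurable t ht).mono (ℋ.le _) le_rfl
    exact integral_exp_mul_sub_le (Measurable.aemeasurable (by fun_prop))
      ((hI.reward_mem_ae ht).mono fun ω hω => hω x a) (hI.integral_reward ht x a) l

open Classical in
lemma measureReal_reward_lower (hI : E.IsInteraction T μ ℋ π H) (x : X) (a : A) {n : ℕ}
    (hn : 0 < n) {c : ℝ} (hc : 0 < c) :
    μ.real {ω | √(n * c / 2) < ∑ t ∈ Finset.range T,
      if visitCount (fun τ => H τ ω) t x a < n ∧ (H (t + 1) ω).traj.Visits x a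
        then -((H (t + 1) ω).reward x a - E.meanReward (t + 1) x a) else 0} ≤ Real.exp (-c) := by
  refine hI.measureReal_hoeffding x a hn
    (f := fun t z => -(z.1 x a - E.meanReward (t + 1) x a))
    (fun t => by fun_prop) (fun t ht => ⟨1, ?_⟩) (fun t ht l => ?_) hc
  · filter_upwards [hI.reward_mem_ae ht] with ω hω
    have h1 := hω x a
    have h2 := E.meanReward_mem (t + 1) x a
    rw [abs_le]
    constructor <;> linarith [h1.1, h1.2, h2.1, h2.2]
  · have hm := (hI.reward_measurable t ht).mono (ℋ.le _) le_rfl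
    have := integral_exp_mul_sub_le (μ := μ) (f := fun ω => (H (t + 1) ω).reward x a)
      (Measurable.aemeasurable (by fun_prop))
      ((hI.reward_mem_ae ht).mono fun ω hω => hω x a) (hI.integral_reward ht x a) (-l)
    rw [neg_sq] at this
    simpa only [neg_mul, mul_neg] using this

open Classical in
lemma measureReal_cost_upper (hI : E.IsInteraction T μ ℋ π H) (i : Fin m) (x : X) (a : A) {n : ℕ}
    (hn : 0 < n) {c : ℝ} (hc : 0 < c) :
    μ.real {ω | √(n * c / 2) < ∑ t ∈ Finset.range T,
      if visitCount (fun τ => H τ ω) t x a < n ∧ (H (t + 1) ω).traj.Visits x a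
        then (H (t + 1) ω).cost i x a - E.meanCost (t + 1) i x a else 0} ≤ Real.exp (-c) := by
  refine hI.measureReal_hoeffding x a hn (f := fun t z => z.2 i x a - E.meanCost (t + 1) i x a)
    (fun t => by fun_prop) (fun t ht => ⟨1, ?_⟩) (fun t ht l => ?_) hc
  · filter_upwards [hI.cost_mem_ae ht] with ω hω
    have h1 := hω i x a
    have h2 := E.meanCost_mem (t + 1) i x a
    rw [abs_le]
    constructor <;> linarith [h1.1, h1.2, h2.1, h2.2]
  · have hm := (hI.cost_measurable t ht).mono (ℋ.le _) le_rfl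
    exact integral_exp_mul_sub_le (Measurable.aemeasurable (by fun_prop))
      ((hI.cost_mem_ae ht).mono fun ω hω => hω i x a) (hI.integral_cost ht i x a) l

/-- A run is typical with probability at least `1 - 5 δ`: the union bound is taken over the numbers
`n = 1, …, T` of visits. -/
lemma exists_measureReal_le_isTypicalRun (hI : E.IsInteraction T μ ℋ π H) (hT : 2 ≤ T)
    (hL : 0 < L) (hA : 0 < Fintype.card A) (hX : 2 ≤ Fintype.card X) (hδ0 : 0 < δ) (hδ1 : δ < 1)
    {w : X → A → ℕ → ℝ} {b : ℝ} (hb : 0 < b) (hw0 : ∀ x a n, 0 ≤ w x a n)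
    (hwb : ∀ x a n, w x a n ≤ b) :
    ∃ B : Set Ω, μ.real B ≤ 5 * δ ∧
      ∀ᵐ ω ∂μ, ω ∉ B → IsTypicalRun E T δ w b (fun t => H t ω) (fun t => π t ω) := by
  classical
  have hT' : (2 : ℝ) ≤ T := by exact_mod_cast hT
  have hX' : (2 : ℝ) ≤ Fintype.card X := by exact_mod_cast hX
  have hA' : (1 : ℝ) ≤ Fintype.card A := by exact_mod_cast hA
  set cX : ℝ := (Fintype.card X : ℝ) with hcX
  set cA : ℝ := (Fintype.card A : ℝ) with hcA
  have hTX : 4 ≤ T * cX := by nlinarith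
  have hTXA : 4 ≤ T * cX * cA := by nlinarith
  set l := logTerm X A T δ with hldef
  set cr := Real.log (2 * T * cX * cA / δ) with hcr
  set cg := Real.log (2 * m * T * cX * cA / δ) with hcg
  have hδinv : 1 < 1 / δ := one_lt_one_div hδ0 hδ1
  have hl0 : 0 < l := Real.log_pos (by
    rw [lt_div_iff₀ hδ0, ← hcX, ← hcA]; linarith)
  have hcr0 : 0 < cr := Real.log_pos (by rw [lt_div_iff₀ hδ0]; linarith)
  have hexpl : Real.exp (-l) = δ / (T * cX * cA) := by
    rw [hldef, logTerm, Real.exp_neg, Real.exp_log (by positivity), inv_div]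
  have hexpr : Real.exp (-cr) = δ / (2 * T * cX * cA) := by
    rw [hcr, Real.exp_neg, Real.exp_log (by positivity), inv_div]
  have hexp2l : Real.exp (-(2 * l)) ≤ δ / (T * cX * cX * cA) := by
    rw [show -(2 * l) = -l + -l by ring, Real.exp_add, hexpl, div_mul_div_comm,
      div_le_div_iff₀ (by positivity) (by positivity)]
    have h1 : δ * δ ≤ δ := by nlinarith
    have h2 : T * cX * cX * cA ≤ T * cX * cA * (T * cX * cA) := by
      have : T * cX * cA * (T * cX * cA) = T * cX * cX * cA * (T * cA) := by ring
      rw [this]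
      exact le_mul_of_one_le_right (by positivity) (by nlinarith)
    exact mul_le_mul h1 h2 (by positivity) hδ0.le
  have hcard : T * cX * cA = Fintype.card (X × A) * T := by
    rw [Fintype.card_prod]; push_cast; ring
  obtain ⟨B1, hm1, n1⟩ := exists_measureReal_le_sum_visits (μ := μ) (T := T) H
    (fun (p : X × A) t ω => (H (t + 1) ω).reward p.1 p.2 - E.meanReward (t + 1) p.1 p.2)
    Prod.fst Prod.snd (fun _ n => √(n * cr / 2))
    fun p n hn => hI.measureReal_reward_upper p.1 p.2 hn hcr0
  obtain ⟨B2, hm2, n2⟩ := exists_measureReal_le_sum_visits (μ := μ) (T := T) H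
    (fun (p : X × A) t ω => -((H (t + 1) ω).reward p.1 p.2 - E.meanReward (t + 1) p.1 p.2))
    Prod.fst Prod.snd (fun _ n => √(n * cr / 2))
    fun p n hn => hI.measureReal_reward_lower p.1 p.2 hn hcr0
  obtain ⟨B3, hm3, n3⟩ : ∃ B : Set Ω, μ.real B ≤ δ ∧ ∀ ω, ω ∉ B → ∀ i : Fin m × X × A, ∀ t ≤ T,
      0 < visitCount (fun τ => H τ ω) t i.2.1 i.2.2 →
        ∑ j ∈ Finset.range t, (if (H (j + 1) ω).traj.Visits i.2.1 i.2.2 then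
          (H (j + 1) ω).cost i.1 i.2.1 i.2.2 - E.meanCost (j + 1) i.1 i.2.1 i.2.2 else 0)
          ≤ √(visitCount (fun τ => H τ ω) t i.2.1 i.2.2 * cg / 2) := by
    -- For `m = 0` the logarithm `cg` is the junk value `log 0`, but there is nothing to control.
    rcases Nat.eq_zero_or_pos m with hm | hm
    · subst hm
      exact ⟨∅, by simpa using hδ0.le, fun ω _ i => i.1.elim0⟩
    have hm' : (1 : ℝ) ≤ m := by exact_mod_cast hm
    have hcg0 : 0 < cg := Real.log_pos (by
      rw [lt_div_iff₀ hδ0]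
      have : T * cX * cA ≤ m * (T * cX * cA) := le_mul_of_one_le_left (by positivity) hm'
      linarith)
    have hexpg : Real.exp (-cg) = δ / (2 * m * T * cX * cA) := by
      rw [hcg, Real.exp_neg, Real.exp_log (by positivity), inv_div]
    obtain ⟨B, hB, n⟩ := exists_measureReal_le_sum_visits (μ := μ) (T := T) H
      (fun (p : Fin m × X × A) t ω =>
        (H (t + 1) ω).cost p.1 p.2.1 p.2.2 - E.meanCost (t + 1) p.1 p.2.1 p.2.2)
      (fun p => p.2.1) (fun p => p.2.2) (fun _ n => √(n * cg / 2))
      fun p n hn => hI.measureReal_cost_upper p.1 p.2.1 p.2.2 hn hcg0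
    refine ⟨B, hB.trans ?_, n⟩
    rw [hexpg]
    simp only [Fintype.card_prod, Fintype.card_fin]
    push_cast
    rw [← hcX, ← hcA, mul_div_assoc', div_le_iff₀ (by positivity)]
    have : 0 ≤ δ * (m * T * cX * cA) := by positivity
    linarith
  obtain ⟨B4, hm4, n4⟩ := exists_measureReal_le_sum_visits (μ := μ) (T := T) H
    (fun (p : X × X × A) t ω => -((if (H (t + 1) ω).traj.Moves p.1 p.2.2 p.2.1 then (1 : ℝ) else 0)
      - E.P p.1 p.2.2 p.2.1)) (fun p => p.1) (fun p => p.2.2)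
    (fun p n => 2 * √(n * E.P p.1 p.2.2 p.2.1 * l)) (c := Real.exp (-(2 * l))) fun p n hn => by
      simp only [sum_ite_neg]
      exact hI.measureReal_moves_lower p.1 p.2.2 p.2.1 hn hl0
  obtain ⟨B5, hm5, n5⟩ := exists_measureReal_le_sum_visits (μ := μ) (T := T) H
    (fun (p : X × X × A) t ω => (if (H (t + 1) ω).traj.Moves p.1 p.2.2 p.2.1 then (1 : ℝ) else 0)
      - E.P p.1 p.2.2 p.2.1) (fun p => p.1) (fun p => p.2.2)
    (fun p n => 2 * √(n * E.P p.1 p.2.2 p.2.1 * l) + 2 * l)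
    fun p n hn => hI.measureReal_moves_upper p.1 p.2.2 p.2.1 (n := n) hl0
  have hm6 := hI.measureReal_azuma (by omega) hL hb hw0 hwb hl0
  set B6 : Set Ω := {ω | b * L * √(2 * T * l) < ∑ t ∈ Finset.range T, ∑ x, ∑ a,
      w x a (visitCount (fun τ => H τ ω) t x a) * (pairOcc (E.occ (π (t + 1) ω)) x a
        - if (H (t + 1) ω).traj.Visits x a then (1 : ℝ) else 0)} with hB6
  refine ⟨B1 ∪ (B2 ∪ (B3 ∪ (B4 ∪ (B5 ∪ B6)))), ?_, ?_⟩
  · have u1 := measureReal_union_le (μ := μ) B1 (B2 ∪ (B3 ∪ (B4 ∪ (B5 ∪ B6))))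
    have u2 := measureReal_union_le (μ := μ) B2 (B3 ∪ (B4 ∪ (B5 ∪ B6)))
    have u3 := measureReal_union_le (μ := μ) B3 (B4 ∪ (B5 ∪ B6))
    have u4 := measureReal_union_le (μ := μ) B4 (B5 ∪ B6)
    have u5 := measureReal_union_le (μ := μ) B5 B6
    have e1 : (Fintype.card (X × A) : ℝ) * T * Real.exp (-cr) = δ / 2 := by
      rw [hexpr, ← hcard]
      field_simp
    have e2 : (Fintype.card (X × X × A) : ℝ) * T * Real.exp (-(2 * l)) ≤ δ := by
      refine (mul_le_mul_of_nonneg_left hexp2l (by positivity)).trans (le_of_eq ?_)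
      simp only [Fintype.card_prod]
      push_cast
      rw [← hcX, ← hcA]
      field_simp
    have e3 : Real.exp (-l) ≤ δ := by
      rw [hexpl]
      exact div_le_self hδ0.le (by linarith)
    linarith
  have a1 : ∀ᵐ ω ∂μ, ∀ t, t < T → IsPolicy (π (t + 1) ω) :=
    ae_all_iff.2 fun t => Filter.eventually_imp_distrib_left.2 fun ht => hI.policy t ht
  have a2 : ∀ᵐ ω ∂μ, ∀ t, t < T → (H (t + 1) ω).traj.Layered E.toLayering :=
    ae_all_iff.2 fun t => Filter.eventually_imp_distrib_left.2 fun ht => hI.ae_layered ht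
  have a3 : ∀ᵐ ω ∂μ, ∀ t, t < T → ∀ x a, (H (t + 1) ω).reward x a ∈ Set.Icc (0 : ℝ) 1 :=
    ae_all_iff.2 fun t => Filter.eventually_imp_distrib_left.2 fun ht => hI.reward_mem_ae ht
  have a4 : ∀ᵐ ω ∂μ, ∀ t, t < T → ∀ i x a, (H (t + 1) ω).cost i x a ∈ Set.Icc (0 : ℝ) 1 :=
    ae_all_iff.2 fun t => Filter.eventually_imp_distrib_left.2 fun ht => hI.cost_mem_ae ht
  filter_upwards [a1, a2, a3, a4] with ω h1 h2 h3 h4 hω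
  simp only [Set.mem_union, not_or] at hω
  obtain ⟨o1, o2, o3, o4, o5, o6⟩ := hω
  have hmoves : ∀ t x a x', ∑ j ∈ Finset.range t, (if (H (j + 1) ω).traj.Visits x a then
      (if (H (j + 1) ω).traj.Moves x a x' then (1 : ℝ) else 0) - E.P x a x' else 0)
      = moveCount (fun τ => H τ ω) t x a x' - visitCount (fun τ => H τ ω) t x a * E.P x a x' := by
    intro t x a x'
    rw [moveCount_eq_sum, visitCount_eq_sum, Finset.sum_mul, ← Finset.sum_sub_distrib]
    refine Finset.sum_congr rfl fun j _ => ?_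
    by_cases hv : (H (j + 1) ω).traj.Visits x a
    · simp [hv]
    · have : ¬ (H (j + 1) ω).traj.Moves x a x' := fun hm => hv hm.visits
      simp [hv, this]
  refine ⟨h1, h2, h3, h4, fun t ht x a hpos => ?_, fun t ht i x a hpos =>
    n3 ω o3 (i, x, a) t ht hpos, fun t ht x a x' hpos => ?_, fun t ht x a x' hpos => ?_,
    not_lt.1 o6⟩
  · have e1 := n1 ω o1 (x, a) t ht hpos
    have e2 := n2 ω o2 (x, a) t ht hpos
    rw [sum_ite_neg] at e2
    exact abs_le.2 ⟨neg_le.1 e2, e1⟩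
  · have e1 := n4 ω o4 (x, x', a) t ht hpos
    rw [sum_ite_neg, hmoves] at e1
    linarith
  · have e1 := n5 ω o5 (x, x', a) t ht hpos
    rwa [hmoves] at e1

end Environment.IsInteraction
end Typical

/-! ### The regret bound -/

lemma one_sub_le_measureReal_of_ae {Ω : Type w} {mΩ : MeasurableSpace Ω} {μ : Measure Ω}
    [IsProbabilityMeasure μ] {B S : Set Ω} {c : ℝ} (hB : μ.real B ≤ c)
    (h : ∀ᵐ ω ∂μ, ω ∉ B → ω ∈ S) : 1 - c ≤ μ.real S := by
  have h1 : μ Set.univ ≤ μ (B ∪ S) := measure_mono_ae (h.mono fun ω hω _ =>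
    (em (ω ∈ B)).imp id hω)
  have h2 : (1 : ℝ) ≤ μ.real (B ∪ S) := by
    have := ENNReal.toReal_mono (measure_ne_top μ _) h1
    simpa [measureReal_def] using this
  linarith [measureReal_union_le (μ := μ) B S]

/-- The regret bound when there are at least two layers and two episodes. -/
lemma regret_bound_of_two_le {X : Type u} {A : Type v} [Fintype X] [Fintype A] [DecidableEq X]
    [DecidableEq A] {m L T : ℕ} {E : Environment X A m L} {δ C : ℝ} {Ω : Type w}
    {mΩ : MeasurableSpace Ω} {μ : Measure Ω} [IsProbabilityMeasure μ] {ℋ : Filtration ℕ mΩ}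
    {π : ℕ → Ω → X → A → ℝ} {H : ℕ → Ω → Episode X A m L} (hT : 2 ≤ T) (hL : 0 < L)
    (hδ0 : 0 < δ) (hδ1 : δ < 1) (hA : 0 < Fintype.card A)
    (hne : (E.feasibleSet (E.avgCost T)).Nonempty) (hC : E.corruption T ≤ C)
    (hI : E.IsInteraction T μ ℋ π H)
    (halg : ∀ᵐ ω ∂μ, IsNSSOPS E.toLayering E.α T δ C (fun t => H t ω) (fun t => π t ω)) :
    1 - 9 * δ ≤ μ.real {ω | E.regret T (fun t => π t ω) ≤
      200 * (L * Fintype.card X * Fintype.card A * √(T * logTerm X A T δ)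
        + Real.log T * Fintype.card X * Fintype.card A * C)} := by
  have hX := two_le_card E hL
  have hT' : (2 : ℝ) ≤ T := by exact_mod_cast hT
  have hX' : (2 : ℝ) ≤ Fintype.card X := by exact_mod_cast hX
  have hA' : (1 : ℝ) ≤ Fintype.card A := by exact_mod_cast hA
  have hTX : (4 : ℝ) ≤ T * Fintype.card X := by nlinarith
  have hY : (4 : ℝ) ≤ T * Fintype.card X * Fintype.card A / δ := by
    rw [le_div_iff₀ hδ0]; nlinarith
  set Y : ℝ := T * Fintype.card X * Fintype.card A / δ with hYdef
  have e2Y : (2 : ℝ) * T * Fintype.card X * Fintype.card A / δ = 2 * Y := by rw [hYdef]; ring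
  have hln2 := Real.log_two_gt_d9
  have hlog4 : Real.log 4 = 2 * Real.log 2 := by
    rw [show (4 : ℝ) = 2 ^ 2 by norm_num, Real.log_pow]; norm_num
  have hl4 : Real.log 4 ≤ Real.log Y := Real.log_le_log (by norm_num) hY
  have hl : logTerm X A T δ = Real.log Y := rfl
  have hlog : Real.log (2 * T * Fintype.card X * Fintype.card A / δ)
      = Real.log 2 + Real.log Y := by
    rw [e2Y, Real.log_mul two_ne_zero (by linarith)]
  have hC0 : 0 ≤ C := (E.corruption_nonneg T).trans hC
  obtain ⟨B, hB, htyp⟩ := hI.exists_measureReal_le_isTypicalRun hT hL hA hX hδ0 hδ1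
    (w := regretWeight E T δ C) (b := 8 * L) (by positivity)
    (regretWeight_nonneg hC0) (regretWeight_le hL)
  refine one_sub_le_measureReal_of_ae (B := B) (by linarith) ?_
  filter_upwards [htyp, halg] with ω h1 h2 hω
  exact (h1 hω).regret_le hT hL h2 hne hC hA (by rw [hlog]; linarith)
    (by rw [hlog, hl]; linarith) (by rw [hl]; linarith)

end CMDP

theorem theorem2 :
    ∃ K : ℝ, 0 < K ∧
      ∀ (X : Type u) (A : Type v) [Fintype X] [Fintype A] [DecidableEq X] [DecidableEq A]
        (m L T : ℕ) (E : CMDP.Environment X A m L) (δ C : ℝ)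
        (Ω : Type w) (mΩ : MeasurableSpace Ω) (μ : Measure Ω) [IsProbabilityMeasure μ]
        (ℋ : Filtration ℕ mΩ) (π : ℕ → Ω → X → A → ℝ) (H : ℕ → Ω → CMDP.Episode X A m L),
        1 ≤ T → 0 < δ → δ < 1 →
        (E.feasibleSet (E.avgCost T)).Nonempty →
        E.corruption T ≤ C →
        E.IsInteraction T μ ℋ π H →
        (∀ᵐ ω ∂μ, CMDP.IsNSSOPS E.toLayering E.α T δ C (fun t => H t ω) (fun t => π t ω)) →
        1 - 9 * δ ≤ μ.real {ω | E.regret T (fun t => π t ω) ≤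
          K * (L * Fintype.card X * Fintype.card A *
                √(T * Real.log (T * Fintype.card X * Fintype.card A / δ))
              + Real.log T * Fintype.card X * Fintype.card A * C)} := by
  refine ⟨200, by norm_num, ?_⟩
  intro X A _ _ _ _ m L T E δ C Ω mΩ μ _ ℋ π H hT hδ0 hδ1 hne hC hI halg
  have hA : 0 < Fintype.card A := by
    obtain ⟨q, ⟨p, hp, -⟩, -⟩ := hne
    rw [Fintype.card_pos_iff]
    by_contra hA
    rw [not_nonempty_iff] at hA
    simpa using hp.2 E.start
  have hC0 : 0 ≤ C := (E.corruption_nonneg T).trans hC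
  have hlogT : 0 ≤ Real.log T := Real.log_natCast_nonneg T
  -- In the degenerate cases the bound holds almost surely.
  have hdet : (∀ᵐ ω ∂μ, E.regret T (fun t => π t ω) ≤
      200 * (L * Fintype.card X * Fintype.card A *
        √(T * Real.log (T * Fintype.card X * Fintype.card A / δ))
        + Real.log T * Fintype.card X * Fintype.card A * C)) →
      1 - 9 * δ ≤ μ.real {ω | E.regret T (fun t => π t ω) ≤
        200 * (L * Fintype.card X * Fintype.card A *
          √(T * Real.log (T * Fintype.card X * Fintype.card A / δ))
          + Real.log T * Fintype.card X * Fintype.card A * C)} := fun h =>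
    CMDP.one_sub_le_measureReal_of_ae (B := ∅) (by simp; linarith) (h.mono fun ω hω _ => hω)
  rcases Nat.eq_zero_or_pos L with hL | hL
  · subst hL
    refine hdet (Filter.Eventually.of_forall fun ω => ?_)
    have hocc : ∀ p : X → A → ℝ, E.occ p = 0 := fun p => by
      ext x a x'
      simp [CMDP.Environment.occ]
    have h0 : ∀ v : X → A → ℝ, CMDP.pairing v (0 : X → A → X → ℝ) = 0 := fun v => by
      simp [CMDP.pairing, CMDP.pairOcc]
    refine CMDP.regret_le_of_forall hne hT fun q hq => ?_
    obtain ⟨⟨p, hp, rfl⟩, -⟩ := hq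
    simp only [hocc, h0, Finset.sum_const_zero, mul_zero, sub_zero, Nat.cast_zero, zero_mul,
      zero_add]
    positivity
  rcases hT.eq_or_lt with hT1 | hT2
  · subst hT1
    refine hdet ?_
    filter_upwards [halg] with ω hω
    refine (CMDP.regret_one_le hne hω.1).trans ?_
    have hX' : (2 : ℝ) ≤ Fintype.card X := by exact_mod_cast CMDP.two_le_card E hL
    have hA' : (1 : ℝ) ≤ Fintype.card A := by exact_mod_cast hA
    have hXA : (2 : ℝ) ≤ Fintype.card X * Fintype.card A := by nlinarith
    have h1 : (1 / 2 : ℝ) ≤ √((1 : ℕ) * Real.log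
        ((1 : ℕ) * Fintype.card X * Fintype.card A / δ)) := by
      refine Real.le_sqrt_of_sq_le ?_
      have h2 : Real.log 2 ≤ Real.log ((1 : ℕ) * Fintype.card X * Fintype.card A / δ) := by
        refine Real.log_le_log two_pos ?_
        rw [le_div_iff₀ hδ0, Nat.cast_one, one_mul]
        linarith
      have h3 := Real.log_two_gt_d9
      norm_num only [Nat.cast_one, one_mul] at h2 h3 ⊢
      linarith
    set S := √((1 : ℕ) * Real.log ((1 : ℕ) * Fintype.card X * Fintype.card A / δ))
    have h4 : (1 : ℝ) ≤ Fintype.card X * Fintype.card A * S := by nlinarith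
    have h5 : (L : ℝ) ≤ L * (Fintype.card X * Fintype.card A * S) :=
      le_mul_of_one_le_right (Nat.cast_nonneg _) h4
    rw [Nat.cast_one, Real.log_one]
    linarith
  · exact CMDP.regret_bound_of_two_le hT2 hL hδ0 hδ1 hA hne hC hI halg
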